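/- **Setting.** A finite automaton $A=(P,\Sigma,\delta,p_0,p_f)$ has a transition relation $\delta\subseteq P\times\Sigma\times P$, one initial and one final state; $L(A(p,p'))$ is the set of words leading from $p$ to $p'$, $L(A)=L(A(p_0,p_f))$, and $|A|$ is the number of states. A shared memory concurrent program $S=(\Sigma,M,(A_i)_{i\in[1..t]})$ with $t\ge 1$ consists of a memory automaton $M$ with initial state $q_0$, final state $q_f$, and set $Q$ of $m$ states, and of thread automata $A_1,\dots,A_t$, where the letters of $A_i$ are tagged with $i$. Its language $L(S)$ consists of the tagged words $u$ such that $u$ without tags is in $L(M)$ and the projection of $u$ to each thread $i$ is in $L(A_i)\cup\{\varepsilon\}$. A context switch of $u$ is a position at which two consecutive letters have different tags. The problem BCS asks, given $S$ and $cs\in\mathbb N$, whether $L(S)$ contains a word with at most $cs$ context switches. An interface sequence is a word $\sigma=(q_1,q_1')\dots(q_k,q_k')$ over $Q\times Q$. It is valid if $q_1=q_0$, $q_k'=q_f$ and $q_i'=q_{i+1}$ for all $i<k$ (for $k=0$: if $q_0=q_f$). The interface language of thread $i$ is the set of all $\sigma$ with $L(A_i)\cap L(M(q_1,q_1'))\cdots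 L(M(q_k,q_k'))\neq\emptyset$. Let $B_i$ be the automaton over $Q\times Q$ with the states, the initial state and the final state of $A_i$, and with a transition from $p$ to $p'$ labeled $(q,q')$ iff $L(A_i(p,p'))\cap L(M(q,q'))\ne\emptyset$. Let $b=\max_i|B_i|$. A word is in the shuffle of languages $L_1,\dots,L_t$ over a common alphabet if it can be decomposed into disjoint scattered subwords $w_1,\dots,w_t$ with $w_i\in L_i\cup\{\varepsilon\}$. Let $$\mathit{SM}(b,k,t)=2^k\cdot t\cdot k\cdot\bigl(b^2+k\cdot \mathit{bc}(k)\bigr),\qquad \mathit{bc}(k)=k\log k\cdot 2^{O(\log^* k)}.$$ Running times refer to a random access machine: it has a fixed program, registers and a memory of natural numbers, addition, truncated subtraction, indirect loads and stores, comparisons and constants, each at unit cost, and a computation with time bound $T$ may use only words smaller than $T$, that is, of about $\log T$ bits. Instances are given by the transition tables of the automata. **Theorem.** 1. For every $i$, the language of $B_i$ is the interface language of thread $i$. 2. $L(S)$ contains a word with at most $cs$ context switches if and only if some valid interface sequence of length at most $cs+1$ lies in the shuffle of $L(B_1),\dots,L(B_t)$. 3. The automata $B_1,\dots,B_t$ can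 all be computed in time $O(t\cdot m^3\cdot b^3+|\Sigma|\cdot t\cdot m^2\cdot b^2)$. 4. BCS can be solved in time $$O\bigl(m^{cs+1}\cdot \mathit{SM}(b,cs+1,t)+t\cdot m^3\cdot b^3+|\Sigma|\cdot t\cdot m^2\cdot b^2\bigr).$$ The same program runs in time $O^*(m^{cs}\cdot 2^{cs})$, i.e. in time at most $m^{cs}\cdot 2^{cs}\cdot p(|\Sigma|+m+t+\sum_i|A_i|+cs)$ for a polynomial $p$. All constants and the polynomial are independent of the instance and of $\Sigma$. If $\Sigma$ is fixed, or if $|\Sigma|=O(m\cdot b)$, the terms with $|\Sigma|$ are absorbed, so the time in 4 is $O(m^{cs+1}\cdot \mathit{SM}(b,cs+1,t)+t\cdot m^3\cdot b^3)$. -/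

import Mathlib

namespace BCS

/-! ## Automata and shared memory concurrent programs -/

/-- A (nondeterministic) finite automaton with a transition relation, one initial state and one
final state. -/
structure Automaton (α σ : Type) where
  trans : σ → α → σ → Prop
  init : σ
  final : σ

namespace Automaton

variable {α σ : Type}

/-- The automaton as an `NFA` of Mathlib, with initial state `p` and final state `p'`. -/
def toNFA (A : Automaton α σ) (p p' : σ) : NFA α σ where
  step := fun q a => {q' | A.trans q a q'}
  start := {p}
  accept := {p'}

/-- `L(A(p, p'))`: the words that lead from state `p` to state `p'`. -/
def between (A : Automaton α σ) (p p' : σ) : Language α := (A.toNFA p p').accepts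

/-- `L(A) = L(A(init, final))`. -/
def lang (A : Automaton α σ) : Language α := A.between A.init A.final

/-- The size `|A|`: the number of states. -/
def size [Fintype σ] (_A : Automaton α σ) : ℕ := Fintype.card σ

end Automaton

/-- The part of a tagged word that belongs to thread `i`, with the tag removed. -/
def proj {α : Type} {t : ℕ} (i : Fin t) (u : List (α × Fin t)) : List α :=
  (u.filter fun x => x.2 = i).map Prod.fst

/-- The shuffle of `L 0, …, L (t-1)`, where the letters of the `i`-th operand carry the tag `i`
(so that the alphabets are disjoint): every projection lies in `L i ∪ {ε}`. -/
def taggedShuffle {α : Type} {t : ℕ} (L : Fin t → Language α) : Language (α × Fin t) :=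
  {u | ∀ i, proj i u ∈ L i ∨ proj i u = []}

/-- The shuffle of languages over a common alphabet: the words that can be decomposed into
scattered subwords `w i ∈ L i ∪ {ε}`, one for each `i`. -/
def shuffle {α : Type} {t : ℕ} (L : Fin t → Language α) : Language α :=
  {w | ∃ u ∈ taggedShuffle L, u.map Prod.fst = w}

/-- The number of context switches: positions where two consecutive letters belong to different
threads. -/
def contextSwitches {α : Type} {t : ℕ} : List (α × Fin t) → ℕ
  | [] => 0
  | [_] => 0
  | x :: y :: l => (if x.2 = y.2 then 0 else 1) + contextSwitches (y :: l)

/-- A shared memory concurrent program: the alphabet is `Fin s`, the memory automaton has the `m`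
states `Fin m`, and there are `t` threads, the `i`-th with the `n i` states `Fin (n i)`.
Letters of thread `i` are to be read as tagged with `i`. -/
structure SMCP where
  s : ℕ
  m : ℕ
  t : ℕ
  n : Fin t → ℕ
  M : Automaton (Fin s) (Fin m)
  A : (i : Fin t) → Automaton (Fin s) (Fin (n i))

namespace SMCP

/-- `L(S) = L(M) ∩ Ш_i L(A_i)`, where `M` does not see the tags. -/
def lang (S : SMCP) : Language (Fin S.s × Fin S.t) :=
  {u | u.map Prod.fst ∈ S.M.lang ∧ u ∈ taggedShuffle fun i => (S.A i).lang}

/-- Bounded context switching: does `L(S)` contain a word with at most `cs` context switches? -/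
def HasBCS (S : SMCP) (cs : ℕ) : Prop := ∃ u ∈ S.lang, contextSwitches u ≤ cs

/-! ## Interface sequences -/

/-- `IsChain q q' σ`: the pairs in `σ` are linked and lead from `q` to `q'`. -/
def IsChain {Q : Type} : Q → Q → List (Q × Q) → Prop
  | q, q', [] => q = q'
  | q, q', (a, b) :: l => a = q ∧ IsChain b q' l

/-- Valid interface sequences: linked, from the initial to the final state of the memory. -/
def Valid (S : SMCP) (σ : List (Fin S.m × Fin S.m)) : Prop := IsChain S.M.init S.M.final σ

/-- The interface language of thread `i`: the sequences `(q₁, q₁') … (q_k, q_k')` such that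
`L(A_i) ∩ L(M(q₁, q₁')) ⋯ L(M(q_k, q_k'))` is not empty. -/
def interfaceLang (S : SMCP) (i : Fin S.t) : Language (Fin S.m × Fin S.m) :=
  {σ | ∃ u ∈ (S.A i).lang, u ∈ (σ.map fun q => S.M.between q.1 q.2).prod}

/-- The automaton `B_i`: it has the states of `A_i`, and a transition from `p` to `p'` labeled
`(q, q')` if `L(A_i(p, p')) ∩ L(M(q, q'))` is not empty. -/
def B (S : SMCP) (i : Fin S.t) : Automaton (Fin S.m × Fin S.m) (Fin (S.n i)) where
  trans := fun p q p' => ∃ u, u ∈ (S.A i).between p p' ∧ u ∈ S.M.between q.1 q.2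
  init := (S.A i).init
  final := (S.A i).final

/-- `b = max_i |B_i|`. -/
def b (S : SMCP) : ℕ := Finset.univ.sup fun i => (S.B i).size

/-- The size of an instance `(S, cs)`. -/
def instanceSize (S : SMCP) (cs : ℕ) : ℕ :=
  S.s + S.m + S.t + ∑ i, (S.A i).size + cs

end SMCP

/-! ## Random access machines -/

/-- A configuration: registers and random access memory, both holding natural numbers. -/
structure State where
  reg : ℕ → ℕ
  mem : ℕ → ℕ

/-- `σ` with register `x` set to `v`. -/
def State.setReg (σ : State) (x v : ℕ) : State := ⟨Function.update σ.reg x v, σ.mem⟩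

/-- `σ` with memory cell `a` set to `v`. -/
def State.setMem (σ : State) (a v : ℕ) : State := ⟨σ.reg, Function.update σ.mem a v⟩

/-- Programs of a random access machine. `x y z` are names of registers, `c` is a constant. -/
inductive Prog where
  /-- do nothing -/
  | skip
  /-- `x := c` -/
  | const (x c : ℕ)
  /-- `x := y + z` -/
  | add (x y z : ℕ)
  /-- `x := y - z`, truncated at zero -/
  | sub (x y z : ℕ)
  /-- `x := mem[y]` -/
  | load (x y : ℕ)
  /-- `mem[x] := y` -/
  | store (x y : ℕ)
  /-- first `P`, then `P'` -/
  | seq (P P' : Prog)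
  /-- if `x < y` then `P` else `P'` -/
  | cond (x y : ℕ) (P P' : Prog)
  /-- while `x < y` do `P` -/
  | loop (x y : ℕ) (P : Prog)

/-- `Exec W P σ k σ'`: started in `σ`, the program `P` halts in `σ'` after exactly `k` steps, and all
words that it writes, and all addresses that it writes to, are smaller than `W` (a program that
exceeds this bound has no execution). Every elementary instruction and every test takes one step. -/
inductive Exec (W : ℕ) : Prog → State → ℕ → State → Prop
  | skip (σ : State) : Exec W .skip σ 1 σ
  | const (σ : State) (x c : ℕ) (h : c < W) : Exec W (.const x c) σ 1 (σ.setReg x c)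
  | add (σ : State) (x y z : ℕ) (h : σ.reg y + σ.reg z < W) :
      Exec W (.add x y z) σ 1 (σ.setReg x (σ.reg y + σ.reg z))
  | sub (σ : State) (x y z : ℕ) (h : σ.reg y - σ.reg z < W) :
      Exec W (.sub x y z) σ 1 (σ.setReg x (σ.reg y - σ.reg z))
  | load (σ : State) (x y : ℕ) (h : σ.mem (σ.reg y) < W) :
      Exec W (.load x y) σ 1 (σ.setReg x (σ.mem (σ.reg y)))
  | store (σ : State) (x y : ℕ) (ha : σ.reg x < W) (h : σ.reg y < W) :
      Exec W (.store x y) σ 1 (σ.setMem (σ.reg x) (σ.reg y))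
  | seq {P P' : Prog} {σ σ' σ'' : State} {k k' : ℕ} (h : Exec W P σ k σ')
      (h' : Exec W P' σ' k' σ'') : Exec W (.seq P P') σ (k + k') σ''
  | condTrue {x y : ℕ} {P P' : Prog} {σ σ' : State} {k : ℕ} (hc : σ.reg x < σ.reg y)
      (h : Exec W P σ k σ') : Exec W (.cond x y P P') σ (k + 1) σ'
  | condFalse {x y : ℕ} {P P' : Prog} {σ σ' : State} {k : ℕ} (hc : ¬ σ.reg x < σ.reg y)
      (h : Exec W P' σ k σ') : Exec W (.cond x y P P') σ (k + 1) σ'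
  | loopDone {x y : ℕ} {P : Prog} {σ : State} (hc : ¬ σ.reg x < σ.reg y) :
      Exec W (.loop x y P) σ 1 σ
  | loopStep {x y : ℕ} {P : Prog} {σ σ' σ'' : State} {k k' : ℕ} (hc : σ.reg x < σ.reg y)
      (h : Exec W P σ k σ') (h' : Exec W (.loop x y P) σ' k' σ'') :
      Exec W (.loop x y P) σ (k + k' + 1) σ''

/-- The start configuration: the memory holds the list `l` from address `0` on, register `0` holds
`r`, everything else is `0`. -/
def startState (l : List ℕ) (r : ℕ) : State where
  reg := fun x => if x = 0 then r else 0
  mem := fun a => l.getD a 0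

/-- On input `(l, r)`, the program `P` halts within `T` steps, using only words smaller than `T`
(that is, words of about `log T` bits), in a configuration that satisfies `post`. -/
def Prog.RunsWithin (P : Prog) (l : List ℕ) (r T : ℕ) (post : State → Prop) : Prop :=
  ∃ k ≤ T, ∃ σ', Exec T P (startState l r) k σ' ∧ post σ'

/-! ## Encoding of instances -/

open Classical in
/-- The transition relation as a table of zeros and ones, one word for every entry, ordered
lexicographically by source state, letter, target state. -/
noncomputable def table {α σ : Type} (letters : List α) (states : List σ) (A : Automaton α σ) :
    List ℕ :=
  states.flatMap fun p => letters.flatMap fun a => states.map fun p' =>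
    if A.trans p a p' then 1 else 0

namespace SMCP

/-- The encoding of `S`: the numbers `s, m, t`, then the memory automaton, then the threads. -/
noncomputable def encode (S : SMCP) : List ℕ :=
  [S.s, S.m, S.t, S.M.init, S.M.final] ++ table (List.finRange S.s) (List.finRange S.m) S.M ++
    (List.finRange S.t).flatMap fun i =>
      [S.n i, ((S.A i).init : ℕ), ((S.A i).final : ℕ)] ++
        table (List.finRange S.s) (List.finRange (S.n i)) (S.A i)

/-- The transition tables of `B_1, …, B_t`, one after the other. The letters `(q, q')` are ordered
lexicographically. -/
noncomputable def encodeB (S : SMCP) : List ℕ :=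
  (List.finRange S.t).flatMap fun i =>
    table (List.finRange S.m ×ˢ List.finRange S.m) (List.finRange (S.n i)) (S.B i)

/-- `P` decides the instance `(S, cs)` within `T` steps: the input is the encoding of `S` in the
memory and `cs` in register `0`; the answer (`1` for yes and `0` for no) is left in register `0`. -/
def DecidedWithin (S : SMCP) (cs : ℕ) (P : Prog) (T : ℕ) : Prop :=
  P.RunsWithin S.encode cs T fun σ =>
    (S.HasBCS cs → σ.reg 0 = 1) ∧ (¬ S.HasBCS cs → σ.reg 0 = 0)

/-- `P` computes the tables of all `B_i` within `T` steps: it leaves them in consecutive memory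
cells, the first of which has its address in register `0`. -/
def BComputedWithin (S : SMCP) (P : Prog) (T : ℕ) : Prop :=
  P.RunsWithin S.encode 0 T fun σ =>
    ∀ j (hj : j < S.encodeB.length), σ.mem (σ.reg 0 + j) = S.encodeB[j]

end SMCP

/-! ## Running times -/

/-- The iterated logarithm `log* k`: how often `log₂` has to be applied until the value is at
most `1`. -/
noncomputable def logStar (k : ℕ) : ℕ := sInf {j | (Nat.log 2)^[j] k ≤ 1}

/-- `bc(k) = k · log k · 2 ^ (c · log* k)`, the time for multiplying two `k`-bit integers. -/
noncomputable def bc (c k : ℕ) : ℕ := k * Nat.log 2 k * 2 ^ (c * logStar k)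

/-- `SM(b, k, t) = 2 ^ k · t · k · (b² + k · bc(k))`. -/
noncomputable def SM (c b k t : ℕ) : ℕ := 2 ^ k * t * k * (b ^ 2 + k * bc c k)

/-- Preprocessing time: `t · m³ · b³`, plus the number `|Σ| · t · m² · b²` of table entries that
have to be compared when the threads are synchronized with the memory. -/
def SMCP.prepTime (S : SMCP) : ℕ :=
  S.t * S.m ^ 3 * S.b ^ 3 + S.s * S.t * S.m ^ 2 * S.b ^ 2

/-- `m ^ (cs + 1) · SM(b, cs + 1, t)` plus the preprocessing time. -/
noncomputable def SMCP.bcsTime (S : SMCP) (c cs : ℕ) : ℕ :=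
  S.m ^ (cs + 1) * SM c S.b (cs + 1) S.t + S.prepTime

end BCS

/-!
The interface sequences of thread `i` are the words of `B_i` because a word of `A_i` that is cut
into pieces is the same as a run of `A_i` that is cut into pieces (`SMCP.path_B`). Cutting a word
of `L(S)` at its context switches gives a valid interface sequence in the shuffle, and a witness
for every letter of such a sequence gives back a word, with a context switch at most at the joints
(`SMCP.hasBCS_iff`).

The tables of the `B_i` are computed by Warshall's algorithm. `B_i` has a transition from `p` to
`p'` with label `(q, q')` if `(p', q')` is reachable from `(p, q)` in the product of `A_i` and
`M`, a graph with at most `m * b` vertices (`SMCP.B_trans_iff`). Its edges are found by comparing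
transition tables, which costs `|Σ|` per pair of vertices, and its closure, formed in place, costs
`(m * b) ^ 3` (`prep_runs`).

For bounded context switching all interface sequences of length `k = cs + 1` from the initial to
the final memory state are tested. This length suffices unless the empty sequence is valid, since
a nonempty sequence can be padded with copies of the pair of final states, read by a thread that
has already taken part (`SMCP.hasBCS_iff_covers`). Such a sequence is determined by its `cs` inner
memory states, so there are `m ^ cs` of them, and an odometer in base `m` runs through them
(`next_runs`). Whether one of them lies in the shuffle is decided by dynamic programming: thread
by thread, the program keeps the collection of those sets of positions that the threads so far can
share among them (`SMCP.cover`). To add a thread it scans the sequence once, and keeps for every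
set of positions the states that the thread can be in (`SMCP.reach`). Whether a scanned position
goes to the current thread or not is one step of an automaton, so that no products of families of
sets have to be formed. The scan costs `b ^ 2` for every set and position, altogether
`2 ^ k * t * k * b ^ 2`, which is the first summand of `SM b k t`; the remaining
overhead is absorbed by a factor `m` (`check_runs`, `solve_time_le`).

The programs are written in a small structured language of expressions, assignments, tests and
counting loops, with a compiler to the random access machine. Its judgement `Runs` bounds time and
word size along with correctness.
-/

namespace BCS

/-! ### A structured language over the random access machine -/

/-- Names of program variables, each with a number; the distinguished variable `input` has number
`0`, so that it occupies register `0`. -/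
class Vars (V : Type) where
  dec : DecidableEq V
  idx : V → ℕ
  idx_inj : Function.Injective idx
  input : V
  idx_input : idx input = 0

instance {V : Type} [Vars V] : DecidableEq V := Vars.dec

/-- The machine as the structured language sees it: the values of the variables, and the memory. -/
@[ext] structure Store (V : Type) where
  reg : V → ℕ
  mem : ℕ → ℕ

/-- Side-effect-free expressions; `get e` reads the memory cell with address `e`. -/
inductive Expr (V : Type) where
  | lit (c : ℕ)
  | var (x : V)
  | add (e f : Expr V)
  | sub (e f : Expr V)
  | get (e : Expr V)

/-- Structured commands. `ite e f c d` tests `e < f`; `for_ x y c` runs `c` for `x = 0, …, y - 1`.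
-/
inductive Cmd (V : Type) where
  | skip
  | assign (x : V) (e : Expr V)
  | store (e f : Expr V)
  | seq (c d : Cmd V)
  | ite (e f : Expr V) (c d : Cmd V)
  | for_ (x y : V) (c : Cmd V)

section Language

variable {V : Type}

namespace Store

/-- `s` with memory cell `a` set to `v`. -/
def put (s : Store V) (a v : ℕ) : Store V := ⟨s.reg, Function.update s.mem a v⟩

@[simp] theorem put_reg (s : Store V) (a v : ℕ) : (s.put a v).reg = s.reg := rfl

theorem put_mem (s : Store V) (a v b : ℕ) :
    (s.put a v).mem b = if b = a then v else s.mem b := by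
  simp [put, Function.update_apply]

variable [Vars V]

/-- `s` with variable `x` set to `v`. -/
def set (s : Store V) (x : V) (v : ℕ) : Store V := ⟨Function.update s.reg x v, s.mem⟩

@[simp] theorem set_reg_self (s : Store V) (x : V) (v : ℕ) : (s.set x v).reg x = v := by
  simp [set]

@[simp] theorem set_reg_ne (s : Store V) {x y : V} (v : ℕ) (h : y ≠ x) :
    (s.set x v).reg y = s.reg y := by
  simp [set, h]

@[simp] theorem set_mem (s : Store V) (x : V) (v : ℕ) : (s.set x v).mem = s.mem := rfl

end Store

variable [Vars V]

namespace Expr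

/-- The value of an expression; subtraction is truncated. -/
@[simp] def eval (s : Store V) : Expr V → ℕ
  | lit c => c
  | var x => s.reg x
  | add e f => e.eval s + f.eval s
  | sub e f => e.eval s - f.eval s
  | get e => s.mem (e.eval s)

/-- No constant and no sum in the expression reaches `W`. Nothing is required of the other
operations, which cannot produce larger words than they are given. -/
@[simp] def Ok (W : ℕ) (s : Store V) : Expr V → Prop
  | lit c => c < W
  | var _ => True
  | add e f => e.Ok W s ∧ f.Ok W s ∧ e.eval s + f.eval s < W
  | sub e f => e.Ok W s ∧ f.Ok W s
  | get e => e.Ok W s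

/-- The number of steps that the compiled expression takes. -/
@[simp] def cost : Expr V → ℕ
  | lit _ => 1
  | var _ => 2
  | add e f => e.cost + f.cost + 1
  | sub e f => e.cost + f.cost + 1
  | get e => e.cost + 1

/-- Code that leaves the value of the expression in the odd register `2 * r + 1` and uses larger odd
registers for intermediate values. -/
def code (r : ℕ) : Expr V → Prog
  | lit c => .const (2 * r + 1) c
  | var x => .seq (.const (2 * r + 1) 0) (.add (2 * r + 1) (2 * r + 1) (2 * Vars.idx x))
  | add e f => .seq (.seq (e.code r) (f.code (r + 1))) (.add (2 * r + 1) (2 * r + 1) (2 * r + 3))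
  | sub e f => .seq (.seq (e.code r) (f.code (r + 1))) (.sub (2 * r + 1) (2 * r + 1) (2 * r + 3))
  | get e => .seq (e.code r) (.load (2 * r + 1) (2 * r + 1))

end Expr

/-- The store represented by a configuration: variables live in the even registers. -/
def view (σ : State) : Store V := ⟨fun x => σ.reg (2 * Vars.idx x), σ.mem⟩

/-- All words of the configuration are smaller than `W`. Executions preserve this. -/
structure Good (W : ℕ) (σ : State) : Prop where
  one : 1 < W
  reg : ∀ x, σ.reg x < W
  mem : ∀ a, σ.mem a < W

theorem Good.setReg {W : ℕ} {σ : State} (h : Good W σ) (x : ℕ) {v : ℕ} (hv : v < W) :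
    Good W (σ.setReg x v) := by
  refine ⟨h.one, fun y => ?_, h.mem⟩
  simp only [State.setReg, Function.update_apply]
  split_ifs
  exacts [hv, h.reg y]

theorem Good.setMem {W : ℕ} {σ : State} (h : Good W σ) (a : ℕ) {v : ℕ} (hv : v < W) :
    Good W (σ.setMem a v) := by
  refine ⟨h.one, h.reg, fun y => ?_⟩
  simp only [State.setMem, Function.update_apply]
  split_ifs
  exacts [hv, h.mem y]

theorem view_setReg_odd (σ : State) (r v : ℕ) :
    (view (σ.setReg (2 * r + 1) v) : Store V) = view σ := by
  have h (x : V) : 2 * Vars.idx x ≠ 2 * r + 1 := by omega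
  simp [view, State.setReg, h]

theorem view_setReg_even (σ : State) (x : V) (v : ℕ) :
    (view (σ.setReg (2 * Vars.idx x) v) : Store V) = (view σ).set x v := by
  ext y
  · by_cases h : y = x
    · simp [view, State.setReg, Store.set, h]
    · have h' : Vars.idx y ≠ Vars.idx x := fun e => h (Vars.idx_inj e)
      simp [view, State.setReg, Store.set, h, h']
  · rfl

@[simp] theorem setReg_reg_self (σ : State) (x v : ℕ) : (σ.setReg x v).reg x = v := by
  simp [State.setReg]

theorem setReg_reg_ne (σ : State) {x y : ℕ} (v : ℕ) (h : y ≠ x) :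
    (σ.setReg x v).reg y = σ.reg y := by
  simp [State.setReg, h]

theorem Expr.code_exec {W : ℕ} (e : Expr V) (r : ℕ) (σ : State) (hσ : Good W σ)
    (h : e.Ok W (view σ)) :
    ∃ σ', Exec W (e.code r) σ e.cost σ' ∧ Good W σ' ∧ (view σ' : Store V) = view σ ∧
      (∀ r' < r, σ'.reg (2 * r' + 1) = σ.reg (2 * r' + 1)) ∧
      σ'.reg (2 * r + 1) = e.eval (view σ) := by
  induction e generalizing r σ with
  | lit c =>
    refine ⟨_, .const σ _ c h, hσ.setReg _ h, view_setReg_odd .., fun r' hr => ?_, by simp⟩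
    exact setReg_reg_ne _ _ (by omega)
  | var x =>
    have h0 : 0 < W := by have := hσ.one; omega
    have hx : (σ.setReg (2 * r + 1) 0).reg (2 * Vars.idx x) = σ.reg (2 * Vars.idx x) :=
      setReg_reg_ne _ _ (by omega)
    have hlt : (σ.setReg (2 * r + 1) 0).reg (2 * r + 1) +
        (σ.setReg (2 * r + 1) 0).reg (2 * Vars.idx x) < W := by
      simpa [hx] using hσ.reg _
    refine ⟨_, .seq (.const σ _ 0 h0) (.add _ _ _ _ hlt), (hσ.setReg _ h0).setReg _ hlt,
      by simp only [view_setReg_odd], fun r' hr => ?_, by simp [hx, view]⟩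
    rw [setReg_reg_ne _ _ (by omega), setReg_reg_ne _ _ (by omega)]
  | add e f ihe ihf =>
    obtain ⟨he, hf, hs⟩ := h
    obtain ⟨σ₁, x₁, g₁, v₁, k₁, r₁⟩ := ihe r σ hσ he
    obtain ⟨σ₂, x₂, g₂, v₂, k₂, r₂⟩ := ihf (r + 1) σ₁ g₁ (by rwa [v₁])
    have e₁ : σ₂.reg (2 * r + 1) = e.eval (view σ) := by rw [k₂ r (by omega), r₁]
    have e₂ : σ₂.reg (2 * r + 3) = f.eval (view σ) := by
      rw [show 2 * r + 3 = 2 * (r + 1) + 1 by ring, r₂, v₁]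
    have hlt : σ₂.reg (2 * r + 1) + σ₂.reg (2 * r + 3) < W := by rw [e₁, e₂]; exact hs
    refine ⟨_, .seq (.seq x₁ x₂) (.add _ _ _ _ hlt), g₂.setReg _ hlt,
      by rw [view_setReg_odd, v₂, v₁], fun r' hr => ?_, by simp [e₁, e₂]⟩
    rw [setReg_reg_ne _ _ (by omega), k₂ r' (by omega), k₁ r' hr]
  | sub e f ihe ihf =>
    obtain ⟨he, hf⟩ := h
    obtain ⟨σ₁, x₁, g₁, v₁, k₁, r₁⟩ := ihe r σ hσ he
    obtain ⟨σ₂, x₂, g₂, v₂, k₂, r₂⟩ := ihf (r + 1) σ₁ g₁ (by rwa [v₁])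
    have e₁ : σ₂.reg (2 * r + 1) = e.eval (view σ) := by rw [k₂ r (by omega), r₁]
    have e₂ : σ₂.reg (2 * r + 3) = f.eval (view σ) := by
      rw [show 2 * r + 3 = 2 * (r + 1) + 1 by ring, r₂, v₁]
    have hlt : σ₂.reg (2 * r + 1) - σ₂.reg (2 * r + 3) < W :=
      (Nat.sub_le _ _).trans_lt (g₂.reg _)
    refine ⟨_, .seq (.seq x₁ x₂) (.sub _ _ _ _ hlt), g₂.setReg _ hlt,
      by rw [view_setReg_odd, v₂, v₁], fun r' hr => ?_, by simp [e₁, e₂]⟩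
    rw [setReg_reg_ne _ _ (by omega), k₂ r' (by omega), k₁ r' hr]
  | get e ihe =>
    obtain ⟨σ₁, x₁, g₁, v₁, k₁, r₁⟩ := ihe r σ hσ h
    have hm : σ₁.mem = σ.mem := congrArg Store.mem v₁
    refine ⟨_, .seq x₁ (.load _ _ _ (g₁.mem _)), g₁.setReg _ (g₁.mem _),
      by rw [view_setReg_odd, v₁], fun r' hr => ?_, by simp [r₁, hm, view]⟩
    rw [setReg_reg_ne _ _ (by omega), k₁ r' hr]

/-- Evaluation of two expressions into the registers `1` and `3`. -/
theorem Expr.code_exec_pair {W : ℕ} (e f : Expr V) (σ : State) (hσ : Good W σ)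
    (he : e.Ok W (view σ)) (hf : f.Ok W (view σ)) :
    ∃ σ', Exec W (.seq (e.code 0) (f.code 1)) σ (e.cost + f.cost) σ' ∧ Good W σ' ∧
      (view σ' : Store V) = view σ ∧ σ'.reg 1 = e.eval (view σ) ∧
      σ'.reg 3 = f.eval (view σ) := by
  obtain ⟨σ₁, x₁, g₁, v₁, -, r₁⟩ := e.code_exec 0 σ hσ he
  obtain ⟨σ₂, x₂, g₂, v₂, k₂, r₂⟩ := f.code_exec 1 σ₁ g₁ (by rwa [v₁])
  refine ⟨σ₂, .seq x₁ x₂, g₂, v₂.trans v₁, ?_, ?_⟩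
  · have := k₂ 0 (by omega)
    simp only [Nat.mul_zero, Nat.zero_add] at this r₁
    rw [this, r₁]
  · simpa [v₁] using r₂

namespace Cmd

/-- Compiled commands. Variables live in the even registers, the odd registers are scratch space;
this is why `for_` may use register `1` for the increment. -/
def code : Cmd V → Prog
  | skip => .skip
  | assign x e => .seq (e.code 0) (.seq (.const 3 0) (.add (2 * Vars.idx x) 1 3))
  | store e f => .seq (.seq (e.code 0) (f.code 1)) (.store 1 3)
  | seq c d => .seq c.code d.code
  | ite e f c d => .seq (.seq (e.code 0) (f.code 1)) (.cond 1 3 c.code d.code)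
  | for_ x y c => .seq (.const (2 * Vars.idx x) 0) (.loop (2 * Vars.idx x) (2 * Vars.idx y)
      (.seq c.code (.seq (.const 1 1) (.add (2 * Vars.idx x) (2 * Vars.idx x) 1))))

/-- The variables that a command may change. -/
@[simp] def writes : Cmd V → List V
  | skip => []
  | assign x _ => [x]
  | store _ _ => []
  | seq c d => c.writes ++ d.writes
  | ite _ _ c d => c.writes ++ d.writes
  | for_ x _ c => x :: c.writes

end Cmd

/-- `Runs W c s T Q`: from the store `s`, with words smaller than `W`, the command `c` halts within
`T` steps and reaches a store that satisfies `Q` and differs from `s` only in the variables that `c`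
may change, and in the memory. -/
def Runs (W : ℕ) (c : Cmd V) (s : Store V) (T : ℕ) (Q : Store V → Prop) : Prop :=
  ∀ σ : State, Good W σ → view σ = s → ∃ k ≤ T, ∃ σ', Exec W c.code σ k σ' ∧ Good W σ' ∧
    (∀ x ∉ c.writes, (view σ' : Store V).reg x = s.reg x) ∧ Q (view σ')

namespace Runs

variable {W : ℕ} {c d : Cmd V} {s : Store V} {T T' : ℕ} {Q R : Store V → Prop} {e f : Expr V}

theorem mono (h : Runs W c s T R) (hT : T ≤ T')
    (hQ : ∀ s', (∀ x ∉ c.writes, s'.reg x = s.reg x) → R s' → Q s') : Runs W c s T' Q := by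
  intro σ hσ hs
  obtain ⟨k, hk, σ', hx, hg, hf, hr⟩ := h σ hσ hs
  exact ⟨k, hk.trans hT, σ', hx, hg, hf, hQ _ hf hr⟩

theorem le (h : Runs W c s T Q) (hT : T ≤ T') : Runs W c s T' Q :=
  h.mono hT fun _ _ h => h

theorem skip (h : Q s) : Runs W .skip s 1 Q := by
  rintro σ hσ rfl
  exact ⟨1, le_rfl, σ, .skip σ, hσ, fun _ _ => rfl, h⟩

theorem assign {x : V} (he : e.Ok W s) (h : Q (s.set x (e.eval s))) :
    Runs W (.assign x e) s (e.cost + 2) Q := by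
  rintro σ hσ rfl
  obtain ⟨σ₁, x₁, g₁, v₁, -, r₁⟩ := e.code_exec 0 σ hσ he
  have h0 : 0 < W := by have := hσ.one; omega
  set σ₂ := σ₁.setReg 3 0 with hσ₂
  have g₂ : Good W σ₂ := g₁.setReg 3 h0
  have h1 : σ₂.reg 1 = e.eval (view σ) := by
    rw [hσ₂, setReg_reg_ne _ _ (by omega)]; exact r₁
  have h3 : σ₂.reg 3 = 0 := by simp [hσ₂]
  have hlt : σ₂.reg 1 + σ₂.reg 3 < W := by rw [h3]; exact g₂.reg 1
  have hv : (view (σ₂.setReg (2 * Vars.idx x) (σ₂.reg 1 + σ₂.reg 3)) : Store V) =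
      (view σ).set x (e.eval (view σ)) := by
    rw [view_setReg_even, h1, h3, hσ₂, view_setReg_odd (r := 1), v₁]
    rfl
  refine ⟨_, le_rfl, _, .seq x₁ (.seq (.const _ _ _ h0) (.add _ _ _ _ hlt)), g₂.setReg _ hlt,
    fun y hy => ?_, ?_⟩
  · rw [hv]
    exact Store.set_reg_ne _ _ (by simpa using hy)
  · rw [hv]
    exact h

theorem store (he : e.Ok W s) (hf : f.Ok W s) (h : Q (s.put (e.eval s) (f.eval s))) :
    Runs W (.store e f) s (e.cost + f.cost + 1) Q := by
  rintro σ hσ rfl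
  obtain ⟨σ₁, x₁, g₁, v₁, r₁, r₃⟩ := e.code_exec_pair f σ hσ he hf
  have hv : (view (σ₁.setMem (σ₁.reg 1) (σ₁.reg 3)) : Store V) =
      (view σ).put (e.eval (view σ)) (f.eval (view σ)) := by
    rw [r₁, r₃, ← v₁]
    rfl
  refine ⟨_, le_rfl, _, .seq x₁ (.store _ _ _ (g₁.reg _) (g₁.reg _)), g₁.setMem _ (g₁.reg _),
    fun y _ => ?_, ?_⟩
  · rw [hv]
    rfl
  · rw [hv]
    exact h

/-- The continuation may use that `c` changes no variables but its own. -/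
theorem seq (h : Runs W c s T R)
    (h' : ∀ s', (∀ x ∉ c.writes, s'.reg x = s.reg x) → R s' → Runs W d s' T' Q) :
    Runs W (.seq c d) s (T + T') Q := by
  intro σ hσ hs
  obtain ⟨k, hk, σ', hx, hg, hf, hr⟩ := h σ hσ hs
  obtain ⟨k', hk', σ'', hx', hg', hf', hq⟩ := h' _ hf hr σ' hg rfl
  refine ⟨k + k', by omega, σ'', .seq hx hx', hg', fun x hx => ?_, hq⟩
  simp only [Cmd.writes, List.mem_append, not_or] at hx
  rw [hf' x hx.2, hf x hx.1]

theorem assign_seq {x : V} (he : e.Ok W s) (h : Runs W c (s.set x (e.eval s)) T Q) :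
    Runs W (.seq (.assign x e) c) s (e.cost + 2 + T) Q := by
  refine seq (assign (Q := fun s' => s' = s.set x (e.eval s)) he rfl) ?_
  rintro s' - rfl
  exact h

theorem store_seq (he : e.Ok W s) (hf : f.Ok W s)
    (h : Runs W c (s.put (e.eval s) (f.eval s)) T Q) :
    Runs W (.seq (.store e f) c) s (e.cost + f.cost + 1 + T) Q := by
  refine seq (store (Q := fun s' => s' = s.put (e.eval s) (f.eval s)) he hf rfl) ?_
  rintro s' - rfl
  exact h

theorem ite (he : e.Ok W s) (hf : f.Ok W s) (hc : e.eval s < f.eval s → Runs W c s T Q)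
    (hd : ¬ e.eval s < f.eval s → Runs W d s T Q) :
    Runs W (.ite e f c d) s (e.cost + f.cost + 1 + T) Q := by
  rintro σ hσ rfl
  obtain ⟨σ₁, x₁, g₁, v₁, r₁, r₃⟩ := e.code_exec_pair f σ hσ he hf
  by_cases hlt : e.eval (view σ : Store V) < f.eval (view σ)
  · obtain ⟨k, hk, σ', hx, hg, hw, hq⟩ := hc hlt σ₁ g₁ v₁
    refine ⟨_, ?_, σ', .seq x₁ (.condTrue (by rwa [r₁, r₃]) hx), hg, fun x hx => ?_, hq⟩
    · omega
    · exact hw x (fun hm => hx (by simp [hm]))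
  · obtain ⟨k, hk, σ', hx, hg, hw, hq⟩ := hd hlt σ₁ g₁ v₁
    refine ⟨_, ?_, σ', .seq x₁ (.condFalse (by rwa [r₁, r₃]) hx), hg, fun x hx => ?_, hq⟩
    · omega
    · exact hw x (fun hm => hx (by simp [hm]))

/-- The rule for loops: `I i` holds before the round with number `i`. That the variables that the
body does not mention keep their values is known in every round, and need not be part of `I`. The
increment of the loop variable is safe since its result is at most the loop bound, which is itself a
word. -/
theorem for_ {x y : V} {T : ℕ} (I : ℕ → Store V → Prop) (n : ℕ) (hn : s.reg y = n)
    (hx : x ∉ c.writes) (hy : y ∉ c.writes) (hxy : y ≠ x) (h0 : I 0 (s.set x 0))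
    (hb : ∀ i < n, ∀ s', I i s' → s'.reg x = i →
      (∀ z, z ∉ x :: c.writes → s'.reg z = s.reg z) →
      Runs W c s' T fun s'' => I (i + 1) (s''.set x (i + 1)))
    (hQ : ∀ s', I n s' → s'.reg x = n → (∀ z, z ∉ x :: c.writes → s'.reg z = s.reg z) → Q s') :
    Runs W (.for_ x y c) s (n * (T + 3) + 2) Q := by
  rintro σ hσ rfl
  have hw : 0 < W := by have := hσ.one; omega
  set body : Prog :=
    .seq c.code (.seq (.const 1 1) (.add (2 * Vars.idx x) (2 * Vars.idx x) 1)) with hbody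
  have key : ∀ r, ∀ i, i + r = n → ∀ τ : State, Good W τ → I i (view τ) →
      (view τ : Store V).reg x = i →
      (∀ z, z ∉ x :: c.writes → (view τ : Store V).reg z = (view σ : Store V).reg z) →
      ∃ k ≤ r * (T + 3) + 1, ∃ σ', Exec W (.loop (2 * Vars.idx x) (2 * Vars.idx y) body) τ k σ' ∧
        Good W σ' ∧ (∀ z, z ∉ x :: c.writes → (view σ' : Store V).reg z =
          (view σ : Store V).reg z) ∧ (view σ' : Store V).reg x = n ∧ I n (view σ') := by
    intro r
    have hyw : y ∉ x :: c.writes := by simp [hxy, hy]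
    induction r with
    | zero =>
      intro i hi τ gτ hI hτ hz
      obtain rfl : i = n := by omega
      refine ⟨1, by omega, τ, .loopDone ?_, gτ, hz, hτ, hI⟩
      have h2 := hz y hyw
      simp only [view] at hτ h2 hn
      omega
    | succ r ih =>
      intro i hi τ gτ hI hτ hz
      have hlt : τ.reg (2 * Vars.idx x) < τ.reg (2 * Vars.idx y) := by
        have h2 := hz y hyw
        simp only [view] at hτ h2 hn
        omega
      obtain ⟨k, hk, τ₁, x₁, g₁, f₁, I₁⟩ := hb i (by omega) _ hI hτ hz τ gτ rfl
      have hx1 : τ₁.reg (2 * Vars.idx x) = i := by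
        have := f₁ x hx
        simp only [view] at this hτ
        omega
      set τ₂ := τ₁.setReg 1 1 with hτ₂
      have g₂ : Good W τ₂ := g₁.setReg 1 hσ.one
      have h1 : τ₂.reg 1 = 1 := by simp [hτ₂]
      have h2 : τ₂.reg (2 * Vars.idx x) = i := by
        rw [hτ₂, setReg_reg_ne _ _ (by omega), hx1]
      have hadd : τ₂.reg (2 * Vars.idx x) + τ₂.reg 1 < W := by
        have h3 := gτ.reg (2 * Vars.idx y)
        simp only [view] at hτ
        omega
      set τ₃ := τ₂.setReg (2 * Vars.idx x) (τ₂.reg (2 * Vars.idx x) + τ₂.reg 1) with hτ₃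
      have hv : (view τ₃ : Store V) = (view τ₁).set x (i + 1) := by
        rw [hτ₃, view_setReg_even, h1, h2, hτ₂, view_setReg_odd (r := 0)]
      obtain ⟨k', hk', σ', x', g', f', e', I'⟩ := ih (i + 1) (by omega) τ₃ (g₂.setReg _ hadd)
        (by rw [hv]; exact I₁) (by rw [hv]; simp) (fun z hzw => by
          rw [hv, Store.set_reg_ne _ _ (fun h => hzw (by simp [h])),
            f₁ z (fun h => hzw (by simp [h])), hz z hzw])
      refine ⟨k + (1 + 1) + k' + 1, ?_, σ',
        .loopStep hlt (.seq x₁ (.seq (.const _ _ _ hσ.one) (.add _ _ _ _ hadd))) x', g', f', e', I'⟩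
      rw [Nat.succ_mul]
      omega
  have hv0 : (view (σ.setReg (2 * Vars.idx x) 0) : Store V) = (view σ).set x 0 :=
    view_setReg_even ..
  obtain ⟨k, hk, σ', x', g', f', e', I'⟩ := key n 0 (by omega) (σ.setReg (2 * Vars.idx x) 0)
    (hσ.setReg _ hw) (by rw [hv0]; exact h0) (by rw [hv0]; simp) (fun z hzw => by
      rw [hv0, Store.set_reg_ne _ _ (fun h => hzw (by simp [h]))])
  exact ⟨1 + k, by omega, σ', .seq (.const _ _ _ hw) x', g', f', hQ _ I' e' f'⟩

end Runs

/-- `x := x + y * z`, by repeated addition; `i` is the loop variable. -/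
def Cmd.addMul (i x y z : V) : Cmd V := .for_ i y (.assign x (.add (.var x) (.var z)))

/-- If `e = f` then `c`. -/
def Cmd.ifEq (e f : Expr V) (c : Cmd V) : Cmd V := .ite e f .skip (.ite f e .skip c)

theorem Runs.addMul {W : ℕ} {s : Store V} {i x y z : V} {Q : Store V → Prop} (hix : i ≠ x)
    (hiy : y ≠ i) (hiz : z ≠ i) (hxy : y ≠ x) (hxz : z ≠ x) (v n a : ℕ) (hv : s.reg x = v)
    (hn : s.reg y = n) (ha : s.reg z = a)
    (hW : v + n * a < W)
    (hQ : ∀ s' : Store V, (∀ w, w ≠ i → w ≠ x → s'.reg w = s.reg w) → s'.mem = s.mem →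
      s'.reg x = v + n * a → Q s') :
    Runs W (.addMul i x y z) s (n * 10 + 2) Q := by
  refine Runs.for_ (T := 7) (fun j s' => s'.mem = s.mem ∧ s'.reg x = v + j * a) n hn
    (by simpa using hix) (by simpa using hxy) hiy ?_ ?_ ?_
  · simp [hv, hix.symm]
  · rintro j hj s' ⟨h1, h2⟩ h3 h4
    have hz : s'.reg z = a := by rw [h4 z (by simp [hiz, hxz]), ha]
    refine Runs.assign ?_ ?_
    · have : (j + 1) * a ≤ n * a := Nat.mul_le_mul_right _ hj
      simp only [Expr.Ok, Expr.eval, h2, hz, true_and]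
      rw [Nat.succ_mul] at this
      omega
    · simp [h1, h2, hz, hix.symm, Nat.succ_mul, Nat.add_assoc]
  · rintro s' ⟨h1, h2⟩ - h4
    exact hQ s' (fun w hw hw' => h4 w (by simp [hw, hw'])) h1 h2

theorem Runs.addMul_seq {W : ℕ} {s : Store V} {i x y z : V} {c : Cmd V} {T : ℕ}
    {Q : Store V → Prop} (hix : i ≠ x) (hiy : y ≠ i) (hiz : z ≠ i) (hxy : y ≠ x) (hxz : z ≠ x)
    (v n a : ℕ) (hv : s.reg x = v) (hn : s.reg y = n) (ha : s.reg z = a) (hW : v + n * a < W)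
    (hQ : ∀ s' : Store V, (∀ w, w ≠ i → w ≠ x → s'.reg w = s.reg w) → s'.mem = s.mem →
      s'.reg x = v + n * a → Runs W c s' T Q) :
    Runs W (.seq (.addMul i x y z) c) s (n * 10 + 2 + T) Q := by
  refine Runs.seq (R := fun s' => (∀ w, w ≠ i → w ≠ x → s'.reg w = s.reg w) ∧ s'.mem = s.mem ∧
    s'.reg x = v + n * a) (Runs.addMul hix hiy hiz hxy hxz v n a hv hn ha hW
      fun s' h1 h2 h3 => ⟨h1, h2, h3⟩) ?_
  rintro s' - ⟨h1, h2, h3⟩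
  exact hQ s' h1 h2 h3

theorem Runs.ifEq {W : ℕ} {s : Store V} {e f : Expr V} {c : Cmd V} {Q : Store V → Prop} {T : ℕ}
    (hT : 1 ≤ T) (he : e.Ok W s) (hf : f.Ok W s) (hc : e.eval s = f.eval s → Runs W c s T Q)
    (hd : e.eval s ≠ f.eval s → Q s) :
    Runs W (.ifEq e f c) s (2 * (e.cost + f.cost + 1) + T) Q := by
  refine (Runs.ite (T := f.cost + e.cost + 1 + T) he hf (fun h => ?_) fun h => ?_).le (by omega)
  · exact (Runs.skip (hd h.ne)).le (by omega)
  · refine Runs.ite hf he (fun h => ?_) fun h' => ?_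
    · exact (Runs.skip (hd h.ne')).le hT
    · exact hc (by omega)

/-- A command that runs within `W` steps on words smaller than `W` yields a program in the sense of
the random access machine. -/
theorem Runs.runsWithin {W : ℕ} {c : Cmd V} {l : List ℕ} {r : ℕ} {post : State → Prop}
    {T : ℕ} (hT : T ≤ W) (h1 : 1 < W) (hr : r < W) (hl : ∀ v ∈ l, v < W)
    (h : Runs W c ⟨fun x => if x = Vars.input then r else 0, fun a => l.getD a 0⟩ T
      fun s => ∀ σ, (view σ : Store V) = s → post σ) :
    c.code.RunsWithin l r W post := by
  have hg : Good W (startState l r) := by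
    refine ⟨h1, fun x => ?_, fun a => ?_⟩
    · simp only [startState]
      split_ifs <;> omega
    · simp only [startState, List.getD_eq_getElem?_getD]
      rcases lt_or_ge a l.length with ha | ha
      · simpa [ha] using hl _ (List.getElem_mem ha)
      · simp [ha]; omega
  obtain ⟨k, hk, σ', hx, -, -, hq⟩ := h (startState l r) hg (by
    ext x
    · have : (Vars.idx x = 0) ↔ x = Vars.input := by
        rw [← Vars.idx_input (V := V)]
        exact Vars.idx_inj.eq_iff
      simp [view, startState, this]
    · rfl)
  exact ⟨k, hk.trans hT, σ', hx, hq _ rfl⟩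

/-- A larger bound on time and word size does no harm. -/
theorem Exec.mono {W W' : ℕ} (hW : W ≤ W') {P : Prog} {σ σ' : State} {k : ℕ}
    (h : Exec W P σ k σ') : Exec W' P σ k σ' := by
  induction h with
  | skip => exact .skip _
  | const _ _ _ h => exact .const _ _ _ (h.trans_le hW)
  | add _ _ _ _ h => exact .add _ _ _ _ (h.trans_le hW)
  | sub _ _ _ _ h => exact .sub _ _ _ _ (h.trans_le hW)
  | load _ _ _ h => exact .load _ _ _ (h.trans_le hW)
  | store _ _ _ ha h => exact .store _ _ _ (ha.trans_le hW) (h.trans_le hW)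
  | seq _ _ h h' => exact .seq h h'
  | condTrue hc _ h => exact .condTrue hc h
  | condFalse hc _ h => exact .condFalse hc h
  | loopDone hc => exact .loopDone hc
  | loopStep hc _ _ h h' => exact .loopStep hc h h'

theorem Prog.RunsWithin.mono {P : Prog} {l : List ℕ} {r T T' : ℕ} {post : State → Prop}
    (h : P.RunsWithin l r T post) (hT : T ≤ T') : P.RunsWithin l r T' post := by
  obtain ⟨k, hk, σ', hx, hq⟩ := h
  exact ⟨k, hk.trans hT, σ', hx.mono hT, hq⟩

end Language

/-! ### Runs of automata and interface sequences -/

namespace Automaton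

variable {α σ : Type}

/-- `A.Path p u p'`: the word `u` leads from state `p` to state `p'`. -/
def Path (A : Automaton α σ) : σ → List α → σ → Prop
  | p, [], p' => p = p'
  | p, a :: u, p' => ∃ r, A.trans p a r ∧ A.Path r u p'

theorem mem_between {A : Automaton α σ} {p p' : σ} {u : List α} :
    u ∈ A.between p p' ↔ A.Path p u p' := by
  have key : ∀ (u : List α) (T : Set σ) (p₁ p₂ s : σ),
      s ∈ (A.toNFA p₁ p₂).evalFrom T u ↔ ∃ p ∈ T, A.Path p u s := by
    intro u
    induction u with
    | nil => intro T p₁ p₂ s; simp [Path]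
    | cons a u ih =>
      intro T p₁ p₂ s
      rw [NFA.evalFrom_cons, ih]
      simp only [NFA.mem_stepSet, Path, toNFA, Set.mem_ofPred_eq]
      constructor
      · rintro ⟨r, ⟨p, hp, hr⟩, h⟩
        exact ⟨p, hp, r, hr, h⟩
      · rintro ⟨p, hp, r, hr, h⟩
        exact ⟨r, ⟨p, hp, hr⟩, h⟩
  rw [between, NFA.mem_accepts]
  have h1 := key u {p} p p' p'
  simp only [Set.mem_singleton_iff, exists_eq_left] at h1
  rw [← h1]
  simp [toNFA]

theorem mem_lang {A : Automaton α σ} {u : List α} :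
    u ∈ A.lang ↔ A.Path A.init u A.final := mem_between

theorem path_append {A : Automaton α σ} {u v : List α} {p p' : σ} :
    A.Path p (u ++ v) p' ↔ ∃ r, A.Path p u r ∧ A.Path r v p' := by
  induction u generalizing p with
  | nil => simp [Path]
  | cons a u ih =>
    simp only [List.cons_append, Path, ih]
    constructor
    · rintro ⟨r, h, r', h1, h2⟩
      exact ⟨r', ⟨r, h, h1⟩, h2⟩
    · rintro ⟨r', ⟨r, h, h1⟩, h2⟩
      exact ⟨r, h, r', h1, h2⟩

theorem path_snoc {A : Automaton α σ} {u : List α} {a : α} {p p' : σ} :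
    A.Path p (u ++ [a]) p' ↔ ∃ r, A.Path p u r ∧ A.trans r a p' := by
  simp [path_append, Path]

end Automaton

section Proj

variable {α : Type} {t : ℕ}

@[simp] theorem proj_nil (i : Fin t) : proj i ([] : List (α × Fin t)) = [] := rfl

theorem proj_cons (i : Fin t) (x : α × Fin t) (u : List (α × Fin t)) :
    proj i (x :: u) = if x.2 = i then x.1 :: proj i u else proj i u := by
  unfold proj
  by_cases h : x.2 = i <;> simp [h]

theorem proj_append (i : Fin t) (u v : List (α × Fin t)) :
    proj i (u ++ v) = proj i u ++ proj i v := by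
  simp [proj]

theorem proj_eq_nil {i : Fin t} {u : List (α × Fin t)} : proj i u = [] ↔ ∀ x ∈ u, x.2 ≠ i := by
  simp [proj]

theorem proj_tag (i j : Fin t) (w : List α) :
    proj i (w.map fun a => (a, j)) = if j = i then w else [] := by
  induction w with
  | nil => simp
  | cons a w ih => by_cases h : j = i <;> simp_all [proj_cons]

theorem contextSwitches_tag (j : Fin t) (w : List α) :
    contextSwitches (w.map fun a => (a, j)) = 0 := by
  induction w with
  | nil => rfl
  | cons a w ih => cases w <;> simp_all [contextSwitches]

theorem contextSwitches_tag_append (j : Fin t) (w : List α) (u : List (α × Fin t)) :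
    contextSwitches (w.map (fun a => (a, j)) ++ u) ≤ contextSwitches u + 1 := by
  induction w with
  | nil => simp
  | cons a w ih =>
    cases w with
    | nil =>
      cases u with
      | nil => simp [contextSwitches]
      | cons y u =>
        simp only [List.map_cons, List.map_nil, List.singleton_append, contextSwitches]
        split_ifs <;> omega
    | cons b w => simpa [contextSwitches] using ih

end Proj

namespace SMCP

/-- Runs of `B_i` are runs of `A_i` that are cut into pieces. -/
theorem path_B {S : SMCP} {i : Fin S.t} {σ : List (Fin S.m × Fin S.m)} {p p' : Fin (S.n i)} :
    (S.B i).Path p σ p' ↔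
      ∃ u, (S.A i).Path p u p' ∧ u ∈ (σ.map fun q => S.M.between q.1 q.2).prod := by
  induction σ generalizing p with
  | nil => simp [Automaton.Path, Language.mem_one]
  | cons q σ ih =>
    simp only [Automaton.Path, List.map_cons, List.prod_cons, Language.mem_mul, ih]
    constructor
    · rintro ⟨r, ⟨u, hu, hu'⟩, v, hv, hv'⟩
      exact ⟨u ++ v, Automaton.path_append.2 ⟨r, Automaton.mem_between.1 hu, hv⟩,
        u, hu', v, hv', rfl⟩
    · rintro ⟨-, h, u, hu, v, hv, rfl⟩
      obtain ⟨r, h1, h2⟩ := Automaton.path_append.1 h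
      exact ⟨r, ⟨u, Automaton.mem_between.2 h1, hu⟩, v, h2, hv⟩

theorem lang_B (S : SMCP) (i : Fin S.t) : (S.B i).lang = S.interfaceLang i := by
  ext σ
  rw [Automaton.mem_lang, path_B]
  simp only [interfaceLang, Automaton.lang, ← Automaton.mem_between]
  rfl

/-- Cutting a tagged word at its context switches yields a tagged interface sequence. Only threads
that occur in the word occur in the sequence. -/
theorem exists_interface {S : SMCP} (u : List (Fin S.s × Fin S.t)) (q q' : Fin S.m)
    (hu : S.M.Path q (u.map Prod.fst) q') :
    ∃ τ : List ((Fin S.m × Fin S.m) × Fin S.t), τ.length ≤ contextSwitches u + 1 ∧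
      τ.head?.map Prod.snd = u.head?.map Prod.snd ∧ IsChain q q' (τ.map Prod.fst) ∧
      (∀ i, proj i u ∈ ((proj i τ).map fun q => S.M.between q.1 q.2).prod) ∧
      ∀ x ∈ τ, ∃ y ∈ u, y.2 = x.2 := by
  induction u generalizing q with
  | nil => exact ⟨[], by simp, rfl, hu, fun i => by simp [Language.mem_one], by simp⟩
  | cons x u ih =>
    obtain ⟨r, hr, hu⟩ := hu
    obtain ⟨τ, hlen, hhead, hchain, hproj, htag⟩ := ih r hu
    cases u with
    | nil =>
      obtain rfl : r = q' := hu
      have hx : [x.1] ∈ S.M.between q r := Automaton.mem_between.2 ⟨r, hr, rfl⟩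
      refine ⟨[((q, r), x.2)], by simp [contextSwitches], rfl, ⟨rfl, rfl⟩, fun i => ?_, by simp⟩
      by_cases h : x.2 = i <;> simp [proj_cons, h, hx, Language.mem_one]
    | cons y u =>
      cases τ with
      | nil => simp at hhead
      | cons z τ =>
        obtain ⟨⟨z₁, z₂⟩, j⟩ := z
        simp only [List.head?_cons, Option.map_some, Option.some.injEq] at hhead
        subst hhead
        obtain ⟨rfl, hchain⟩ := hchain
        by_cases hxy : x.2 = y.2
        · refine ⟨((q, z₂), x.2) :: τ, ?_, rfl, ⟨rfl, hchain⟩, fun i => ?_, ?_⟩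
          · simpa [contextSwitches, hxy] using hlen
          · have h1 := hproj i
            rw [proj_cons i x]
            by_cases h : x.2 = i
            · have h' : y.2 = i := hxy ▸ h
              rw [proj_cons (x := ((z₁, z₂), y.2)), if_pos h', List.map_cons, List.prod_cons,
                Language.mem_mul] at h1
              obtain ⟨a, ha, b, hb, hab⟩ := h1
              rw [if_pos h, proj_cons, if_pos h, List.map_cons, List.prod_cons, Language.mem_mul]
              refine ⟨x.1 :: a, Automaton.mem_between.2 ⟨z₁, hr, Automaton.mem_between.1 ha⟩, b, hb,
                ?_⟩
              rw [← hab]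
              rfl
            · have h' : ¬ y.2 = i := hxy ▸ h
              rw [if_neg h, proj_cons i ((q, z₂), x.2), if_neg h]
              rwa [proj_cons (x := ((z₁, z₂), y.2)), if_neg h'] at h1
          · intro w hw
            rcases List.mem_cons.1 hw with rfl | hw
            · exact ⟨x, by simp, rfl⟩
            · obtain ⟨v, hv, hv'⟩ := htag w (by simp [hw])
              exact ⟨v, List.mem_cons_of_mem _ hv, hv'⟩
        · refine ⟨((q, z₁), x.2) :: ((z₁, z₂), y.2) :: τ, ?_, rfl, ⟨rfl, rfl, hchain⟩,
            fun i => ?_, ?_⟩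
          · simp only [List.length_cons, contextSwitches, hxy, if_false] at hlen ⊢
            omega
          · have h1 := hproj i
            rw [proj_cons i x, proj_cons i ((q, z₁), x.2)]
            by_cases h : x.2 = i
            · rw [if_pos h, if_pos h, List.map_cons, List.prod_cons, Language.mem_mul]
              exact ⟨[x.1], Automaton.mem_between.2 ⟨z₁, hr, rfl⟩, _, h1, rfl⟩
            · rwa [if_neg h, if_neg h]
          · intro w hw
            rcases List.mem_cons.1 hw with rfl | hw
            · exact ⟨x, by simp, rfl⟩
            · obtain ⟨v, hv, hv'⟩ := htag w hw
              exact ⟨v, List.mem_cons_of_mem _ hv, hv'⟩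

/-- Words that witness the transitions of the `B_i` can be put together along a tagged interface
sequence; they are monochromatic, so context switches occur only between consecutive pairs. -/
theorem exists_word {S : SMCP} (τ : List ((Fin S.m × Fin S.m) × Fin S.t)) (q q' : Fin S.m)
    (hchain : IsChain q q' (τ.map Prod.fst)) (p p' : (i : Fin S.t) → Fin (S.n i))
    (hp : ∀ i, (S.B i).Path (p i) (proj i τ) (p' i)) :
    ∃ u : List (Fin S.s × Fin S.t), S.M.Path q (u.map Prod.fst) q' ∧
      (∀ i, (S.A i).Path (p i) (proj i u) (p' i)) ∧ contextSwitches u ≤ τ.length - 1 ∧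
      ∀ x ∈ u, ∃ y ∈ τ, y.2 = x.2 := by
  induction τ generalizing q p with
  | nil => exact ⟨[], hchain, hp, by simp [contextSwitches], by simp⟩
  | cons z τ ih =>
    obtain ⟨⟨z₁, z₂⟩, j⟩ := z
    obtain ⟨rfl, hchain⟩ := hchain
    have hj := hp j
    rw [proj_cons, if_pos rfl] at hj
    obtain ⟨r, ⟨w, hw, hw'⟩, hr⟩ := hj
    obtain ⟨u, hu, hproj, hcs, htag⟩ := ih z₂ hchain (Function.update p j r) (fun i => by
      by_cases h : i = j
      · subst h
        simpa using hr
      · have h1 := hp i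
        rw [proj_cons, if_neg (fun e => h e.symm)] at h1
        simpa [h] using h1)
    refine ⟨w.map (fun a => (a, j)) ++ u, ?_, fun i => ?_, ?_, ?_⟩
    · rw [List.map_append, Automaton.path_append]
      refine ⟨z₂, ?_, hu⟩
      simpa [Function.comp_def] using Automaton.mem_between.1 hw'
    · rw [proj_append, Automaton.path_append, proj_tag]
      refine ⟨Function.update p j r i, ?_, hproj i⟩
      by_cases h : i = j
      · subst h
        simpa using Automaton.mem_between.1 hw
      · rw [if_neg (fun e => h e.symm)]
        simp [Automaton.Path, h]
    · cases u with
      | nil => simp [contextSwitches_tag]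
      | cons y u =>
        obtain ⟨v, hv, -⟩ := htag y (by simp)
        have h1 : 0 < τ.length := List.length_pos_of_mem hv
        have h2 := contextSwitches_tag_append j w (y :: u)
        simp only [List.length_cons]
        omega
    · intro x hx
      rcases List.mem_append.1 hx with hx | hx
      · obtain ⟨a, -, rfl⟩ := List.mem_map.1 hx
        exact ⟨((z₁, z₂), j), by simp, rfl⟩
      · obtain ⟨v, hv, hv'⟩ := htag x hx
        exact ⟨v, List.mem_cons_of_mem _ hv, hv'⟩

theorem hasBCS_iff (S : SMCP) (cs : ℕ) : S.HasBCS cs ↔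
    ∃ σ : List (Fin S.m × Fin S.m), σ.length ≤ cs + 1 ∧ S.Valid σ ∧
      σ ∈ shuffle fun i => (S.B i).lang := by
  constructor
  · rintro ⟨u, ⟨hM, hA⟩, hcs⟩
    obtain ⟨τ, hlen, -, hchain, hproj, htag⟩ := exists_interface u _ _ (Automaton.mem_lang.1 hM)
    refine ⟨τ.map Prod.fst, by simp; omega, hchain, τ, fun i => ?_, rfl⟩
    rcases hA i with h | h
    · exact .inl (Automaton.mem_lang.2 (path_B.2 ⟨_, Automaton.mem_lang.1 h, hproj i⟩))
    · refine .inr (proj_eq_nil.2 fun x hx e => ?_)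
      obtain ⟨y, hy, hy'⟩ := htag x hx
      exact proj_eq_nil.1 h y hy (hy'.trans e)
  · rintro ⟨-, hlen, hchain, τ, hτ, rfl⟩
    classical
    obtain ⟨u, hu, hproj, hcs, htag⟩ := exists_word τ _ _ hchain (fun i => (S.A i).init)
      (fun i => if proj i τ = [] then (S.A i).init else (S.A i).final) (fun i => by
        by_cases h : proj i τ = []
        · simp [h, Automaton.Path]
        · rw [if_neg h]
          exact Automaton.mem_lang.1 ((hτ i).resolve_right h))
    refine ⟨u, ⟨Automaton.mem_lang.2 hu, fun i => ?_⟩, ?_⟩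
    · have h1 := hproj i
      by_cases h : proj i τ = []
      · refine .inr (proj_eq_nil.2 fun x hx e => ?_)
        obtain ⟨y, hy, hy'⟩ := htag x hx
        exact proj_eq_nil.1 h y hy (hy'.trans e)
      · rw [if_neg h] at h1
        exact .inl (Automaton.mem_lang.2 h1)
    · simp only [List.length_map] at hlen
      omega

/-! ### Interface sequences of fixed length -/

/-- The part of the sequence `(d 0, d 1) (d 1, d 2) … (d (k - 1), d k)` that belongs to thread `i`,
if position `j` belongs to thread `f j`. -/
def share {Q : Type} (d : ℕ → Q) (f : ℕ → ℕ) (i k : ℕ) : List (Q × Q) :=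
  ((List.range k).filter fun j => f j = i).map fun j => (d j, d (j + 1))

theorem share_succ {Q : Type} (d : ℕ → Q) (f : ℕ → ℕ) (i k : ℕ) :
    share d f i (k + 1) = share d f i k ++ if f k = i then [(d k, d (k + 1))] else [] := by
  by_cases h : f k = i <;> simp [share, List.range_succ, h]

theorem share_congr {Q : Type} {d : ℕ → Q} {f g : ℕ → ℕ} {i k : ℕ}
    (h : ∀ j < k, f j = i ↔ g j = i) : share d f i k = share d g i k := by
  unfold share
  congr 1
  apply List.filter_congr
  intro j hj
  simp [h j (List.mem_range.1 hj)]

theorem share_eq_nil {Q : Type} {d : ℕ → Q} {f : ℕ → ℕ} {i k : ℕ} :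
    share d f i k = [] ↔ ∀ j < k, f j ≠ i := by
  simp [share]

/-- The positions of the interface sequence `d` of length `k` can be distributed among the
threads. -/
def Covers (S : SMCP) (k : ℕ) (d : ℕ → Fin S.m) : Prop :=
  ∃ f : ℕ → ℕ, (∀ j < k, f j < S.t) ∧
    ∀ i : Fin S.t, share d f i k ∈ (S.B i).lang ∨ share d f i k = []

theorem proj_eq_share {Q : Type} {t : ℕ} (d : ℕ → Q) (f : ℕ → Fin t) (i : Fin t) (k : ℕ) :
    proj i ((List.range k).map fun j => ((d j, d (j + 1)), f j)) =
      share d (fun j => f j) i k := by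
  simp [proj, share, List.filter_map, Function.comp_def, Fin.ext_iff]

theorem isChain_range {Q : Type} (d : ℕ → Q) (k : ℕ) :
    IsChain (d 0) (d k) ((List.range k).map fun j => (d j, d (j + 1))) := by
  induction k generalizing d with
  | zero => rfl
  | succ k ih =>
    rw [List.range_succ_eq_map]
    simpa [IsChain, Function.comp_def] using ih fun j => d (j + 1)

/-- Tagged interface sequences are given by a sequence `d` of memory states and a sequence `f` of
threads. -/
theorem exists_of_isChain {Q : Type} {t : ℕ} (i₀ : Fin t) (τ : List ((Q × Q) × Fin t)) (q q' : Q)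
    (h : IsChain q q' (τ.map Prod.fst)) :
    ∃ (d : ℕ → Q) (f : ℕ → Fin t), d 0 = q ∧ d τ.length = q' ∧
      τ = (List.range τ.length).map fun j => ((d j, d (j + 1)), f j) := by
  induction τ generalizing q with
  | nil => exact ⟨fun _ => q, fun _ => i₀, rfl, h, rfl⟩
  | cons z τ ih =>
    obtain ⟨⟨z₁, z₂⟩, j⟩ := z
    obtain ⟨rfl, h⟩ := h
    obtain ⟨d, f, h0, h1, h2⟩ := ih z₂ h
    refine ⟨fun | 0 => z₁ | j + 1 => d j, fun | 0 => j | j + 1 => f j, rfl, h1, ?_⟩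
    rw [List.length_cons, List.range_succ_eq_map]
    simp only [List.map_cons, List.map_map, h0]
    congr 1

/-- A nonempty tagged interface sequence can be padded with copies of the pair of final states,
which a thread that occurs in the sequence reads as empty words. -/
theorem exists_padding {S : SMCP} (r : ℕ) (τ : List ((Fin S.m × Fin S.m) × Fin S.t)) (hne : τ ≠ [])
    (hτ : τ ∈ taggedShuffle fun i => (S.B i).lang) (hchain : S.Valid (τ.map Prod.fst)) :
    ∃ τ' ∈ taggedShuffle fun i => (S.B i).lang, S.Valid (τ'.map Prod.fst) ∧
      τ'.length = τ.length + r := by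
  induction r with
  | zero => exact ⟨τ, hτ, hchain, rfl⟩
  | succ r ih =>
    obtain ⟨τ', h1, h2, h3⟩ := ih
    have hne' : τ' ≠ [] := by
      rintro rfl
      have := List.length_pos_iff.2 hne
      simp at h3
      omega
    obtain ⟨x, hx⟩ := List.exists_mem_of_ne_nil _ hne'
    have hchain_snoc : ∀ (l : List (Fin S.m × Fin S.m)) (q q' : Fin S.m), IsChain q q' l →
        IsChain q q' (l ++ [(q', q')]) := by
      intro l
      induction l with
      | nil => rintro q q' ⟨rfl⟩; exact ⟨rfl, rfl⟩
      | cons y l ih => rintro q q' ⟨h, h'⟩; exact ⟨h, ih _ _ h'⟩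
    refine ⟨τ' ++ [((S.M.final, S.M.final), x.2)], fun i => ?_, ?_, by simp [h3]; omega⟩
    · rw [proj_append, proj_cons]
      by_cases h : x.2 = i
      · rw [if_pos h, proj_nil]
        refine .inl (Automaton.mem_lang.2 (Automaton.path_snoc.2 ⟨(S.B i).final, ?_, [], ?_, ?_⟩))
        · refine Automaton.mem_lang.1 ((h1 i).resolve_right fun e => ?_)
          exact proj_eq_nil.1 e x hx h
        · exact Automaton.mem_between.2 rfl
        · exact Automaton.mem_between.2 rfl
      · rw [if_neg h, proj_nil, List.append_nil]
        exact h1 i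
    · simpa [Valid] using hchain_snoc _ _ _ h2

/-- It suffices to look for interface sequences of length exactly `cs + 1`, unless the empty word is
accepted. -/
theorem hasBCS_iff_covers (S : SMCP) (cs : ℕ) (ht : 0 < S.t) : S.HasBCS cs ↔
    S.M.init = S.M.final ∨ ∃ d : ℕ → Fin S.m, d 0 = S.M.init ∧ d (cs + 1) = S.M.final ∧
      S.Covers (cs + 1) d := by
  rw [hasBCS_iff]
  constructor
  · rintro ⟨-, hlen, hchain, τ, hτ, rfl⟩
    rcases eq_or_ne τ [] with rfl | hne
    · exact .inl hchain
    · rw [List.length_map] at hlen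
      obtain ⟨τ', h1, h2, h3⟩ := exists_padding (cs + 1 - τ.length) τ hne hτ hchain
      obtain ⟨d, f, hd0, hd1, hd⟩ := exists_of_isChain ⟨0, ht⟩ τ' _ _ h2
      rw [show τ'.length = cs + 1 by omega] at hd hd1
      refine .inr ⟨d, hd0, hd1, fun j => f j, fun j _ => (f j).2, fun i => ?_⟩
      have := h1 i
      rwa [hd, proj_eq_share] at this
  · rintro (h | ⟨d, hd0, hd1, f, hf, h⟩)
    · exact ⟨[], by simp, h, [], fun i => .inr rfl, rfl⟩
    · refine ⟨(List.range (cs + 1)).map fun j => (d j, d (j + 1)), by simp, ?_,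
        (List.range (cs + 1)).map fun j =>
          ((d j, d (j + 1)), if h : f j < S.t then ⟨f j, h⟩ else ⟨0, ht⟩), fun i => ?_, ?_⟩
      · have := isChain_range d (cs + 1)
        rwa [hd0, hd1] at this
      · rw [proj_eq_share, share_congr (g := f) fun j hj => by simp [hf j hj]]
        exact h i
      · simp [Function.comp_def]

/-! ### Covering the positions one thread after the other -/

/-- Bit number `j` of `y` is zero. -/
def Low (j y : ℕ) : Prop := y % 2 ^ (j + 1) < 2 ^ j

theorem low_iff {j y : ℕ} : Low j y ↔ y.testBit j = false := by
  have h1 : y % 2 ^ (j + 1) = y % 2 ^ j + 2 ^ j * (y / 2 ^ j % 2) := by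
    rw [pow_succ, Nat.mod_mul]
  have h2 : y % 2 ^ j < 2 ^ j := Nat.mod_lt _ (by positivity)
  rw [Low, h1, Nat.testBit_eq_decide_div_mod_eq]
  rcases Nat.mod_two_eq_zero_or_one (y / 2 ^ j) with h | h <;> simp [h, h2]

theorem Low.add_eq_or {j y : ℕ} (h : Low j y) : y + 2 ^ j = y ||| 2 ^ j := by
  have h1 := Nat.div_add_mod y (2 ^ (j + 1))
  have h2 : y % 2 ^ (j + 1) + 2 ^ j < 2 ^ (j + 1) := by
    rw [Low] at h
    rw [pow_succ] at h ⊢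
    omega
  have h3 := Nat.two_pow_add_eq_or_of_lt h2 (y / 2 ^ (j + 1))
  have h4 := Nat.two_pow_add_eq_or_of_lt (Nat.mod_lt y (by positivity : 0 < 2 ^ (j + 1)))
    (y / 2 ^ (j + 1))
  rw [← Nat.or_two_pow_eq_add_of_lt h, ← Nat.or_assoc, ← h4, h1,
    Nat.or_two_pow_eq_add_of_lt h] at h3
  omega

theorem Low.testBit_add {j y : ℕ} (h : Low j y) (l : ℕ) :
    (y + 2 ^ j).testBit l = (y.testBit l || decide (j = l)) := by
  rw [h.add_eq_or, Nat.testBit_or, Nat.testBit_two_pow]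

theorem Low.add_lt {j y k : ℕ} (h : Low j y) (hj : j < k) (hy : y < 2 ^ k) : y + 2 ^ j < 2 ^ k := by
  rw [h.add_eq_or]
  exact Nat.or_lt_two_pow hy (Nat.pow_lt_pow_right (by omega) hj)

/-- If bit `j` of `x` is one, then `x` arises from a number whose bit `j` is zero. -/
theorem exists_low {j x : ℕ} (h : x.testBit j = true) : ∃ y, Low j y ∧ x = y + 2 ^ j := by
  have h1 : 2 ^ j ≤ x := Nat.ge_two_pow_of_testBit h
  have h2 : Low j (x ^^^ 2 ^ j) := by
    rw [low_iff, Nat.testBit_xor, Nat.testBit_two_pow, h]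
    simp
  refine ⟨x ^^^ 2 ^ j, h2, ?_⟩
  apply Nat.eq_of_testBit_eq
  intro l
  rw [h2.testBit_add, Nat.testBit_xor, Nat.testBit_two_pow]
  rcases eq_or_ne j l with rfl | hl
  · simp [h]
  · simp [hl]

/-- Numbers stand for sets of positions, by their binary digits. `reach B d D j x p`: the set `x` is
the disjoint union of a set in `D` and of a set of positions below `j`, and `B` comes to state `p`
when it reads the letters of `d` at the positions of the latter. -/
def reach {Q σ : Type} (B : Automaton (Q × Q) σ) (d : ℕ → Q) (D : ℕ → Prop) :
    ℕ → ℕ → σ → Prop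
  | 0, x, p => D x ∧ p = B.init
  | j + 1, x, p => reach B d D j x p ∨ ∃ y p₀, Low j y ∧ x = y + 2 ^ j ∧ reach B d D j y p₀ ∧
      B.trans p₀ (d j, d (j + 1)) p

/-- `S.cover d k i x`: the set `x` of positions below `k` can be distributed among the first `i`
threads. -/
def cover (S : SMCP) (d : ℕ → Fin S.m) (k : ℕ) : ℕ → ℕ → Prop
  | 0, x => x = 0
  | i + 1, x => cover S d k i x ∨
      ∃ h : i < S.t, reach (S.B ⟨i, h⟩) d (cover S d k i) k x (S.B ⟨i, h⟩).final

/-- The first `i` threads accept their shares of the positions below `k`, as distributed by `f`. -/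
def Accepts (S : SMCP) (d : ℕ → Fin S.m) (k i : ℕ) (f : ℕ → ℕ) : Prop :=
  ∀ i' : Fin S.t, i' < i → share d f i' k ∈ (S.B i').lang ∨ share d f i' k = []

theorem Accepts.congr {S : SMCP} {d : ℕ → Fin S.m} {k i : ℕ} {f g : ℕ → ℕ}
    (h : S.Accepts d k i f) (hfg : ∀ j < k, ∀ i' < i, f j = i' ↔ g j = i') :
    S.Accepts d k i g := by
  intro i' hi'
  rw [← share_congr fun j hj => hfg j hj i' hi']
  exact h i' hi'

/-- The meaning of `reach` in terms of distributions `f` of positions to threads: those of `x` go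
to the threads up to `i`, those among them that go to thread `i` itself are below `j`. Positions
outside `x` go to threads beyond `i`. -/
theorem reach_iff {S : SMCP} {d : ℕ → Fin S.m} {k i : ℕ} (hi : i < S.t)
    (hD : ∀ x, S.cover d k i x ↔ x < 2 ^ k ∧ ∃ f : ℕ → ℕ,
      (∀ l < k, x.testBit l = true ↔ f l < i) ∧ S.Accepts d k i f)
    (j : ℕ) (hj : j ≤ k) (x : ℕ) (p : Fin (S.n ⟨i, hi⟩)) :
    reach (S.B ⟨i, hi⟩) d (S.cover d k i) j x p ↔ x < 2 ^ k ∧ ∃ f : ℕ → ℕ,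
      (∀ l < k, x.testBit l = true ↔ f l ≤ i) ∧ (∀ l < k, f l = i → l < j) ∧
      S.Accepts d k i f ∧ (S.B ⟨i, hi⟩).Path (S.B ⟨i, hi⟩).init (share d f i j) p := by
  induction j generalizing x p with
  | zero =>
    rw [reach, hD]
    constructor
    · rintro ⟨⟨hx, f, hf, ha⟩, rfl⟩
      refine ⟨hx, fun l => if f l < i then f l else i + 1, fun l hl => ?_, fun l hl => ?_,
        ha.congr fun l hl i' hi' => ?_, by simp [share, Automaton.Path]⟩
      · rw [hf l hl]; dsimp only; split_ifs <;> omega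
      · dsimp only; split_ifs <;> omega
      · split_ifs <;> omega
    · rintro ⟨hx, f, hf, hl, ha, hp⟩
      refine ⟨⟨hx, f, fun l hl' => ?_, ha⟩, ?_⟩
      · rw [hf l hl']
        have := hl l hl'
        omega
      · simpa [share, Automaton.Path, eq_comm] using hp
  | succ j ih =>
    rw [reach, ih (by omega)]
    constructor
    · rintro (⟨hx, f, hf, hl, ha, hp⟩ | ⟨y, p₀, hy, rfl, hr, htr⟩)
      · refine ⟨hx, f, hf, fun l h h' => (hl l h h').trans (by omega), ha, ?_⟩
        have : f j ≠ i := fun e => by have := hl j (by omega) e; omega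
        simpa [share_succ, this] using hp
      · obtain ⟨hx, f, hf, hl, ha, hp⟩ := (ih (by omega) _ _).1 hr
        have hfj : ¬ f j ≤ i := by
          rw [← hf j (by omega), low_iff.1 hy]
          simp
        have hu (l : ℕ) : Function.update f j i l = if l = j then i else f l := by
          rw [Function.update_apply]
        refine ⟨hy.add_lt (by omega) hx, Function.update f j i, fun l h => ?_, fun l h => ?_,
          ha.congr fun l h i' hi' => ?_, ?_⟩
        · rw [hy.testBit_add, Bool.or_eq_true, hf l h, hu, decide_eq_true_eq]
          split_ifs with h'
          · simp [h']
          · simp [Ne.symm h']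
        · rw [hu]
          have := hl l h
          split_ifs <;> omega
        · rw [hu]
          split_ifs with h'
          · subst h'
            omega
          · rfl
        · rw [share_succ, if_pos (by simp), Automaton.path_snoc]
          refine ⟨p₀, ?_, htr⟩
          rwa [share_congr (g := f) fun l hl => by rw [hu, if_neg (by omega)]]
    · rintro ⟨hx, f, hf, hl, ha, hp⟩
      by_cases hfj : f j = i
      · right
        obtain ⟨y, hy, rfl⟩ := exists_low ((hf j (by omega)).2 hfj.le)
        rw [share_succ, if_pos hfj, Automaton.path_snoc] at hp
        obtain ⟨p₀, hp, htr⟩ := hp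
        have hu (l : ℕ) : Function.update f j (i + 1) l = if l = j then i + 1 else f l := by
          rw [Function.update_apply]
        -- Giving position `j` to thread `i + 1` takes it out of the set.
        refine ⟨y, p₀, hy, rfl, (ih (by omega) _ _).2 ⟨(Nat.le_add_right _ _).trans_lt hx,
          Function.update f j (i + 1), fun l h => ?_, fun l h => ?_,
          ha.congr fun l h i' hi' => ?_, ?_⟩, htr⟩
        · have h1 := hf l h
          rw [hy.testBit_add, Bool.or_eq_true, decide_eq_true_eq] at h1
          rw [hu]
          split_ifs with h'
          · subst h'
            simp [low_iff.1 hy]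
          · rw [← h1]
            simp [Ne.symm h']
        · rw [hu]
          have := hl l h
          split_ifs <;> omega
        · rw [hu]
          split_ifs with h'
          · subst h'
            omega
          · rfl
        · rwa [share_congr (g := f) fun l hl => by rw [hu, if_neg (by omega)]]
      · left
        refine ⟨hx, f, hf, fun l h h' => ?_, ha, ?_⟩
        · have := hl l h h'
          have : l ≠ j := fun e => hfj (e ▸ h')
          omega
        · simpa [share_succ, hfj] using hp

theorem cover_iff (S : SMCP) (d : ℕ → Fin S.m) (k i : ℕ) (hi : i ≤ S.t) (x : ℕ) :
    S.cover d k i x ↔ x < 2 ^ k ∧ ∃ f : ℕ → ℕ,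
      (∀ l < k, x.testBit l = true ↔ f l < i) ∧ S.Accepts d k i f := by
  induction i generalizing x with
  | zero =>
    constructor
    · rintro ⟨rfl⟩
      exact ⟨by positivity, fun _ => 0, fun l _ => by simp, fun i' h => by omega⟩
    · rintro ⟨hx, f, hf, -⟩
      apply Nat.eq_of_testBit_eq
      intro l
      rcases lt_or_ge l k with hl | hl
      · have := hf l hl
        simpa using this
      · simp [Nat.testBit_lt_two_pow (hx.trans_le (Nat.pow_le_pow_right (by omega) hl))]
  | succ i ih =>
    have hi' : i < S.t := hi
    have ih' := ih (by omega)
    rw [cover, ih']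
    have hr := reach_iff hi' ih' k le_rfl x
    constructor
    · rintro (⟨hx, f, hf, ha⟩ | ⟨_, h⟩)
      · have ha' : S.Accepts d k i fun l => if f l < i then f l else i + 1 :=
          ha.congr fun l hl i' hi' => by split_ifs <;> omega
        refine ⟨hx, fun l => if f l < i then f l else i + 1, fun l hl => ?_, fun i' hi' => ?_⟩
        · rw [hf l hl]; dsimp only; split_ifs <;> omega
        · rcases Nat.lt_succ_iff_lt_or_eq.1 hi' with h | h
          · exact ha' i' h
          · refine .inr (share_eq_nil.2 fun j hj => ?_)
            split_ifs <;> omega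
      · obtain ⟨hx, f, hf, -, ha, hp⟩ := (hr _).1 h
        refine ⟨hx, f, fun l hl => by rw [hf l hl]; omega, fun ⟨i', _⟩ h' => ?_⟩
        rcases Nat.lt_succ_iff_lt_or_eq.1 h' with h | h
        · exact ha ⟨i', _⟩ h
        · dsimp only at h
          subst h
          exact .inl (Automaton.mem_lang.2 hp)
    · rintro ⟨hx, f, hf, ha⟩
      have ha' : S.Accepts d k i f := fun i' h => ha i' (by omega)
      rcases ha ⟨i, hi'⟩ (Nat.lt_succ_self i) with h | h
      · exact .inr ⟨hi', (hr _).2 ⟨hx, f, fun l hl => by rw [hf l hl]; omega, fun l hl _ => hl, ha',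
          Automaton.mem_lang.1 h⟩⟩
      · refine .inl ⟨hx, f, fun l hl => ?_, ha'⟩
        have := share_eq_nil.1 h l hl
        simp only [ne_eq] at this
        rw [hf l hl]
        omega

theorem cover_full_iff (S : SMCP) (d : ℕ → Fin S.m) (k : ℕ) :
    S.cover d k S.t (2 ^ k - 1) ↔ S.Covers k d := by
  rw [cover_iff S d k S.t le_rfl]
  have h : 2 ^ k - 1 < 2 ^ k := Nat.sub_lt (by positivity) one_pos
  simp only [h, true_and, Nat.testBit_two_pow_sub_one, decide_eq_true_eq]
  constructor
  · rintro ⟨f, hf, ha⟩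
    exact ⟨f, fun j hj => (hf j hj).1 hj, fun i => ha i i.2⟩
  · rintro ⟨f, hf, ha⟩
    exact ⟨f, fun j hj => ⟨fun _ => hf j hj, fun _ => hj⟩, fun i _ => ha i⟩

end SMCP

/-! ### Tables in memory -/

/-- The list `l` stands in memory from address `a` on. -/
def Seg (mem : ℕ → ℕ) (a : ℕ) (l : List ℕ) : Prop := ∀ j (h : j < l.length), mem (a + j) = l[j]

section Seg

variable {mem : ℕ → ℕ}

theorem Seg.congr {mem' : ℕ → ℕ} {a : ℕ} {l : List ℕ} (h : Seg mem a l)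
    (h' : ∀ x, a ≤ x → x < a + l.length → mem' x = mem x) : Seg mem' a l := fun j hj => by
  rw [h' _ (by omega) (by omega), h j hj]

@[simp] theorem seg_nil {a : ℕ} : Seg mem a [] := fun j h => absurd h (Nat.not_lt_zero j)

theorem seg_cons {a v : ℕ} {l : List ℕ} : Seg mem a (v :: l) ↔ mem a = v ∧ Seg mem (a + 1) l := by
  constructor
  · intro h
    refine ⟨h 0 (by simp), fun j hj => ?_⟩
    rw [add_assoc, add_comm 1 j]
    exact h (j + 1) (by simpa using hj)
  · rintro ⟨h0, h⟩ j hj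
    cases j with
    | zero => exact h0
    | succ j =>
      have := h j (by simpa using hj)
      rwa [add_assoc, add_comm 1 j] at this

theorem seg_append {a : ℕ} {l l' : List ℕ} :
    Seg mem a (l ++ l') ↔ Seg mem a l ∧ Seg mem (a + l.length) l' := by
  induction l generalizing a with
  | nil => simp
  | cons v l ih =>
    rw [List.cons_append, seg_cons, seg_cons, ih, and_assoc, List.length_cons,
      show a + 1 + l.length = a + (l.length + 1) by ring]

/-- `o i` is the address of the `i`-th block. -/
theorem seg_flatMap {α : Type} {l : List α} {f : α → List ℕ} (o : ℕ → ℕ)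
    (ho : ∀ i (h : i < l.length), o (i + 1) = o i + (f l[i]).length) :
    Seg mem (o 0) (l.flatMap f) ↔ ∀ i (h : i < l.length), Seg mem (o i) (f l[i]) := by
  induction l generalizing o with
  | nil => simp
  | cons x l ih =>
    have h0 : o 1 = o 0 + (f x).length := ho 0 (by simp)
    rw [List.flatMap_cons, seg_append, ← h0,
      ih (fun i => o (i + 1)) fun i h => ho (i + 1) (by simpa using h)]
    constructor
    · rintro ⟨h1, h2⟩ i hi
      cases i with
      | zero => exact h1
      | succ i => exact h2 i (by simpa using hi)
    · intro h
      exact ⟨h 0 (by simp), fun i hi => h (i + 1) (by simpa using hi)⟩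

theorem seg_flatMap_finRange {t : ℕ} {f : Fin t → List ℕ} (o : ℕ → ℕ)
    (ho : ∀ i : Fin t, o (i + 1) = o i + (f i).length) :
    Seg mem (o 0) ((List.finRange t).flatMap f) ↔ ∀ i : Fin t, Seg mem (o i) (f i) := by
  rw [seg_flatMap o fun i h => by simpa using ho ⟨i, by simpa using h⟩]
  simp only [List.length_finRange, List.getElem_finRange, Fin.cast_mk]
  exact ⟨fun h i => h i i.2, fun h i hi => h ⟨i, hi⟩⟩

theorem seg_map {α : Type} {l : List α} {f : α → ℕ} {a : ℕ} :
    Seg mem a (l.map f) ↔ ∀ i (h : i < l.length), mem (a + i) = f l[i] := by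
  simp [Seg]

end Seg

open Classical in
/-- The truth value of a proposition as a number. -/
noncomputable def ind (P : Prop) : ℕ := if P then 1 else 0

theorem ind_pos {P : Prop} : 0 < ind P ↔ P := by
  unfold ind
  split_ifs with h <;> simp [h]

theorem table_eq {α σ : Type} (letters : List α) (states : List σ) (A : Automaton α σ) :
    table letters states A = states.flatMap fun p => letters.flatMap fun a => states.map fun p' =>
      ind (A.trans p a p') := rfl

theorem length_table {α σ : Type} (letters : List α) (states : List σ) (A : Automaton α σ) :
    (table letters states A).length = states.length * (letters.length * states.length) := by
  simp [table_eq, List.length_flatMap]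

theorem seg_table {α : Type} {n : ℕ} {letters : List α} {A : Automaton α (Fin n)}
    {mem : ℕ → ℕ} {a : ℕ} : Seg mem a (table letters (List.finRange n) A) ↔
      ∀ (p : Fin n) (j : ℕ) (hj : j < letters.length) (p' : Fin n),
        mem (a + p * (letters.length * n) + j * n + p') = ind (A.trans p letters[j] p') := by
  have h1 := seg_flatMap (mem := mem) (l := List.finRange n) (f := fun p => letters.flatMap fun a =>
    (List.finRange n).map fun p' => ind (A.trans p a p')) (fun i => a + i * (letters.length * n))
    (fun i h => by simp [List.length_flatMap, Nat.succ_mul, Nat.add_assoc])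
  have h2 (i : ℕ) (p : Fin n) := seg_flatMap (mem := mem) (l := letters) (f := fun a =>
    (List.finRange n).map fun p' => ind (A.trans p a p'))
    (fun j => a + i * (letters.length * n) + j * n)
    (fun i h => by simp [Nat.succ_mul, Nat.add_assoc])
  simp only [Nat.zero_mul, Nat.add_zero] at h1 h2
  rw [table_eq, h1]
  simp only [h2, seg_map, List.length_finRange, List.getElem_finRange, Fin.cast_mk]
  exact ⟨fun h p j hj p' => h p p.2 j hj p' p'.2, fun h p hp j hj p' hp' => h ⟨p, hp⟩ j hj ⟨p', hp'⟩⟩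

theorem length_pairs (m : ℕ) : (List.finRange m ×ˢ List.finRange m).length = m * m := by
  rw [List.length_product]; simp

theorem getElem_product {m j : ℕ} (q q' : Fin m) (hj : j = q * m + q')
    (h : j < (List.finRange m ×ˢ List.finRange m).length) :
    (List.finRange m ×ˢ List.finRange m)[j] = (q, q') := by
  subst hj
  have key : ∀ (l : List (Fin m)) (i : ℕ) (x : Fin m), l[i]? = some x →
      (l ×ˢ List.finRange m)[i * m + q']? = some (x, q') := by
    intro l
    induction l with
    | nil => simp
    | cons y l ih =>
      intro i x hx
      rw [List.product_cons]
      cases i with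
      | zero =>
        simp only [List.getElem?_cons_zero, Option.some.injEq] at hx
        rw [List.getElem?_append_left (by simp)]
        simp [hx]
      | succ i =>
        rw [List.getElem?_append_right (by simp [Nat.succ_mul]; omega)]
        rw [List.getElem?_cons_succ] at hx
        rw [← ih i x hx]
        congr 1
        simp [Nat.succ_mul]
        omega
  have h1 := key (List.finRange m) q q (by simp)
  exact (List.getElem?_eq_some_iff.1 h1).2

namespace SMCP

/-- The number of states of thread `i`, and zero if there is no thread `i`. -/
def nn (S : SMCP) (i : ℕ) : ℕ := if h : i < S.t then S.n ⟨i, h⟩ else 0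

/-- The address of thread `i` in the encoding; for `i = t` the length of the encoding. -/
def inAddr (S : SMCP) (i : ℕ) : ℕ :=
  5 + S.m * (S.s * S.m) + ∑ j ∈ Finset.range i, (3 + S.nn j * (S.s * S.nn j))

/-- The position of the table of `B_i` in the list of all these tables. -/
def outPos (S : SMCP) (i : ℕ) : ℕ := ∑ j ∈ Finset.range i, S.nn j * S.m * (S.nn j * S.m)

variable {S : SMCP}

theorem nn_fin (i : Fin S.t) : S.nn i = S.n i := by simp [nn]

theorem nn_of_lt {i : ℕ} (h : i < S.t) : S.nn i = S.n ⟨i, h⟩ := by simp [nn, h]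

theorem inAddr_succ (i : ℕ) :
    S.inAddr (i + 1) = S.inAddr i + 3 + S.nn i * (S.s * S.nn i) := by
  simp only [inAddr, Finset.sum_range_succ]
  ring

theorem outPos_succ (i : ℕ) : S.outPos (i + 1) = S.outPos i + S.nn i * S.m * (S.nn i * S.m) := by
  simp only [outPos, Finset.sum_range_succ]

theorem inAddr_mono {i j : ℕ} (h : i ≤ j) : S.inAddr i ≤ S.inAddr j :=
  monotone_nat_of_le_succ (f := S.inAddr) (fun i => by rw [inAddr_succ]; omega) h

theorem outPos_mono {i j : ℕ} (h : i ≤ j) : S.outPos i ≤ S.outPos j :=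
  monotone_nat_of_le_succ (f := S.outPos) (fun i => by rw [outPos_succ]; omega) h

/-- What the encoding says, entry by entry. -/
structure Loaded (S : SMCP) (mem : ℕ → ℕ) : Prop where
  seg : Seg mem 0 S.encode
  s : mem 0 = S.s
  m : mem 1 = S.m
  t : mem 2 = S.t
  init : mem 3 = S.M.init
  final : mem 4 = S.M.final
  trans : ∀ (q : Fin S.m) (a : Fin S.s) (q' : Fin S.m),
    mem (5 + q * (S.s * S.m) + a * S.m + q') = ind (S.M.trans q a q')
  n : ∀ i : Fin S.t, mem (S.inAddr i) = S.n i
  init_thread : ∀ i : Fin S.t, mem (S.inAddr i + 1) = (S.A i).init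
  final_thread : ∀ i : Fin S.t, mem (S.inAddr i + 2) = (S.A i).final
  trans_thread : ∀ (i : Fin S.t) (p : Fin (S.n i)) (a : Fin S.s) (p' : Fin (S.n i)),
    mem (S.inAddr i + 3 + p * (S.s * S.n i) + a * S.n i + p') = ind ((S.A i).trans p a p')

theorem length_encode : S.encode.length = S.inAddr S.t := by
  have h : ((List.finRange S.t).map fun i : Fin S.t => 3 + S.nn i * (S.s * S.nn i)).sum =
      ∑ j ∈ Finset.range S.t, (3 + S.nn j * (S.s * S.nn j)) := by
    rw [← Fin.sum_univ_eq_sum_range (fun j => 3 + S.nn j * (S.s * S.nn j)),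
      ← List.sum_ofFn, List.ofFn_eq_map]
  rw [inAddr, ← h]
  simp only [encode, List.length_append, List.length_flatMap, length_table, List.length_finRange,
    List.length_cons, List.length_nil, nn_fin]

theorem loaded_of_seg {mem : ℕ → ℕ} (h : Seg mem 0 S.encode) : S.Loaded mem := by
  have h' := h
  rw [encode, seg_append, seg_append] at h
  obtain ⟨⟨h1, h2⟩, h3⟩ := h
  simp only [seg_cons, Nat.zero_add, Nat.reduceAdd, seg_nil, and_true] at h1
  obtain ⟨s0, s1, s2, s3, s4⟩ := h1
  have hbase : 0 + ([S.s, S.m, S.t, (S.M.init : ℕ), (S.M.final : ℕ)] ++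
      table (List.finRange S.s) (List.finRange S.m) S.M).length = S.inAddr 0 := by
    simp [length_table, inAddr]
    ring
  rw [hbase, seg_flatMap_finRange S.inAddr (fun i => by
    simp [length_table, inAddr_succ, nn_fin]
    ring)] at h3
  simp only [seg_append, seg_cons, seg_nil,
    and_true, List.length_cons, List.length_nil, seg_table, List.length_finRange] at h2 h3
  exact ⟨h', s0, s1, s2, s3, s4, fun q a q' => by simpa using h2 q a a.2 q', fun i => (h3 i).1.1,
    fun i => (h3 i).1.2.1, fun i => (h3 i).1.2.2,
    fun i p a p' => by simpa using (h3 i).2 p a a.2 p'⟩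

theorem Loaded.congr {mem mem' : ℕ → ℕ} (h : S.Loaded mem)
    (h' : ∀ a < S.inAddr S.t, mem' a = mem a) : S.Loaded mem' :=
  loaded_of_seg (h.seg.congr fun x _ hx => h' x (by rw [length_encode] at hx; omega))

theorem loaded_start (r : ℕ) : S.Loaded (startState S.encode r).mem :=
  loaded_of_seg fun j hj => by simp [startState, hj]

/-- The table of `B_i`, as a square matrix over the states of the product of `A_i` and `M`, stands
in memory at `a`. -/
def TableAt (S : SMCP) (i : Fin S.t) (mem : ℕ → ℕ) (a : ℕ) : Prop :=
  ∀ (p : Fin (S.n i)) (q q' : Fin S.m) (p' : Fin (S.n i)),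
    mem (a + (p * S.m + q) * (S.n i * S.m) + (q' * S.n i + p')) = ind ((S.B i).trans p (q, q') p')

theorem seg_encodeB {mem : ℕ → ℕ} {a : ℕ} (h : ∀ i : Fin S.t, S.TableAt i mem (a + S.outPos i)) :
    Seg mem a S.encodeB := by
  have h1 := seg_flatMap_finRange (mem := mem) (f := fun i =>
    table (List.finRange S.m ×ˢ List.finRange S.m) (List.finRange (S.n i)) (S.B i))
    (fun i => a + S.outPos i) (fun i => by
      rw [outPos_succ, length_table, length_pairs, List.length_finRange, nn_fin]
      ring)
  simp only [outPos, Finset.range_zero, Finset.sum_empty, Nat.add_zero] at h1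
  rw [encodeB, h1]
  intro i
  rw [seg_table]
  intro p j hj p'
  have hj' : j < S.m * S.m := by rwa [length_pairs] at hj
  have hm : 0 < S.m := (S.M.init).pos
  have e := Nat.div_add_mod j S.m
  have e' : j = (⟨j / S.m, Nat.div_lt_of_lt_mul hj'⟩ : Fin S.m) * S.m +
      (⟨j % S.m, Nat.mod_lt _ hm⟩ : Fin S.m) := by
    simp only
    rw [mul_comm]
    exact e.symm
  rw [getElem_product _ _ e', ← h i]
  simp only [outPos, length_pairs]
  congr 1
  have e'' : j * S.n i =
      (S.m * (j / S.m) + j % S.m) * S.n i := by rw [e]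
  rw [e'']
  ring

end SMCP

/-! ### The common frame of the programs -/

/-- The variables of the programs below. -/
inductive Var where
  | cs | s | m | t | q0 | qf | sm | thr | base | i | n | sn | N | ptr | bp | z
  | w | p | q | q2 | p2 | a | a1 | a2 | pA | pM | v
  | kr | kc | kp | kq | rp | x | y
  | ans | k | full | cnt | tmp | dig | dp | tb | u | j | ini | fin | pw | dn | ph | src | row | row0
  | mN | d | carry
  deriving DecidableEq

instance : Vars Var where
  dec := inferInstance
  idx e := e.ctorIdx
  idx_inj e f h := by
    have key : ∀ e : Var, Var.ofNat e.ctorIdx = e := by intro e; cases e <;> rfl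
    exact (key e).symm.trans ((congrArg Var.ofNat h).trans (key f))
  input := .cs
  idx_input := rfl

local infixr:60 " ;; " => Cmd.seq

/-- Reads the number of states of the thread at `ptr`, and computes the sizes of its table. -/
def header : Cmd Var :=
  .assign .n (.get (.var .ptr)) ;;
  .assign .sn (.lit 0) ;; .addMul .z .sn .n .s ;;
  .assign .N (.lit 0) ;; .addMul .z .N .n .m

/-- Moves `ptr` to the next thread of the input and `bp` to the table of the next `B_i`. -/
def advance : Cmd Var :=
  .assign .ptr (.add (.var .ptr) (.lit 3)) ;; .addMul .z .ptr .n .sn ;; .addMul .z .bp .N .N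

/-- Runs `body` for every thread. -/
def threads (body : Cmd Var) : Cmd Var :=
  .assign .ptr (.var .thr) ;; .assign .bp (.var .base) ;;
  .for_ .i .t (header ;; body ;; advance)

set_option linter.constructorNameAsVariable false

variable {W : ℕ} {s : Store Var} {Q : Store Var → Prop}

theorem header_runs {a n m σ : ℕ} (hptr : s.reg .ptr = a) (hn : s.mem a = n)
    (hs : s.reg .s = σ) (hm : s.reg .m = m) (hsW : n * σ < W) (hmW : n * m < W)
    (hQ : ∀ s' : Store Var, (∀ e ∉ header.writes, s'.reg e = s.reg e) → s'.mem = s.mem →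
      s'.reg .n = n → s'.reg .sn = n * σ → s'.reg .N = n * m → Q s') :
    Runs W header s (n * 20 + 16) Q := by
  have h0 : 0 < W := by omega
  apply Runs.mono (R := fun s' => s'.mem = s.mem ∧ s'.reg .n = n ∧ s'.reg .sn = n * σ ∧
    s'.reg .N = n * m)
  · unfold header
    apply Runs.assign_seq (by simp)
    apply Runs.assign_seq (by simpa using h0)
    apply Runs.addMul_seq (by simp) (by simp) (by simp) (by simp) (by simp)
      0 n σ (by simp) (by simp [hptr, hn]) (by simp [hs]) (by omega)
    intro s1 f1 m1 r1
    apply Runs.assign_seq (by simpa using h0)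
    apply Runs.addMul (by simp) (by simp) (by simp) (by simp) (by simp)
      0 n m (by simp) (by simp [f1, hptr, hn]) (by simp [f1, hm]) (by omega)
    intro s2 f2 m2 r2
    simp [f2, f1, m2, m1, r2, r1, hptr, hn]
  · simp
    ring_nf
    omega
  · rintro s' f ⟨h1, h2, h3, h4⟩
    exact hQ s' f h1 h2 h3 h4

theorem advance_runs {a b n k N : ℕ} (hptr : s.reg .ptr = a) (hn : s.reg .n = n)
    (hs : s.reg .sn = k) (hbp : s.reg .bp = b) (hN : s.reg .N = N) (haW : a + 3 + n * k < W)
    (hbW : b + N * N < W)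
    (hQ : ∀ s' : Store Var, (∀ e ∉ advance.writes, s'.reg e = s.reg e) → s'.mem = s.mem →
      s'.reg .ptr = a + 3 + n * k → s'.reg .bp = b + N * N → Q s') :
    Runs W advance s (n * 10 + N * 10 + 10) Q := by
  apply Runs.mono (R := fun s' => s'.mem = s.mem ∧ s'.reg .ptr = a + 3 + n * k ∧
    s'.reg .bp = b + N * N)
  · unfold advance
    apply Runs.assign_seq (by simp; omega)
    apply Runs.addMul_seq (by simp) (by simp) (by simp) (by simp) (by simp)
      (a + 3) n k (by simp [hptr]) (by simp [hn]) (by simp [hs]) (by omega)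
    intro s1 f1 m1 r1
    apply Runs.addMul (by simp) (by simp) (by simp) (by simp) (by simp)
      b N N (by simp [f1, hbp]) (by simp [f1, hN]) (by simp [f1, hN]) (by omega)
    intro s2 f2 m2 r2
    simp [f2, m2, m1, r2, r1]
  · simp
    omega
  · rintro s' f ⟨h1, h2, h3⟩
    exact hQ s' f h1 h2 h3

/-- The values that are computed once and for all. -/
structure Params (S : SMCP) (τ : Store Var) : Prop where
  s : τ.reg .s = S.s
  m : τ.reg .m = S.m
  t : τ.reg .t = S.t
  thr : τ.reg .thr = S.inAddr 0

theorem Params.congr {S : SMCP} {s s' : Store Var} (h : Params S s)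
    (h' : ∀ e ∈ [Var.s, .m, .t, .thr], s'.reg e = s.reg e) : Params S s' :=
  ⟨by rw [h' _ (by simp), h.s], by rw [h' _ (by simp), h.m], by rw [h' _ (by simp), h.t],
    by rw [h' _ (by simp), h.thr]⟩

/-- The variables hold the data of thread `i`, and `bp` points to its table. -/
structure AtThread (S : SMCP) (b : ℕ) (i : Fin S.t) (τ : Store Var) : Prop extends
    Params S τ where
  ptr : τ.reg .ptr = S.inAddr i
  bp : τ.reg .bp = b + S.outPos i
  n : τ.reg .n = S.n i
  sn : τ.reg .sn = S.n i * S.s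
  N : τ.reg .N = S.n i * S.m

theorem AtThread.congr {S : SMCP} {b : ℕ} {i : Fin S.t} {s s' : Store Var} (h : AtThread S b i s)
    (h' : ∀ e ∈ [Var.s, .m, .t, .thr, .ptr, .bp, .n, .sn, .N], s'.reg e = s.reg e) :
    AtThread S b i s' := by
  simp only [List.mem_cons, List.not_mem_nil, or_false, forall_eq_or_imp, forall_eq] at h'
  obtain ⟨h1, h2, h3, h4, h5, h6, h7, h8, h9⟩ := h'
  exact ⟨⟨h1.trans h.s, h2.trans h.m, h3.trans h.t, h4.trans h.thr⟩, h5.trans h.ptr,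
    h6.trans h.bp, h7.trans h.n, h8.trans h.sn, h9.trans h.N⟩

theorem n_le_b (S : SMCP) (i : Fin S.t) : S.n i ≤ S.b := by
  have := Finset.le_sup (f := fun i => (S.B i).size) (Finset.mem_univ i)
  simpa [SMCP.b, Automaton.size] using this

theorem n_pos (S : SMCP) (i : Fin S.t) : 0 < S.n i := (S.A i).init.pos

theorem m_pos (S : SMCP) : 0 < S.m := S.M.init.pos

/-- The rule for `threads`: the invariant depends on the memory and on the variables that `body` may
change, except for those that hold the data of the thread. -/
theorem threads_runs {S : SMCP} {body : Cmd Var} {b T : ℕ} (I : ℕ → Store Var → Prop)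
    (hI : ∀ i s s', I i s → s'.mem = s.mem →
      (∀ e ∉ (threads .skip).writes, s'.reg e = s.reg e) → I i s')
    (hmem : ∀ i s, I i s → S.Loaded s.mem) (hs : Params S s) (hb : s.reg .base = b)
    (hw : ∀ e ∈ [Var.ptr, .bp, .i, .n, .sn, .N, .thr, .base, .s, .m, .t], e ∉ body.writes)
    (hW : S.inAddr S.t < W) (hW' : b + S.outPos S.t < W) (h0 : I 0 s)
    (hbody : ∀ (i : Fin S.t) (s' : Store Var), I i s' → AtThread S b i s' →
      (∀ e ∉ (threads body).writes, s'.reg e = s.reg e) →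
      Runs W body s' T fun s'' => I (i + 1) s'')
    (hQ : ∀ s' : Store Var, I S.t s' → s'.reg .ptr = S.inAddr S.t →
      s'.reg .bp = b + S.outPos S.t → Q s') :
    Runs W (threads body) s (S.t * (T + 80 * (S.m * S.b)) + 10) Q := by
  simp only [List.mem_cons, List.not_mem_nil, or_false, forall_eq_or_imp, forall_eq] at hw
  obtain ⟨w1, w2, w3, w4, w5, w6, w7, w8, w9, w10, w11⟩ := hw
  have hzt : Var.t ∉ (header ;; body ;; advance).writes := by
    simp [header, advance, Cmd.addMul, w11]
  have hzi : Var.i ∉ (header ;; body ;; advance).writes := by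
    simp [header, advance, Cmd.addMul, w3]
  apply Runs.le
  · unfold threads
    apply Runs.assign_seq (by simp)
    apply Runs.assign_seq (by simp)
    apply Runs.for_ (T := T + 70 * (S.m * S.b)) (fun i s' => I i s' ∧ s'.reg .ptr = S.inAddr i ∧
      s'.reg .bp = b + S.outPos i) S.t (by simp [hs.t]) hzi hzt (by simp)
    · refine ⟨hI _ _ _ h0 rfl fun e he => ?_, by simp [hs.thr], by simp [hb, SMCP.outPos]⟩
      simp [threads, header, advance, Cmd.addMul] at he
      simp [he]
    · rintro i hi s1 ⟨hI1, hptr, hbp⟩ hi1 hf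
      have hin : S.inAddr (i + 1) ≤ S.inAddr S.t := SMCP.inAddr_mono hi
      have hout : S.outPos (i + 1) ≤ S.outPos S.t := SMCP.outPos_mono hi
      rw [SMCP.inAddr_succ, SMCP.nn_of_lt hi] at hin
      rw [SMCP.outPos_succ, SMCP.nn_of_lt hi] at hout
      have hn0 := n_pos S ⟨i, hi⟩
      have hm0 := m_pos S
      have e1 : S.n ⟨i, hi⟩ * S.s ≤ S.n ⟨i, hi⟩ * (S.s * S.n ⟨i, hi⟩) :=
        Nat.mul_le_mul_left _ (Nat.le_mul_of_pos_right _ hn0)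
      have e2 : S.n ⟨i, hi⟩ * S.m ≤ S.n ⟨i, hi⟩ * S.m * (S.n ⟨i, hi⟩ * S.m) :=
        Nat.le_mul_of_pos_right _ (by positivity)
      have hP : Params S s1 := hs.congr fun e he => by
        rw [hf e]
        · simp only [List.mem_cons, List.not_mem_nil, or_false] at he
          rcases he with rfl | rfl | rfl | rfl <;> simp
        · simp only [List.mem_cons, List.not_mem_nil, or_false] at he
          rcases he with rfl | rfl | rfl | rfl <;> simp [header, advance, Cmd.addMul, *]
      apply Runs.le
      · apply Runs.seq (R := fun s2 => s2.mem = s1.mem ∧ s2.reg .n = S.n ⟨i, hi⟩ ∧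
          s2.reg .sn = S.n ⟨i, hi⟩ * S.s ∧ s2.reg .N = S.n ⟨i, hi⟩ * S.m)
        · apply header_runs (σ := S.s) (m := S.m) hptr ((hmem _ _ hI1).n ⟨i, hi⟩) hP.s hP.m
            (by omega) (by omega)
          intro s2 f2 m2 r1 r2 r3
          exact ⟨m2, r1, r2, r3⟩
        · rintro s2 f2 ⟨m2, r1, r2, r3⟩
          have hat : AtThread S b ⟨i, hi⟩ s2 := by
            refine ⟨hP.congr fun e he => ?_, ?_, ?_, r1, r2, r3⟩
            · apply f2
              simp only [List.mem_cons, List.not_mem_nil, or_false] at he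
              rcases he with rfl | rfl | rfl | rfl <;> simp [header, Cmd.addMul]
            · rw [f2 _ (by simp [header, Cmd.addMul]), hptr]
            · rw [f2 _ (by simp [header, Cmd.addMul]), hbp]
          apply Runs.seq
          · apply hbody ⟨i, hi⟩ s2 (hI _ _ _ hI1 m2 fun e he => f2 e fun h => he ?_) hat
            · intro e he
              rw [f2 e fun h => he ?_, hf e fun h => he ?_]
              · simp only [threads, Cmd.writes, List.mem_append, List.mem_cons] at he
                have h1 : e ≠ .ptr := by tauto
                have h2 : e ≠ .bp := by tauto
                simp [h1, h2]
              · simp only [threads, Cmd.writes, List.mem_append, List.mem_cons] at h ⊢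
                tauto
              · simp only [threads, Cmd.writes, List.mem_append, List.mem_cons] at h ⊢
                tauto
            · simp only [threads, Cmd.writes, List.mem_append, List.mem_cons] at h ⊢
              tauto
          · intro s3 f3 hI3
            apply advance_runs (by rw [f3 _ w1, hat.ptr]) (by rw [f3 _ w4, hat.n])
              (by rw [f3 _ w5, hat.sn]) (by rw [f3 _ w2, hat.bp]) (by rw [f3 _ w6, hat.N])
              (by
                have : S.n ⟨i, hi⟩ * (S.n ⟨i, hi⟩ * S.s) = S.n ⟨i, hi⟩ * (S.s * S.n ⟨i, hi⟩) := by
                  ring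
                dsimp only
                omega) (by dsimp only; omega)
            intro s4 f4 m4 r1 r2
            refine ⟨hI _ s3 _ hI3 m4 fun e he => ?_, ?_, ?_⟩
            · have h1 : e ≠ .i := by rintro rfl; simp [threads] at he
              rw [Store.set_reg_ne _ _ h1]
              apply f4
              intro h
              apply he
              simp only [threads, Cmd.writes, List.mem_append, List.mem_cons]
              tauto
            · rw [Store.set_reg_ne _ _ (by simp), r1, SMCP.inAddr_succ, SMCP.nn_of_lt hi]
              ring
            · rw [Store.set_reg_ne _ _ (by simp), r2, SMCP.outPos_succ, SMCP.nn_of_lt hi]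
              ring
      · have h1 := n_le_b S ⟨i, hi⟩
        have h2 : S.n ⟨i, hi⟩ * S.m ≤ S.m * S.b := by
          rw [mul_comm]; exact Nat.mul_le_mul_left _ h1
        have h3 : S.n ⟨i, hi⟩ ≤ S.n ⟨i, hi⟩ * S.m := Nat.le_mul_of_pos_right _ hm0
        omega
    · rintro s1 ⟨h1, h2, h3⟩ - -
      exact hQ s1 h1 h2 h3
  · rcases Nat.eq_zero_or_pos S.t with h | h
    · simp [h]
    · have h1 : 1 ≤ S.m * S.b :=
        Nat.mul_pos (m_pos S) ((n_pos S ⟨0, h⟩).trans_le (n_le_b S ⟨0, h⟩))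
      have : S.t * (T + 70 * (S.m * S.b) + 3) ≤ S.t * (T + 80 * (S.m * S.b)) :=
        Nat.mul_le_mul_left _ (by omega)
      simp
      omega

/-! ### The products of the threads with the memory -/

namespace SMCP

variable {S : SMCP} {i : Fin S.t}

/-- One synchronized step of thread `i` and the memory, or none. -/
def Step (S : SMCP) (i : Fin S.t) (a b : Fin (S.n i) × Fin S.m) : Prop :=
  a = b ∨ ∃ l, (S.A i).trans a.1 l b.1 ∧ S.M.trans a.2 l b.2

/-- The transitions of `B_i` are the reachability relation of the product. -/
theorem B_trans_iff (p p' : Fin (S.n i)) (q q' : Fin S.m) :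
    (S.B i).trans p (q, q') p' ↔ Relation.ReflTransGen (S.Step i) (p, q) (p', q') := by
  simp only [B, Automaton.mem_between]
  constructor
  · rintro ⟨u, h1, h2⟩
    induction u generalizing p q with
    | nil =>
      obtain ⟨rfl⟩ := h1
      obtain ⟨rfl⟩ := h2
      rfl
    | cons l u ih =>
      obtain ⟨r, hr, h1⟩ := h1
      obtain ⟨r', hr', h2⟩ := h2
      exact .head (.inr ⟨l, hr, hr'⟩) (ih r r' h1 h2)
  · intro h
    generalize ha : (p, q) = a at h
    induction h using Relation.ReflTransGen.head_induction_on generalizing p q with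
    | refl =>
      obtain ⟨rfl, rfl⟩ := Prod.mk.inj ha
      exact ⟨[], rfl, rfl⟩
    | head hs _ ih =>
      obtain ⟨u, h1, h2⟩ := ih _ _ rfl
      subst ha
      rcases hs with rfl | ⟨l, h3, h4⟩
      · exact ⟨u, h1, h2⟩
      · exact ⟨l :: u, ⟨_, h3, h1⟩, ⟨_, h4, h2⟩⟩

/-- Entry of the matrix `R` for two states of the product. The states are numbered row by row as
`p * m + q`, but column by column as `q * n + p`: with these numberings the matrix is the transition
table of `B_i`. -/
def Entry (S : SMCP) (i : Fin S.t) (R : ℕ → ℕ → Prop) (a b : Fin (S.n i) × Fin S.m) : Prop :=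
  R (a.1 * S.m + a.2) (b.2 * S.n i + b.1)

theorem pair_inj {m x y : ℕ} {a b : Fin m} (h : x * m + a = y * m + b) : x = y ∧ a = b := by
  have hm : 0 < m := a.pos
  have h1 : x = y := by
    have := congrArg (· / m) h
    simpa [Nat.mul_comm _ m, Nat.mul_add_div hm, Nat.div_eq_of_lt] using this
  subst h1
  exact ⟨rfl, Fin.ext (by omega)⟩

theorem pair_lt {m n x a : ℕ} (hx : x < n) (ha : a < m) : x * m + a < n * m := by
  have : (x + 1) * m ≤ n * m := Nat.mul_le_mul_right _ hx
  rw [Nat.succ_mul] at this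
  omega

/-- The state of Warshall's algorithm: the matrix contains all steps, is contained in the
reachability relation, and is transitive as far as the first `c` states as intermediate states are
concerned. -/
structure Partial (S : SMCP) (i : Fin S.t) (c : ℕ) (R : ℕ → ℕ → Prop) : Prop where
  step : ∀ a b, S.Step i a b → S.Entry i R a b
  sound : ∀ a b, S.Entry i R a b → Relation.ReflTransGen (S.Step i) a b
  trans : ∀ a b (z : Fin (S.n i) × Fin S.m), (z.1 * S.m + z.2 : ℕ) < c → S.Entry i R a z →
    S.Entry i R z b → S.Entry i R a b

theorem Partial.succ {R : ℕ → ℕ → Prop} (z : Fin (S.n i) × Fin S.m)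
    (h : S.Partial i (z.1 * S.m + z.2) R) :
    S.Partial i (z.1 * S.m + z.2 + 1) fun x y =>
      R x y ∨ R x (z.2 * S.n i + z.1) ∧ R (z.1 * S.m + z.2) y := by
  have hE (a b : Fin (S.n i) × Fin S.m) : S.Entry i (fun x y =>
      R x y ∨ R x (z.2 * S.n i + z.1) ∧ R (z.1 * S.m + z.2) y) a b ↔
      S.Entry i R a b ∨ S.Entry i R a z ∧ S.Entry i R z b := Iff.rfl
  refine ⟨fun a b hab => ?_, fun a b hab => ?_, fun a b y hy hay hyb => ?_⟩
  · exact (hE a b).2 (.inl (h.step a b hab))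
  · rcases (hE a b).1 hab with h1 | ⟨h1, h2⟩
    · exact h.sound a b h1
    · exact (h.sound _ _ h1).trans (h.sound _ _ h2)
  · rw [hE] at hay hyb ⊢
    rcases Nat.lt_succ_iff_lt_or_eq.1 hy with hlt | heq
    · have ht := fun a b => h.trans a b y hlt
      rcases hay with h1 | ⟨h1, h1'⟩ <;> rcases hyb with h2 | ⟨h2, h2'⟩
      · exact .inl (ht _ _ h1 h2)
      · exact .inr ⟨ht _ _ h1 h2, h2'⟩
      · exact .inr ⟨h1, ht _ _ h1' h2⟩
      · exact .inr ⟨h1, h2'⟩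
    · obtain ⟨h1, h2⟩ := pair_inj heq
      obtain rfl : y = z := Prod.ext (Fin.ext h1) h2
      tauto

theorem Partial.entry_iff {R : ℕ → ℕ → Prop} (h : S.Partial i (S.n i * S.m) R)
    (a b : Fin (S.n i) × Fin S.m) : S.Entry i R a b ↔ Relation.ReflTransGen (S.Step i) a b := by
  refine ⟨h.sound a b, fun hab => ?_⟩
  induction hab with
  | refl => exact h.step _ _ (.inl rfl)
  | tail _ hs ih => exact h.trans _ _ _ (pair_lt (Fin.is_lt _) (Fin.is_lt _)) ih (h.step _ _ hs)

/-- The matrix of the steps. -/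
def stepMatrix (S : SMCP) (i : Fin S.t) (x y : ℕ) : Prop :=
  ∃ a b, x = a.1 * S.m + a.2 ∧ y = b.2 * S.n i + b.1 ∧ S.Step i a b

theorem stepMatrix_iff (a b : Fin (S.n i) × Fin S.m) :
    S.stepMatrix i (a.1 * S.m + a.2) (b.2 * S.n i + b.1) ↔ S.Step i a b := by
  constructor
  · rintro ⟨a', b', h1, h2, h⟩
    obtain ⟨h3, h4⟩ := pair_inj h1
    obtain ⟨h5, h6⟩ := pair_inj h2
    rwa [show a = a' from Prod.ext (Fin.ext h3) h4, show b = b' from Prod.ext h6 (Fin.ext h5)]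
  · exact fun h => ⟨a, b, rfl, rfl, h⟩

theorem partial_zero : S.Partial i 0 (S.stepMatrix i) :=
  ⟨fun a b h => (stepMatrix_iff a b).2 h, fun a b h => .single ((stepMatrix_iff a b).1 h),
    fun _ _ _ h => absurd h (Nat.not_lt_zero _)⟩

end SMCP

/-- A matrix of zeros and ones, with `M` rows of length `N`, stands in memory at `a`; elsewhere the
memory is `mem₀`. -/
structure Mat (mem₀ mem : ℕ → ℕ) (a M N : ℕ) (R : ℕ → ℕ → Prop) : Prop where
  cell : ∀ x < M, ∀ y < N, mem (a + x * N + y) = ind (R x y)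
  outside : ∀ z, z < a ∨ a + M * N ≤ z → mem z = mem₀ z

theorem Mat.congr {mem₀ mem : ℕ → ℕ} {a M N : ℕ} {R R' : ℕ → ℕ → Prop}
    (h : Mat mem₀ mem a M N R) (hR : ∀ x < M, ∀ y < N, R x y ↔ R' x y) : Mat mem₀ mem a M N R' :=
  ⟨fun x hx y hy => by rw [h.cell x hx y hy, propext (hR x hx y hy)], h.outside⟩

theorem Mat.put {mem₀ : ℕ → ℕ} {s : Store Var} {a M N i j v : ℕ} {R R' : ℕ → ℕ → Prop}
    (h : Mat mem₀ s.mem a M N R) (hi : i < M) (hj : j < N) (hv : v = ind (R' i j))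
    (hR : ∀ x < M, ∀ y < N, ¬ (x = i ∧ y = j) → (R x y ↔ R' x y)) :
    Mat mem₀ (s.put (a + i * N + j) v).mem a M N R' := by
  have hlt := SMCP.pair_lt hi hj
  refine ⟨fun x hx y hy => ?_, fun z hz => ?_⟩
  · rw [Store.put_mem]
    split_ifs with he
    · obtain ⟨h1, h2⟩ := SMCP.pair_inj (a := ⟨y, hy⟩) (b := ⟨j, hj⟩) (x := x) (y := i)
        (by simp only; omega)
      simp only [Fin.mk.injEq] at h2
      rw [hv, h1, h2]
    · rw [h.cell x hx y hy, propext (hR x hx y hy ?_)]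
      rintro ⟨rfl, rfl⟩
      exact he rfl
  · rw [Store.put_mem, if_neg (by omega), h.outside z hz]

/-- Setting an entry to one. -/
theorem Mat.put_one {mem₀ : ℕ → ℕ} {s : Store Var} {a M N i j : ℕ} {R R' : ℕ → ℕ → Prop}
    (h : Mat mem₀ s.mem a M N R) (hi : i < M) (hj : j < N)
    (hR : ∀ x < M, ∀ y < N, R' x y ↔ R x y ∨ (x = i ∧ y = j)) :
    Mat mem₀ (s.put (a + i * N + j) 1).mem a M N R' := by
  refine h.put hi hj ?_ fun x hx y hy hxy => ?_
  · have : R' i j := (hR i hi j hj).2 (.inr ⟨rfl, rfl⟩)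
    simp [ind, this]
  · rw [hR x hx y hy]
    simp [hxy]

/-! ### Computing the automata -/

/-- Writes one entry of the matrix of steps. The registers `a1` and `a2` run through the entries for
all letters in the tables of the thread and of the memory. -/
def cell : Cmd Var :=
  .assign .v (.lit 0) ;; .assign .a1 (.add (.var .pA) (.var .p2)) ;;
  .assign .a2 (.add (.var .pM) (.var .q2)) ;;
  .for_ .a .s (
    .ite (.lit 0) (.get (.var .a1))
      (.ite (.lit 0) (.get (.var .a2)) (.assign .v (.lit 1)) .skip) .skip ;;
    .assign .a1 (.add (.var .a1) (.var .n)) ;; .assign .a2 (.add (.var .a2) (.var .m))) ;;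
  .ifEq (.var .p) (.var .p2) (.ifEq (.var .q) (.var .q2) (.assign .v (.lit 1))) ;;
  .store (.var .w) (.var .v) ;; .assign .w (.add (.var .w) (.lit 1))

/-- Writes the matrix of steps, entry by entry, at `bp`. -/
def fill : Cmd Var :=
  .assign .w (.var .bp) ;; .assign .pA (.add (.var .ptr) (.lit 3)) ;;
  .for_ .p .n (
    .assign .pM (.lit 5) ;;
    .for_ .q .m (.for_ .q2 .m (.for_ .p2 .n cell) ;; .assign .pM (.add (.var .pM) (.var .sm))) ;;
    .assign .pA (.add (.var .pA) (.var .sn)))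

/-- A stage of Warshall's algorithm, for the pivot with row address `kr` and column number `kc`. -/
def stage : Cmd Var :=
  .assign .rp (.var .bp) ;;
  .for_ .x .N (
    .ite (.lit 0) (.get (.add (.var .rp) (.var .kc)))
      (.for_ .y .N (.ite (.lit 0) (.get (.add (.var .kr) (.var .y)))
        (.store (.add (.var .rp) (.var .y)) (.lit 1)) .skip)) .skip ;;
    .assign .rp (.add (.var .rp) (.var .N)))

/-- Warshall's algorithm on the matrix at `bp`. -/
def warshall : Cmd Var :=
  .assign .kr (.var .bp) ;;
  .for_ .kp .n (
    .assign .kc (.var .kp) ;;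
    .for_ .kq .m (
      stage ;; .assign .kr (.add (.var .kr) (.var .N)) ;; .assign .kc (.add (.var .kc) (.var .n))))

theorem stage_runs {mem₀ : ℕ → ℕ} {b N r c : ℕ} {R : ℕ → ℕ → Prop} (hR : Mat mem₀ s.mem b N N R)
    (hbp : s.reg .bp = b) (hN : s.reg .N = N) (hkr : s.reg .kr = b + r * N) (hkc : s.reg .kc = c)
    (hr : r < N) (hc : c < N) (hW : b + N * N < W)
    (hQ : ∀ s' : Store Var, (∀ e ∉ stage.writes, s'.reg e = s.reg e) →
      Mat mem₀ s'.mem b N N (fun x y => R x y ∨ R x c ∧ R r y) → Q s') :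
    Runs W stage s (N * (N * 40 + 40) + 10) Q := by
  have hNN : N * 1 ≤ N * N := Nat.mul_le_mul_left _ (by omega)
  apply Runs.mono (R := fun s' => Mat mem₀ s'.mem b N N (fun x y => R x y ∨ R x c ∧ R r y))
  · unfold stage
    apply Runs.assign_seq (by simp)
    apply Runs.for_ (T := N * 20 + 30) (fun i s' => s'.reg .rp = b + i * N ∧
      Mat mem₀ s'.mem b N N fun x y => R x y ∨ (x < i ∧ R x c ∧ R r y)) N (by simp [hN]) (by decide)
      (by decide) (by decide)
    · exact ⟨by simp [hbp], hR.congr fun x _ y _ => by simp⟩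
    · rintro i hi s1 ⟨hrp, hM⟩ hi1 hf
      have f1 : s1.reg .kc = c := by rw [hf _ (by decide)]; simp [hkc]
      have f2 : s1.reg .kr = b + r * N := by rw [hf _ (by decide)]; simp [hkr]
      have f3 : s1.reg .N = N := by rw [hf _ (by decide)]; simp [hN]
      have hlt := SMCP.pair_lt hi hc
      have hle : i * N + N ≤ N * N := by
        rw [← Nat.succ_mul]; exact Nat.mul_le_mul_right _ hi
      have hv : s1.mem (b + i * N + c) = ind (R i c) := by
        rw [hM.cell i hi c hc]; congr 1; simp
      apply Runs.le
      · apply Runs.seq (R := fun s' => Mat mem₀ s'.mem b N N fun x y => R x y ∨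
          (x < i + 1 ∧ R x c ∧ R r y))
        · apply Runs.ite (T := N * 20 + 2) (by simp; omega) (by simp [hrp, f1]; omega)
          · intro hpos
            simp only [Expr.eval, hrp, f1, hv, ind_pos] at hpos
            apply Runs.le
            · apply Runs.for_ (T := 16) (fun j s' => Mat mem₀ s'.mem b N N fun x y => R x y ∨
                ((x < i ∨ x = i ∧ y < j) ∧ R x c ∧ R r y)) N f3 (by decide) (by decide) (by decide)
              · exact hM.congr fun x _ y _ => by simp
              · rintro j hj s2 hM2 hj2 hf2
                have g1 : s2.reg .kr = b + r * N := by rw [hf2 _ (by decide), f2]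
                have g2 : s2.reg .rp = b + i * N := by rw [hf2 _ (by decide), hrp]
                have hlt1 := SMCP.pair_lt hr hj
                have hlt2 := SMCP.pair_lt hi hj
                -- The stage changes neither the pivot row nor the pivot column, which is why it can
                -- work in place.
                have hv2 : s2.mem (b + r * N + j) = ind (R r j) := by
                  rw [hM2.cell r hr j hj]; congr 1
                  rw [eq_iff_iff]; tauto
                apply Runs.le
                · apply Runs.ite (T := 7) (by simp; omega) (by simp [g1, hj2]; omega)
                  · intro hp
                    simp only [Expr.eval, g1, hj2, hv2, ind_pos] at hp
                    apply Runs.le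
                    · apply Runs.store (by simp [g2, hj2]; omega) (by simp; omega)
                      simp only [Expr.eval, g2, hj2, Store.set_mem]
                      refine hM2.put_one hi hj fun x _ y _ => ?_
                      constructor
                      · rintro (h | ⟨h1 | ⟨h1, h1'⟩, h2⟩)
                        · exact .inl (.inl h)
                        · exact .inl (.inr ⟨.inl h1, h2⟩)
                        · rcases Nat.lt_succ_iff_lt_or_eq.1 h1' with h | h
                          · exact .inl (.inr ⟨.inr ⟨h1, h⟩, h2⟩)
                          · exact .inr ⟨h1, h⟩
                      · rintro ((h | ⟨h1 | ⟨h1, h1'⟩, h2⟩) | ⟨rfl, rfl⟩)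
                        · exact .inl h
                        · exact .inr ⟨.inl h1, h2⟩
                        · exact .inr ⟨.inr ⟨h1, by omega⟩, h2⟩
                        · exact .inr ⟨.inr ⟨rfl, by omega⟩, hpos, hp⟩
                    · simp
                  · intro hp
                    simp only [Expr.eval, g1, hj2, hv2, ind_pos] at hp
                    apply Runs.le (Runs.skip _) (by simp)
                    simp only [Store.set_mem]
                    refine hM2.congr fun x _ y _ => ?_
                    have : y = j → ¬ R r y := by rintro rfl; exact hp
                    constructor
                    · rintro (h | ⟨h1 | ⟨h1, h1'⟩, h2⟩)
                      · exact .inl h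
                      · exact .inr ⟨.inl h1, h2⟩
                      · exact .inr ⟨.inr ⟨h1, by omega⟩, h2⟩
                    · rintro (h | ⟨h1 | ⟨h1, h1'⟩, h2⟩)
                      · exact .inl h
                      · exact .inr ⟨.inl h1, h2⟩
                      · refine .inr ⟨.inr ⟨h1, ?_⟩, h2⟩
                        rcases Nat.lt_succ_iff_lt_or_eq.1 h1' with h | h
                        · exact h
                        · exact absurd h2.2 (this h)
                · simp
              · intro s2 hM2 _ _
                refine hM2.congr fun x _ y hy => ?_
                simp only [hy, and_true, Nat.lt_succ_iff_lt_or_eq]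
            · omega
          · intro hpos
            simp only [Expr.eval, hrp, f1, hv, ind_pos] at hpos
            apply Runs.le (Runs.skip _) (by omega)
            refine hM.congr fun x _ y _ => ?_
            have : x = i → ¬ R x c := by rintro rfl; exact hpos
            rw [Nat.lt_succ_iff_lt_or_eq]
            tauto
        · intro s2 hf2 hM2
          have g1 : s2.reg .rp = b + i * N := by rw [hf2 _ (by decide), hrp]
          have g2 : s2.reg .N = N := by rw [hf2 _ (by decide), f3]
          apply Runs.assign (by simp [g1, g2]; omega)
          refine ⟨?_, hM2⟩
          simp [g1, g2]
          ring
      · simp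
        omega
    · rintro s1 ⟨_, hM⟩ _ _
      refine hM.congr fun x hx y _ => ?_
      simp [hx]
  · simp
    have : N * (N * 20 + 30 + 3) ≤ N * (N * 40 + 40) := Nat.mul_le_mul_left _ (by omega)
    omega
  · exact fun s' f h => hQ s' f h

theorem warshall_runs {S : SMCP} {i : Fin S.t} {mem₀ : ℕ → ℕ} {b : ℕ} (hat : AtThread S b i s)
    (hM : Mat mem₀ s.mem (b + S.outPos i) (S.n i * S.m) (S.n i * S.m) (S.stepMatrix i))
    (hW : b + S.outPos i + S.n i * S.m * (S.n i * S.m) + S.n i * S.m < W)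
    (hQ : ∀ s' : Store Var, (∀ e ∉ warshall.writes, s'.reg e = s.reg e) → ∀ R,
      Mat mem₀ s'.mem (b + S.outPos i) (S.n i * S.m) (S.n i * S.m) R →
      S.Partial i (S.n i * S.m) R → Q s') :
    Runs W warshall s (S.n i * S.m * (S.n i * S.m * (S.n i * S.m * 40 + 40) + 60) + 10) Q := by
  have hn := n_pos S i
  have hm := m_pos S
  obtain ⟨n, hn'⟩ : ∃ n, n = S.n i := ⟨_, rfl⟩
  obtain ⟨m, hm'⟩ : ∃ m, m = S.m := ⟨_, rfl⟩
  obtain ⟨N, hN'⟩ : ∃ N, N = n * m := ⟨_, rfl⟩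
  obtain ⟨B, hB'⟩ : ∃ B, B = b + S.outPos i := ⟨_, rfl⟩
  have r1 := hat.bp
  have r2 := hat.n
  have r3 := hat.N
  have r4 := hat.m
  rw [← hn', ← hm', ← hB', ← hN'] at hM hW hQ
  rw [← hn', ← hm', ← hN']
  rw [← hB'] at r1
  rw [← hn'] at r2 hn
  rw [← hn', ← hm', ← hN'] at r3
  rw [← hm'] at r4 hm
  have hnN : n ≤ N := hN' ▸ Nat.le_mul_of_pos_right _ hm
  apply Runs.mono (R := fun s' => ∃ R, Mat mem₀ s'.mem B N N R ∧ S.Partial i N R)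
  · unfold warshall
    apply Runs.assign_seq (by simp)
    apply Runs.for_ (T := m * (N * (N * 40 + 40) + 30) + 10) (fun kp s' =>
      s'.reg .kr = B + kp * m * N ∧ ∃ R, Mat mem₀ s'.mem B N N R ∧ S.Partial i (kp * m) R) n
      (by simp [r2]) (by decide) (by decide) (by decide)
    · exact ⟨by simp [r1], _, hM, by simpa using SMCP.partial_zero⟩
    · rintro kp hkp s1 ⟨hkr, R, hR, hP⟩ hi1 hf
      have f1 : s1.reg .m = m := by rw [hf _ (by decide)]; simp [r4]
      have f2 : s1.reg .N = N := by rw [hf _ (by decide)]; simp [r3]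
      have f3 : s1.reg .bp = B := by rw [hf _ (by decide)]; simp [r1]
      have f4 : s1.reg .n = n := by rw [hf _ (by decide)]; simp [r2]
      apply Runs.le
      · apply Runs.assign_seq (by simp)
        apply Runs.for_ (T := N * (N * 40 + 40) + 26) (fun kq s' =>
          s'.reg .kr = B + (kp * m + kq) * N ∧ s'.reg .kc = kq * n + kp ∧
          ∃ R, Mat mem₀ s'.mem B N N R ∧ S.Partial i (kp * m + kq) R) m
          (by simp [f1]) (by decide) (by decide) (by decide)
        · exact ⟨by simp [hkr], by simp [hi1], R, hR, by simpa using hP⟩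
        · rintro kq hkq s2 ⟨hkr, hkc, R, hR, hP⟩ hi2 hf2
          have g2 : s2.reg .N = N := by rw [hf2 _ (by decide)]; simp [f2]
          have g3 : s2.reg .bp = B := by rw [hf2 _ (by decide)]; simp [f3]
          have g4 : s2.reg .n = n := by rw [hf2 _ (by decide)]; simp [f4]
          have hr : kp * m + kq < N := hN' ▸ SMCP.pair_lt hkp hkq
          have hc : kq * n + kp < N := by
            rw [hN', mul_comm n m]; exact SMCP.pair_lt hkq hkp
          have hrow : (kp * m + kq + 1) * N ≤ N * N := Nat.mul_le_mul_right _ hr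
          rw [Nat.succ_mul] at hrow
          apply Runs.le
          · apply Runs.seq (R := fun s' => ∃ R, Mat mem₀ s'.mem B N N R ∧
              S.Partial i (kp * m + kq + 1) R)
            · apply stage_runs hR g3 g2 hkr hkc hr hc (by omega)
              intro s3 _ hM3
              have := hP
              subst hn' hm'
              exact ⟨_, hM3, SMCP.Partial.succ (⟨kp, hkp⟩, ⟨kq, hkq⟩) hP⟩
            · rintro s3 f3 ⟨R', hR', hP'⟩
              have k1 : s3.reg .kr = B + (kp * m + kq) * N := by rw [f3 _ (by decide), hkr]
              have k2 : s3.reg .kc = kq * n + kp := by rw [f3 _ (by decide), hkc]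
              have k3 : s3.reg .N = N := by rw [f3 _ (by decide), g2]
              have k4 : s3.reg .n = n := by rw [f3 _ (by decide), g4]
              apply Runs.assign_seq (by simp [k1, k3]; omega)
              apply Runs.assign (by simp [k2, k4]; omega)
              refine ⟨?_, ?_, R', hR', hP'⟩
              · simp [k1, k3]; ring
              · simp [k2, k4]; ring
          · simp
        · rintro s2 ⟨h1, _, R, hR, hP⟩ _ _
          have e : (kp + 1) * m = kp * m + m := Nat.succ_mul _ _
          exact ⟨by simp [h1, e], R, hR, by rwa [e]⟩
      · simp
        have : m * (N * (N * 40 + 40) + 26 + 3) ≤ m * (N * (N * 40 + 40) + 30) :=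
          Nat.mul_le_mul_left _ (by omega)
        omega
    · rintro s1 ⟨_, R, hR, hP⟩ _ _
      exact ⟨R, hR, by rwa [hN']⟩
  · simp
    have : n * (m * (N * (N * 40 + 40) + 30) + 10 + 3) ≤ N * (N * (N * 40 + 40) + 60) := by
      generalize N * (N * 40 + 40) = X
      rw [hN', mul_assoc]
      refine Nat.mul_le_mul_left _ ?_
      rw [Nat.mul_add m _ 30, Nat.mul_add m _ 60]
      omega
    omega
  · rintro s' f ⟨R, hR, hP⟩
    exact hQ s' f R hR hP

theorem cell_runs {S : SMCP} {i : Fin S.t} {b : ℕ} (hat : AtThread S b i s) (hL : S.Loaded s.mem)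
    (hW : S.inAddr S.t + S.inAddr S.t + S.b + S.m < W) {p q q2 p2 w : ℕ} (hp : p < S.n i)
    (hq : q < S.m) (hq2 : q2 < S.m) (hp2 : p2 < S.n i) (rp : s.reg .p = p) (rq : s.reg .q = q)
    (rq2 : s.reg .q2 = q2) (rp2 : s.reg .p2 = p2) (rw_ : s.reg .w = w)
    (rpA : s.reg .pA = S.inAddr i + 3 + p * (S.s * S.n i))
    (rpM : s.reg .pM = 5 + q * (S.s * S.m)) (hw : w + 1 < W)
    (hQ : ∀ s' : Store Var, s'.mem = (s.put w (ind (S.Step i (⟨p, hp⟩, ⟨q, hq⟩)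
      (⟨p2, hp2⟩, ⟨q2, hq2⟩)))).mem → s'.reg .w = w + 1 → Q s') :
    Runs W cell s (S.s * 50 + 80) Q := by
  have hb := n_le_b S i
  have hA : S.inAddr (i + 1) ≤ S.inAddr S.t := SMCP.inAddr_mono i.2
  rw [SMCP.inAddr_succ, SMCP.nn_fin] at hA
  have hpn : (p + 1) * (S.s * S.n i) ≤ S.n i * (S.s * S.n i) := Nat.mul_le_mul_right _ hp
  have hqm : (q + 1) * (S.s * S.m) ≤ S.m * (S.s * S.m) := Nat.mul_le_mul_right _ hq
  have hM : 5 + S.m * (S.s * S.m) ≤ S.inAddr S.t :=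
    (Nat.le_add_right _ _).trans (SMCP.inAddr_mono (Nat.zero_le _))
  rw [Nat.succ_mul] at hpn hqm
  obtain ⟨AA, hAA⟩ : ∃ AA, AA = S.inAddr i + 3 + p * (S.s * S.n i) + p2 := ⟨_, rfl⟩
  obtain ⟨MM, hMM⟩ : ∃ MM, MM = 5 + q * (S.s * S.m) + q2 := ⟨_, rfl⟩
  apply Runs.mono (R := fun s' => s'.mem = (s.put w (ind (S.Step i (⟨p, hp⟩, ⟨q, hq⟩)
      (⟨p2, hp2⟩, ⟨q2, hq2⟩)))).mem ∧ s'.reg .w = w + 1)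
  · unfold cell
    apply Runs.assign_seq (by simp; omega)
    apply Runs.assign_seq (by simp [rpA, rp2]; omega)
    apply Runs.assign_seq (by simp [rpM, rq2]; omega)
    apply Runs.seq (R := fun s' => s'.mem = s.mem ∧ s'.reg .v = ind (∃ l,
      (S.A i).trans ⟨p, hp⟩ l ⟨p2, hp2⟩ ∧ S.M.trans ⟨q, hq⟩ l ⟨q2, hq2⟩))
    · apply Runs.for_ (T := 36) (fun a s' => s'.mem = s.mem ∧ s'.reg .a1 = AA + a * S.n i ∧
        s'.reg .a2 = MM + a * S.m ∧ s'.reg .v = ind (∃ l : Fin S.s, (l : ℕ) < a ∧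
        (S.A i).trans ⟨p, hp⟩ l ⟨p2, hp2⟩ ∧ S.M.trans ⟨q, hq⟩ l ⟨q2, hq2⟩)) S.s
        (by simp [hat.s]) (by decide) (by decide) (by decide)
      · refine ⟨rfl, by simp [rpA, rp2, hAA], by simp [rpM, rq2, hMM], by simp [ind]⟩
      · rintro a ha s1 ⟨hm, ra1, ra2, rv⟩ ra hf
        have f1 : s1.reg .n = S.n i := by rw [hf _ (by decide)]; simp [hat.n]
        have f2 : s1.reg .m = S.m := by rw [hf _ (by decide)]; simp [hat.m]
        have v1 : s1.mem (AA + a * S.n i) = ind ((S.A i).trans ⟨p, hp⟩ ⟨a, ha⟩ ⟨p2, hp2⟩) := by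
          rw [hm, ← hL.trans_thread i ⟨p, hp⟩ ⟨a, ha⟩ ⟨p2, hp2⟩]
          congr 1
          simp only
          omega
        have v2 : s1.mem (MM + a * S.m) = ind (S.M.trans ⟨q, hq⟩ ⟨a, ha⟩ ⟨q2, hq2⟩) := by
          rw [hm, ← hL.trans ⟨q, hq⟩ ⟨a, ha⟩ ⟨q2, hq2⟩]
          congr 1
          simp only
          omega
        have e1 : (a + 1) * S.n i ≤ S.s * S.n i := Nat.mul_le_mul_right _ ha
        have e2 : (a + 1) * S.m ≤ S.s * S.m := Nat.mul_le_mul_right _ ha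
        have hsplit : (∃ l : Fin S.s, (l : ℕ) < a + 1 ∧
            (S.A i).trans ⟨p, hp⟩ l ⟨p2, hp2⟩ ∧ S.M.trans ⟨q, hq⟩ l ⟨q2, hq2⟩) ↔
            ((S.A i).trans ⟨p, hp⟩ ⟨a, ha⟩ ⟨p2, hp2⟩ ∧ S.M.trans ⟨q, hq⟩ ⟨a, ha⟩ ⟨q2, hq2⟩) ∨
            ∃ l : Fin S.s, (l : ℕ) < a ∧
            (S.A i).trans ⟨p, hp⟩ l ⟨p2, hp2⟩ ∧ S.M.trans ⟨q, hq⟩ l ⟨q2, hq2⟩ := by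
          constructor
          · rintro ⟨l, hl, h⟩
            rcases Nat.lt_succ_iff_lt_or_eq.1 hl with hl | hl
            · exact .inr ⟨l, hl, h⟩
            · obtain rfl : l = ⟨a, ha⟩ := Fin.ext hl
              exact .inl h
          · rintro (h | ⟨l, hl, h⟩)
            · exact ⟨⟨a, ha⟩, Nat.lt_succ_self a, h⟩
            · exact ⟨l, by omega, h⟩
        rw [Nat.succ_mul] at e1 e2
        apply Runs.le
        · apply Runs.seq (R := fun s' => s'.mem = s.mem ∧ s'.reg .a1 = AA + a * S.n i ∧
            s'.reg .a2 = MM + a * S.m ∧ s'.reg .v = ind (∃ l : Fin S.s, (l : ℕ) < a + 1 ∧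
            (S.A i).trans ⟨p, hp⟩ l ⟨p2, hp2⟩ ∧ S.M.trans ⟨q, hq⟩ l ⟨q2, hq2⟩))
          · rw [hsplit]
            apply Runs.ite (T := 8) (by simp; omega) (by simp)
            · intro h1
              simp only [Expr.eval, ra1, v1, ind_pos] at h1
              apply Runs.le
              · apply Runs.ite (T := 3) (by simp; omega) (by simp)
                · intro h2
                  simp only [Expr.eval, ra2, v2, ind_pos] at h2
                  apply Runs.le
                  · apply Runs.assign (by simp; omega)
                    exact ⟨hm, by simp [ra1], by simp [ra2], by simp [ind, h1, h2]⟩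
                  · simp
                · intro h2
                  simp only [Expr.eval, ra2, v2, ind_pos] at h2
                  exact Runs.le (Runs.skip ⟨hm, ra1, ra2, by simp [h2, rv]⟩) (by simp)
              · simp
            · intro h1
              simp only [Expr.eval, ra1, v1, ind_pos] at h1
              exact Runs.le (Runs.skip ⟨hm, ra1, ra2, by simp [h1, rv]⟩) (by simp)
          · rintro s2 hf2 ⟨hm2, k1, k2, k3⟩
            have g1 : s2.reg .n = S.n i := by rw [hf2 _ (by decide), f1]
            have g2 : s2.reg .m = S.m := by rw [hf2 _ (by decide), f2]
            apply Runs.assign_seq (by simp [k1, g1]; omega)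
            apply Runs.assign (by simp [k2, g2]; omega)
            refine ⟨hm2, ?_, ?_, ?_⟩
            · simp [k1, g1]; ring
            · simp [k2, g2]; ring
            · simp [k3]
        · simp
      · rintro s1 ⟨h1, _, _, h2⟩ _ _
        refine ⟨h1, h2.trans ?_⟩
        simp
    · rintro s1 hf ⟨hm1, rv⟩
      have f1 : s1.reg .p = p := by rw [hf _ (by decide)]; simp [rp]
      have f2 : s1.reg .p2 = p2 := by rw [hf _ (by decide)]; simp [rp2]
      have f3 : s1.reg .q = q := by rw [hf _ (by decide)]; simp [rq]
      have f4 : s1.reg .q2 = q2 := by rw [hf _ (by decide)]; simp [rq2]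
      have f5 : s1.reg .w = w := by rw [hf _ (by decide)]; simp [rw_]
      have hstep : S.Step i (⟨p, hp⟩, ⟨q, hq⟩) (⟨p2, hp2⟩, ⟨q2, hq2⟩) ↔ (p = p2 ∧ q = q2) ∨ ∃ l,
          (S.A i).trans ⟨p, hp⟩ l ⟨p2, hp2⟩ ∧ S.M.trans ⟨q, hq⟩ l ⟨q2, hq2⟩ := by
        simp [SMCP.Step]
      rw [hstep]
      apply Runs.seq (R := fun s' => s'.mem = s.mem ∧ s'.reg .v = ind ((p = p2 ∧ q = q2) ∨ ∃ l,
          (S.A i).trans ⟨p, hp⟩ l ⟨p2, hp2⟩ ∧ S.M.trans ⟨q, hq⟩ l ⟨q2, hq2⟩))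
      · apply Runs.ifEq (T := 13) (by omega) (by simp) (by simp)
        · intro h1
          simp only [Expr.eval, f1, f2] at h1
          apply Runs.le
          · apply Runs.ifEq (T := 3) (by omega) (by simp) (by simp)
            · intro h2
              simp only [Expr.eval, f3, f4] at h2
              apply Runs.assign (by simp; omega)
              exact ⟨hm1, by simp [ind, h1, h2]⟩
            · intro h2
              simp only [Expr.eval, f3, f4] at h2
              exact ⟨hm1, by simp [h2, rv]⟩
          · simp
        · intro h1
          simp only [Expr.eval, f1, f2] at h1
          exact ⟨hm1, by simp [h1, rv]⟩
      · rintro s2 hf2 ⟨hm2, rv⟩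
        have g1 : s2.reg .w = w := by rw [hf2 _ (by decide), f5]
        apply Runs.store_seq (by simp) (by simp)
        apply Runs.assign (by simp [g1]; omega)
        simp [g1, rv, Store.put, hm2]
  · simp
    omega
  · exact fun s' _ h => hQ s' h.1 h.2

/-- The first `c` entries of the matrix of steps have been written at `B`; elsewhere the memory is
`mem₀`. -/
structure Filled (S : SMCP) (i : Fin S.t) (mem₀ : ℕ → ℕ) (B c : ℕ) (τ : Store Var) : Prop where
  w : τ.reg .w = B + c
  cell : ∀ x < c, τ.mem (B + x) =
    ind (S.stepMatrix i (x / (S.n i * S.m)) (x % (S.n i * S.m)))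
  outside : ∀ z, z < B ∨ B + c ≤ z → τ.mem z = mem₀ z

theorem Filled.set {S : SMCP} {i : Fin S.t} {mem₀ : ℕ → ℕ} {B c : ℕ} (h : Filled S i mem₀ B c s)
    (e : Var) (v : ℕ) (he : Var.w ≠ e) : Filled S i mem₀ B c (s.set e v) :=
  ⟨by rw [Store.set_reg_ne _ _ he, h.w], h.cell, h.outside⟩

theorem fill_row_runs {S : SMCP} {i : Fin S.t} {b B : ℕ} {mem₀ : ℕ → ℕ} (hat : AtThread S b i s)
    (hL : S.Loaded mem₀) (hB : S.inAddr S.t ≤ B)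
    (hW : S.inAddr S.t + S.inAddr S.t + S.b + S.m < W)
    (hW' : B + S.n i * S.m * (S.n i * S.m) < W) {p q q2 : ℕ} (hp : p < S.n i)
    (hq : q < S.m) (hq2 : q2 < S.m) (rp : s.reg .p = p) (rq : s.reg .q = q)
    (rq2 : s.reg .q2 = q2)
    (rpA : s.reg .pA = S.inAddr i + 3 + p * (S.s * S.n i))
    (rpM : s.reg .pM = 5 + q * (S.s * S.m))
    (hI : Filled S i mem₀ B (((p * S.m + q) * S.m + q2) * S.n i) s) :
    Runs W (.for_ .p2 .n cell) s (S.n i * (S.s * 50 + 83) + 2)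
      (Filled S i mem₀ B (((p * S.m + q) * S.m + (q2 + 1)) * S.n i)) := by
  apply Runs.for_ (T := S.s * 50 + 80) (fun p2 s' =>
    Filled S i mem₀ B (((p * S.m + q) * S.m + q2) * S.n i + p2) s') (S.n i) hat.n (by decide)
    (by decide) (by decide)
  · exact hI.set _ _ (by simp)
  · rintro p2 hp2 s4 hI4 hi4 hf4
    have hr := SMCP.pair_lt hp hq
    have hc : q2 * S.n i + p2 < S.n i * S.m := by
      rw [mul_comm (S.n i)]; exact SMCP.pair_lt hq2 hp2
    have hN : 0 < S.n i * S.m := by omega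
    have hlt := SMCP.pair_lt hr hc
    have e0 : (p * S.m + q) * (S.n i * S.m) + (q2 * S.n i + p2) =
        ((p * S.m + q) * S.m + q2) * S.n i + p2 := by
      ring
    have hat4 : AtThread S b i s4 := hat.congr fun e he => hf4 e (by revert he; revert e; decide)
    have hL4 : S.Loaded s4.mem := hL.congr fun z hz => hI4.outside z (.inl (by omega))
    apply cell_runs hat4 hL4 hW hp hq hq2 hp2 (by rw [hf4 _ (by decide), rp])
      (by rw [hf4 _ (by decide), rq]) (by rw [hf4 _ (by decide), rq2]) hi4 hI4.w
      (by rw [hf4 _ (by decide), rpA]) (by rw [hf4 _ (by decide), rpM]) (by omega)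
    intro s5 hmem hw5
    refine ⟨by simp [hw5]; ring, fun x hx => ?_, fun z hz => ?_⟩
    · rw [Store.set_mem, hmem, Store.put_mem]
      split_ifs with he
      · have hx' : x = S.n i * S.m * (p * S.m + q) + (q2 * S.n i + p2) := by
          rw [mul_comm (S.n i * S.m), e0]; omega
        rw [hx', Nat.mul_add_div hN, Nat.div_eq_of_lt hc, Nat.mul_add_mod,
          Nat.mod_eq_of_lt hc, add_zero]
        congr 1
        exact propext (SMCP.stepMatrix_iff (S := S) (i := i)
          (⟨p, hp⟩, ⟨q, hq⟩) (⟨p2, hp2⟩, ⟨q2, hq2⟩)).symm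
      · exact hI4.cell x (by omega)
    · rw [Store.set_mem, hmem, Store.put_mem, if_neg (by omega)]
      exact hI4.outside z (by omega)
  · intro s4 h _ _
    rwa [show ((p * S.m + q) * S.m + (q2 + 1)) * S.n i =
      ((p * S.m + q) * S.m + q2) * S.n i + S.n i by ring]

theorem fill_rows_runs {S : SMCP} {i : Fin S.t} {b B : ℕ} {mem₀ : ℕ → ℕ} (hat : AtThread S b i s)
    (hL : S.Loaded mem₀) (hB : S.inAddr S.t ≤ B)
    (hW : S.inAddr S.t + S.inAddr S.t + S.b + S.m < W)
    (hW' : B + S.n i * S.m * (S.n i * S.m) < W) {p : ℕ} (hp : p < S.n i)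
    (rp : s.reg .p = p) (rpA : s.reg .pA = S.inAddr i + 3 + p * (S.s * S.n i))
    (rpM : s.reg .pM = 5) (rsm : s.reg .sm = S.s * S.m)
    (hI : Filled S i mem₀ B (p * S.m * S.m * S.n i) s) :
    Runs W (.for_ .q .m (.for_ .q2 .m (.for_ .p2 .n cell) ;;
        .assign .pM (.add (.var .pM) (.var .sm)))) s
      (S.m * (S.m * (S.n i * (S.s * 50 + 83) + 5) + 12) + 2)
      (Filled S i mem₀ B ((p + 1) * S.m * S.m * S.n i)) := by
  have hM : 5 + S.m * (S.s * S.m) ≤ S.inAddr S.t :=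
    (Nat.le_add_right _ _).trans (SMCP.inAddr_mono (Nat.zero_le _))
  apply Runs.for_ (T := S.m * (S.n i * (S.s * 50 + 83) + 5) + 9) (fun q s' =>
    s'.reg .pM = 5 + q * (S.s * S.m) ∧ Filled S i mem₀ B ((p * S.m + q) * S.m * S.n i) s') S.m
    hat.m (by decide) (by decide) (by decide)
  · exact ⟨by simp [rpM], hI.set _ _ (by simp)⟩
  · rintro q hq s2 ⟨hpM, hI2⟩ hi2 hf2
    have hqm : (q + 1) * (S.s * S.m) ≤ S.m * (S.s * S.m) := Nat.mul_le_mul_right _ hq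
    rw [Nat.succ_mul] at hqm
    have hat2 : AtThread S b i s2 := hat.congr fun e he => hf2 e (by revert he; revert e; decide)
    apply Runs.le
    · apply Runs.seq (R := Filled S i mem₀ B ((p * S.m + (q + 1)) * S.m * S.n i))
      · apply Runs.for_ (T := S.n i * (S.s * 50 + 83) + 2) (fun q2 s' =>
          Filled S i mem₀ B (((p * S.m + q) * S.m + q2) * S.n i) s') S.m hat2.m (by decide)
          (by decide) (by decide)
        · exact Filled.set (by simpa using hI2) _ _ (by simp)
        · rintro q2 hq2 s3 hI3 hi3 hf3
          have hat3 : AtThread S b i s3 :=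
            hat2.congr fun e he => hf3 e (by revert he; revert e; decide)
          refine (fill_row_runs hat3 hL hB hW hW' hp hq hq2 ?_ ?_ hi3 ?_ ?_ hI3).mono le_rfl
            fun s4 _ h => h.set _ _ (by simp)
          · rw [hf3 _ (by decide), hf2 _ (by decide), rp]
          · rw [hf3 _ (by decide), hi2]
          · rw [hf3 _ (by decide), hf2 _ (by decide), rpA]
          · rw [hf3 _ (by decide), hpM]
        · intro s3 h _ _
          rwa [show (p * S.m + (q + 1)) * S.m * S.n i = ((p * S.m + q) * S.m + S.m) * S.n i by ring]
      · intro s3 hf3 hI3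
        have k1 : s3.reg .pM = 5 + q * (S.s * S.m) := by rw [hf3 _ (by decide), hpM]
        have k2 : s3.reg .sm = S.s * S.m := by
          rw [hf3 _ (by decide), hf2 _ (by decide), rsm]
        apply Runs.assign (by simp [k1, k2]; omega)
        refine ⟨?_, (hI3.set _ _ (by simp)).set _ _ (by simp)⟩
        simp [k1, k2]
        ring
    · simp
  · rintro s2 ⟨_, h⟩ _ _
    rwa [show (p + 1) * S.m * S.m * S.n i = (p * S.m + S.m) * S.m * S.n i by ring]

theorem fill_runs {S : SMCP} {i : Fin S.t} {b : ℕ} (hat : AtThread S b i s) (hL : S.Loaded s.mem)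
    (hsm : s.reg .sm = S.s * S.m) (hb : S.inAddr S.t ≤ b)
    (hW : S.inAddr S.t + S.inAddr S.t + S.b + S.m < W)
    (hW' : b + S.outPos i + S.n i * S.m * (S.n i * S.m) < W)
    (hQ : ∀ s' : Store Var, (∀ e ∉ fill.writes, s'.reg e = s.reg e) →
      Mat s.mem s'.mem (b + S.outPos i) (S.n i * S.m) (S.n i * S.m) (S.stepMatrix i) → Q s') :
    Runs W fill s (S.n i * S.m * (S.n i * S.m) * (S.s * 50 + 150) + 20) Q := by
  have hn := n_pos S i
  have hm := m_pos S
  have hN := Nat.mul_pos hn hm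
  have hin := SMCP.inAddr_mono (S := S) (Nat.zero_le S.t)
  have hin0 : S.inAddr 0 = 5 + S.m * (S.s * S.m) := by simp [SMCP.inAddr]
  have hini := SMCP.inAddr_mono (S := S) (Nat.succ_le_of_lt i.2)
  rw [Nat.succ_eq_add_one, SMCP.inAddr_succ, SMCP.nn_fin] at hini
  apply Runs.mono (R := Filled S i s.mem (b + S.outPos i) (S.n i * S.m * S.m * S.n i))
  · unfold fill
    apply Runs.assign_seq (by simp)
    apply Runs.assign_seq (by simp [hat.ptr]; omega)
    apply Runs.for_ (T := S.m * (S.m * (S.n i * (S.s * 50 + 83) + 5) + 12) + 20) (fun p s' =>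
      s'.reg .pA = S.inAddr i + 3 + p * (S.s * S.n i) ∧
      Filled S i s.mem (b + S.outPos i) (p * S.m * S.m * S.n i) s') (S.n i)
      (by simp [hat.n]) (by decide) (by decide) (by decide)
    · exact ⟨by simp [hat.ptr], by simp [hat.bp], by simp, by simp⟩
    · rintro p hp s1 ⟨hpA, hI1⟩ hi1 hf
      have f1 : s1.reg .sm = S.s * S.m := by rw [hf _ (by decide)]; simp [hsm]
      have hat1 : AtThread S b i s1 := by
        refine AtThread.congr (s := (s.set .w (s.reg .bp)).set .pA (s.reg .ptr + 3)) ?_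
          fun e he => hf e (by revert he; revert e; decide)
        refine hat.congr fun e he => ?_
        rw [Store.set_reg_ne _ _ (by rintro rfl; revert he; decide),
          Store.set_reg_ne _ _ (by rintro rfl; revert he; decide)]
      have hpn : (p + 1) * (S.s * S.n i) ≤ S.n i * (S.s * S.n i) := Nat.mul_le_mul_right _ hp
      rw [Nat.succ_mul] at hpn
      apply Runs.le
      · apply Runs.assign_seq (by simp; omega)
        apply Runs.seq (R := Filled S i s.mem (b + S.outPos i) ((p + 1) * S.m * S.m * S.n i))
        · apply fill_rows_runs (b := b) ?_ hL (by omega) hW hW' hp (by simp [hi1]) (by simp [hpA])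
            (by simp) (by simp [f1]) (hI1.set _ _ (by simp))
          refine hat1.congr fun e he => ?_
          rw [Store.set_reg_ne _ _ (by rintro rfl; revert he; decide)]
        · intro s2 hf2 hI2
          have k1 : s2.reg .pA = S.inAddr i + 3 + p * (S.s * S.n i) := by
            rw [hf2 _ (by decide)]; simp [hpA]
          have k2 : s2.reg .sn = S.n i * S.s := by rw [hf2 _ (by decide)]; simp [hat1.sn]
          have e : S.n i * S.s = S.s * S.n i := mul_comm _ _
          apply Runs.assign (by simp [k1, k2]; omega)
          refine ⟨?_, (hI2.set _ _ (by simp)).set _ _ (by simp)⟩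
          simp [k1, k2]
          ring
      · simp
        omega
    · exact fun s1 h _ _ => h.2
  · generalize S.n i = n at *
    generalize S.m = m at *
    simp
    have h1 : n * m * 1 ≤ n * m * (n * m) := Nat.mul_le_mul_left _ (by omega)
    have h2 : n * m * m * 1 ≤ n * m * m * n := Nat.mul_le_mul_left _ hn
    have h3 : n * 1 ≤ n * m := Nat.mul_le_mul_left _ hm
    have e1 : n * m * (n * m) * (S.s * 50 + 150) =
        n * m * (n * m) * S.s * 50 + n * m * (n * m) * 150 := by
      ring
    have e2 : n * (m * (m * (n * (S.s * 50 + 83) + 5) + 12) + 20 + 3) =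
      n * m * (n * m) * S.s * 50 + n * m * (n * m) * 83 + n * m * m * 5 + n * m * 12 + n * 23 := by
      ring
    have e3 : n * m * m * n = n * m * (n * m) := by ring
    rw [e1, e2]
    omega
  · rintro s' f ⟨_, h1, h2⟩
    have e : S.n i * S.m * S.m * S.n i = S.n i * S.m * (S.n i * S.m) := by ring
    rw [e] at h1 h2
    refine hQ s' f ⟨fun x hx y hy => ?_, h2⟩
    have := h1 _ (SMCP.pair_lt hx hy)
    rw [← add_assoc] at this
    rw [this, mul_comm x, Nat.mul_add_div hN, Nat.div_eq_of_lt hy, Nat.mul_add_mod,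
      Nat.mod_eq_of_lt hy, add_zero]

/-- Reads the head of the input and finds the first thread. -/
def readHead : Cmd Var :=
  .assign .s (.get (.lit 0)) ;; .assign .m (.get (.lit 1)) ;; .assign .t (.get (.lit 2)) ;;
  .assign .q0 (.get (.lit 3)) ;; .assign .qf (.get (.lit 4)) ;;
  .assign .sm (.lit 0) ;; .addMul .z .sm .m .s ;;
  .assign .thr (.lit 5) ;; .addMul .z .thr .m .sm ;; .assign .base (.lit 0)

/-- Computes the tables of all `B_i` behind the input. The first pass over the threads only finds
the end of the input. -/
def prep : Cmd Var :=
  readHead ;; threads .skip ;; .assign .base (.var .ptr) ;; threads (fill ;; warshall)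

/-- The outcome of `prep`. -/
structure Prepared (S : SMCP) (τ : Store Var) : Prop extends Params S τ where
  base : τ.reg .base = S.inAddr S.t
  bp : τ.reg .bp = S.inAddr S.t + S.outPos S.t
  q0 : τ.reg .q0 = S.M.init
  qf : τ.reg .qf = S.M.final
  loaded : S.Loaded τ.mem
  table : ∀ i, S.TableAt i τ.mem (S.inAddr S.t + S.outPos i)

theorem readHead_runs {S : SMCP} (hL : S.Loaded s.mem) (hW : S.inAddr S.t < W)
    (hQ : ∀ s' : Store Var, s'.mem = s.mem → Params S s' → s'.reg .sm = S.s * S.m →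
      s'.reg .q0 = S.M.init → s'.reg .qf = S.M.final → s'.reg .base = 0 → Q s') :
    Runs W readHead s (S.m * 20 + 60) Q := by
  have hin := SMCP.inAddr_mono (S := S) (Nat.zero_le S.t)
  have hin0 : S.inAddr 0 = 5 + S.m * (S.s * S.m) := by simp [SMCP.inAddr]
  have h1 : S.m * S.s ≤ S.m * (S.s * S.m) :=
    Nat.mul_le_mul_left _ (Nat.le_mul_of_pos_right _ (m_pos S))
  have e : S.m * (S.m * S.s) = S.m * (S.s * S.m) := by ring
  apply Runs.le
  · unfold readHead
    apply Runs.assign_seq (by simp; omega)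
    apply Runs.assign_seq (by simp; omega)
    apply Runs.assign_seq (by simp; omega)
    apply Runs.assign_seq (by simp; omega)
    apply Runs.assign_seq (by simp; omega)
    apply Runs.assign_seq (by simp; omega)
    apply Runs.addMul_seq (by simp) (by simp) (by simp) (by simp) (by simp) 0 S.m S.s (by simp)
      (by simp [hL.m]) (by simp [hL.s]) (by omega)
    intro s1 f1 m1 r1
    apply Runs.assign_seq (by simp; omega)
    apply Runs.addMul_seq (by simp) (by simp) (by simp) (by simp) (by simp) 5 S.m (S.m * S.s)
      (by simp) (by simp [f1, hL.m]) (by simp [r1]) (by omega)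
    intro s2 f2 m2 r2
    apply Runs.assign (by simp; omega)
    apply hQ
    · simp [m2, m1]
    · refine ⟨?_, ?_, ?_, ?_⟩
      · simp [f1, f2, hL.s]
      · simp [f1, f2, hL.m]
      · simp [f1, f2, hL.t]
      · simp [r2, hin0, e]
    · simp [f2, r1, mul_comm]
    · simp [f1, f2, hL.init]
    · simp [f1, f2, hL.final]
    · simp
  · simp
    omega

theorem tableAt_of_mat {S : SMCP} {i : Fin S.t} {mem₀ mem : ℕ → ℕ} {a : ℕ} {R : ℕ → ℕ → Prop}
    (hM : Mat mem₀ mem a (S.n i * S.m) (S.n i * S.m) R) (hP : S.Partial i (S.n i * S.m) R) :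
    S.TableAt i mem a := by
  intro p q q' p'
  rw [hM.cell _ (SMCP.pair_lt p.2 q.2) _ (by
    rw [mul_comm (S.n i)]; exact SMCP.pair_lt q'.2 p'.2)]
  congr 1
  exact propext ((hP.entry_iff (p, q) (p', q')).trans (SMCP.B_trans_iff p p' q q').symm)

theorem tableAt_congr {S : SMCP} {i : Fin S.t} {mem mem' : ℕ → ℕ} {a : ℕ}
    (h : S.TableAt i mem a)
    (h' : ∀ z, a ≤ z → z < a + S.n i * S.m * (S.n i * S.m) → mem' z = mem z) :
    S.TableAt i mem' a := by
  intro p q q' p'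
  have h1 := SMCP.pair_lt p.2 q.2
  have h2 : q' * S.n i + p' < S.n i * S.m := by
    rw [mul_comm (S.n i)]; exact SMCP.pair_lt q'.2 p'.2
  have h3 := SMCP.pair_lt h1 h2
  rw [h' _ (by omega) (by omega), h]

theorem b_pos {S : SMCP} (ht : 0 < S.t) : 0 < S.b :=
  (n_pos S ⟨0, ht⟩).trans_le (n_le_b S ⟨0, ht⟩)

/-- A bound for the addresses that `prep` uses. -/
def space (S : SMCP) : ℕ := 2 * S.inAddr S.t + S.outPos S.t + 2 * (S.m * S.b) + 10

theorem prep_runs {S : SMCP} (ht : 0 < S.t) (hL : S.Loaded s.mem) (hW : space S < W)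
    (hQ : ∀ s' : Store Var, (∀ e ∉ prep.writes, s'.reg e = s.reg e) → Prepared S s' → Q s') :
    Runs W prep s (1000 * S.prepTime) Q := by
  have hm := m_pos S
  have hb := b_pos ht
  obtain ⟨K, hK⟩ : ∃ K, K = S.m * S.b := ⟨_, rfl⟩
  have hmK : S.m ≤ K := hK ▸ Nat.le_mul_of_pos_right _ hb
  have hbK : S.b ≤ K := hK ▸ Nat.le_mul_of_pos_left _ hm
  have hnK (i : Fin S.t) : S.n i * S.m ≤ K := by
    rw [hK, mul_comm]; exact Nat.mul_le_mul_left _ (n_le_b S i)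
  rw [space, ← hK] at hW
  apply Runs.mono (R := Prepared S)
  · unfold prep
    apply Runs.seq (R := fun s' => s'.mem = s.mem ∧ Params S s' ∧ s'.reg .sm = S.s * S.m ∧
      s'.reg .q0 = S.M.init ∧ s'.reg .qf = S.M.final ∧ s'.reg .base = 0)
    · exact readHead_runs hL (by omega) fun s' h1 h2 h3 h4 h5 h6 => ⟨h1, h2, h3, h4, h5, h6⟩
    rintro s1 - ⟨m1, p1, r1, r2, r3, r4⟩
    apply Runs.seq (R := fun s' => s'.mem = s.mem ∧ s'.reg .ptr = S.inAddr S.t)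
    · exact threads_runs (b := 0) (T := 1) (fun _ s' => s'.mem = s.mem)
        (fun _ _ _ h1 h2 _ => h2.trans h1) (fun _ _ h => h ▸ hL) p1 r4 (by simp) (by omega)
        (by omega) m1 (fun _ _ h _ _ => Runs.skip h) fun s' h1 h2 _ => ⟨h1, h2⟩
    rintro s2 f2 ⟨m2, r5⟩
    apply Runs.assign_seq (by simp)
    have hp2 : Params S (s2.set .base (s2.reg .ptr)) := p1.congr fun e he => by
      rw [Store.set_reg_ne _ _ (by rintro rfl; revert he; decide)]
      exact f2 e (by revert he; revert e; decide)
    apply Runs.mono (T := S.t * (K * K * (S.s * 50 + 150) + 20 +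
        (K * (K * (K * 40 + 40) + 60) + 10) + 80 * K) + 10)
        (R := fun s' => (∀ z < S.inAddr S.t, s'.mem z = s.mem z) ∧ (∀ i : Fin S.t,
          S.TableAt i s'.mem (S.inAddr S.t + S.outPos i)) ∧
          s'.reg .bp = S.inAddr S.t + S.outPos S.t)
    · rw [hK]
      refine threads_runs (b := S.inAddr S.t) (fun j s' => (∀ z < S.inAddr S.t, s'.mem z = s.mem z) ∧
        (∀ i : Fin S.t, (i : ℕ) < j → S.TableAt i s'.mem (S.inAddr S.t + S.outPos i)) ∧
        s'.reg .sm = S.s * S.m) ?_ ?_ hp2 (by simp [r5]) (by decide) (by omega) (by omega) ?_ ?_ ?_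
      · rintro j s s' ⟨h1, h2, h3⟩ h4 h5
        rw [h4, h5 _ (by decide)]
        exact ⟨h1, h2, h3⟩
      · rintro j s' ⟨h1, -, -⟩
        exact hL.congr h1
      · refine ⟨fun z _ => by simp [m2], fun i hi => absurd hi (Nat.not_lt_zero _), ?_⟩
        rw [Store.set_reg_ne _ _ (by decide), f2 _ (by decide), r1]
      · rintro i s3 ⟨h1, h2, h3⟩ hat -
        have hout := SMCP.outPos_mono (S := S) (Nat.succ_le_of_lt i.2)
        rw [Nat.succ_eq_add_one, SMCP.outPos_succ, SMCP.nn_fin] at hout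
        have hi := hnK i
        rw [← hK]
        apply Runs.le
        · apply Runs.seq (R := fun s' => Mat s3.mem s'.mem (S.inAddr S.t + S.outPos i)
            (S.n i * S.m) (S.n i * S.m) (S.stepMatrix i))
          · exact fill_runs hat (hL.congr h1) h3 le_rfl (by omega) (by omega) fun s' _ h => h
          · intro s4 f4 hM
            have hat4 : AtThread S (S.inAddr S.t) i s4 :=
              hat.congr fun e he => f4 e (by revert he; revert e; decide)
            apply warshall_runs hat4 hM (by omega)
            intro s5 f5 R hM5 hP5
            refine ⟨fun z hz => ?_, fun j hj => ?_, ?_⟩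
            · rw [hM5.outside z (.inl (by omega)), h1 z hz]
            · rcases Nat.lt_succ_iff_lt_or_eq.1 hj with hj | hj
              · refine tableAt_congr (h2 j hj) fun z hz hz' => hM5.outside z (.inl ?_)
                have hout' := SMCP.outPos_mono (S := S) (Nat.succ_le_of_lt hj)
                rw [Nat.succ_eq_add_one, SMCP.outPos_succ, SMCP.nn_fin] at hout'
                omega
              · obtain rfl : j = i := Fin.ext hj
                exact tableAt_of_mat hM5 hP5
            · rw [f5 _ (by decide), f4 _ (by decide), h3]
        · have g1 : S.n i * S.m * (S.n i * S.m) * (S.s * 50 + 150) ≤ K * K * (S.s * 50 + 150) := by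
            gcongr
          have g2 : S.n i * S.m * (S.n i * S.m * (S.n i * S.m * 40 + 40) + 60) ≤
              K * (K * (K * 40 + 40) + 60) := by
            gcongr
          omega
      · rintro s' ⟨h1, h2, _⟩ _ h3
        exact ⟨h1, fun i => h2 i i.2, h3⟩
    · exact le_rfl
    · rintro s' f ⟨h1, h2, h3⟩
      refine ⟨hp2.congr fun e he => f e (by revert he; revert e; decide), ?_, h3, ?_, ?_,
        hL.congr h1, h2⟩
      · rw [f _ (by decide)]
        simp [r5]
      · rw [f _ (by decide), Store.set_reg_ne _ _ (by decide), f2 _ (by decide), r2]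
      · rw [f _ (by decide), Store.set_reg_ne _ _ (by decide), f2 _ (by decide), r3]
  · have e : S.prepTime = S.t * (K ^ 3 + S.s * K ^ 2) := by
      rw [SMCP.prepTime, hK]; ring
    have hK1 : 1 ≤ K := by omega
    have k1 : K ≤ K ^ 3 := Nat.le_self_pow (by omega) K
    have k2 : K ^ 2 ≤ K ^ 3 := Nat.pow_le_pow_right hK1 (by omega)
    have e1 : K * K * (S.s * 50 + 150) + 20 + (K * (K * (K * 40 + 40) + 60) + 10) + 80 * K =
        50 * (S.s * K ^ 2) + 40 * K ^ 3 + 190 * K ^ 2 + 140 * K + 30 := by ring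
    rw [← hK, e, e1]
    have h1 : S.t * (50 * (S.s * K ^ 2) + 40 * K ^ 3 + 190 * K ^ 2 + 140 * K + 30) ≤
        S.t * (400 * (K ^ 3 + S.s * K ^ 2)) := Nat.mul_le_mul_left _ (by omega)
    have h2 : S.t * (1 + 80 * K) ≤ S.t * (81 * (K ^ 3 + S.s * K ^ 2)) :=
      Nat.mul_le_mul_left _ (by omega)
    have h3 : 1 * K ≤ S.t * (K ^ 3 + S.s * K ^ 2) := Nat.mul_le_mul ht (by omega)
    have e2 : S.t * (400 * (K ^ 3 + S.s * K ^ 2)) = 400 * (S.t * (K ^ 3 + S.s * K ^ 2)) := by ring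
    have e3 : S.t * (81 * (K ^ 3 + S.s * K ^ 2)) = 81 * (S.t * (K ^ 3 + S.s * K ^ 2)) := by ring
    simp
    omega
  · exact fun s' f h => hQ s' f h

/-! ### Testing one interface sequence -/

/-- The table at `tb` says which states the current thread can be in for which set of covered
positions. The row of the set `y`, at `src`, is used to update the row of `y` with the current
position added, which is `dn` cells further. The transitions for the current letter are found at
`row0`, in rows that are `mN` cells apart. -/
def transfer : Cmd Var :=
  .assign .row (.var .row0) ;;
  .for_ .p .n (
    .ite (.lit 0) (.get (.add (.var .src) (.var .p)))
      (.for_ .p2 .n (.ite (.lit 0) (.get (.add (.var .row) (.var .p2)))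
        (.store (.add (.add (.var .src) (.var .dn)) (.var .p2)) (.lit 1)) .skip)) .skip ;;
    .assign .row (.add (.var .row) (.var .mN)))

/-- Processes all sets that do not contain the current position `j`. The bit of weight `pw = 2 ^
j` of the set is read off from `ph`, the remainder modulo `2 ^ (j + 1)`. -/
def updateSets : Cmd Var :=
  .assign .src (.var .tb) ;; .assign .ph (.lit 0) ;;
  .for_ .x .full (
    .ite (.var .ph) (.var .pw) transfer .skip ;;
    .assign .src (.add (.var .src) (.var .n)) ;; .assign .ph (.add (.var .ph) (.lit 1)) ;;
    .ifEq (.var .ph) (.add (.var .pw) (.var .pw)) (.assign .ph (.lit 0)))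

theorem transfer_runs {mem₀ : ℕ → ℕ} {a M n y δ r g : ℕ} {R E : ℕ → ℕ → Prop}
    (hR : Mat mem₀ s.mem a M n R) (hn : s.reg .n = n) (hsrc : s.reg .src = a + y * n)
    (hdn : s.reg .dn = δ * n) (hrow : s.reg .row0 = r) (hmN : s.reg .mN = g)
    (hδ : 0 < δ) (hy : y + δ < M) (hE : ∀ p₀ < n, ∀ p < n, mem₀ (r + p₀ * g + p) = ind (E p₀ p))
    (hra : ∀ p₀ < n, ∀ p < n, r + p₀ * g + p < a) (hW : a + M * n < W) (hWr : r + n * g < W)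
    (hQ : ∀ s' : Store Var, (∀ e ∉ transfer.writes, s'.reg e = s.reg e) →
      Mat mem₀ s'.mem a M n (fun x p => R x p ∨ x = y + δ ∧ ∃ p₀ < n, R y p₀ ∧ E p₀ p) → Q s') :
    Runs W transfer s (n * (n * 30 + 40) + 10) Q := by
  have h0 : 0 < W := by omega
  have hle : (y + δ + 1) * n ≤ M * n := Nat.mul_le_mul_right _ hy
  have e1 : (y + δ + 1) * n = y * n + δ * n + n := by ring
  rw [e1] at hle
  have hyM : y < M := by omega
  apply Runs.mono (R := fun s' => Mat mem₀ s'.mem a M n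
    (fun x p => R x p ∨ x = y + δ ∧ ∃ p₀ < n, R y p₀ ∧ E p₀ p))
  · unfold transfer
    apply Runs.assign_seq (by simp)
    apply Runs.for_ (T := n * 22 + 30) (fun i s' => s'.reg .row = r + i * g ∧
      Mat mem₀ s'.mem a M n fun x p => R x p ∨ x = y + δ ∧ ∃ p₀ < i, R y p₀ ∧ E p₀ p) n
      (by simp [hn]) (by decide) (by decide) (by decide)
    · exact ⟨by simp [hrow], hR.congr fun x _ p _ => by simp⟩
    · rintro i hi s1 ⟨hrow1, hM⟩ hi1 hf
      have f1 : s1.reg .src = a + y * n := by rw [hf _ (by decide)]; simp [hsrc]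
      have f2 : s1.reg .dn = δ * n := by rw [hf _ (by decide)]; simp [hdn]
      have f3 : s1.reg .mN = g := by rw [hf _ (by decide)]; simp [hmN]
      have f4 : s1.reg .n = n := by rw [hf _ (by decide)]; simp [hn]
      have hg : (i + 1) * g ≤ n * g := Nat.mul_le_mul_right _ hi
      rw [Nat.succ_mul] at hg
      have hv : s1.mem (a + y * n + i) = ind (R y i) := by
        rw [hM.cell y hyM i hi]; congr 1; simp [hδ.ne']
      apply Runs.le
      · apply Runs.seq (R := fun s' => Mat mem₀ s'.mem a M n fun x p =>
          R x p ∨ x = y + δ ∧ ∃ p₀ < i + 1, R y p₀ ∧ E p₀ p)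
        · apply Runs.ite (T := n * 22 + 2) (by simp; omega) (by simp [hi1, f1]; omega)
          · intro hpos
            simp only [Expr.eval, hi1, f1, hv, ind_pos] at hpos
            apply Runs.le
            · apply Runs.for_ (T := 19) (fun j s' => Mat mem₀ s'.mem a M n fun x p =>
                R x p ∨ x = y + δ ∧ ∃ p₀, (p₀ < i ∨ p₀ = i ∧ p < j) ∧ R y p₀ ∧ E p₀ p) n f4
                (by decide) (by decide) (by decide)
              · exact hM.congr fun x _ p _ => by simp
              · rintro j hj s2 hM2 hj2 hf2
                have g1 : s2.reg .src = a + y * n := by rw [hf2 _ (by decide), f1]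
                have g2 : s2.reg .row = r + i * g := by rw [hf2 _ (by decide), hrow1]
                have g3 : s2.reg .dn = δ * n := by rw [hf2 _ (by decide), f2]
                have hra' := hra i hi j hj
                have hv2 : s2.mem (r + i * g + j) = ind (E i j) := by
                  rw [hM2.outside _ (.inl hra'), hE i hi j hj]
                apply Runs.le
                · apply Runs.ite (T := 10) (by simp; omega) (by simp [g2, hj2]; omega)
                  · intro hp
                    simp only [Expr.eval, g2, hj2, hv2, ind_pos] at hp
                    apply Runs.le
                    · apply Runs.store (by simp [g1, g3, hj2]; omega) (by simp; omega)
                      have e : a + y * n + δ * n + j = a + (y + δ) * n + j := by ring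
                      simp only [Expr.eval, g1, g3, hj2, Store.set_mem, e]
                      refine hM2.put_one hy hj fun x _ p _ => ?_
                      constructor
                      · rintro (h | ⟨h, p₀, h1 | ⟨rfl, h1⟩, h2⟩)
                        · exact .inl (.inl h)
                        · exact .inl (.inr ⟨h, p₀, .inl h1, h2⟩)
                        · rcases Nat.lt_succ_iff_lt_or_eq.1 h1 with h1 | h1
                          · exact .inl (.inr ⟨h, p₀, .inr ⟨rfl, h1⟩, h2⟩)
                          · exact .inr ⟨h, h1⟩
                      · rintro ((h | ⟨h, p₀, h1 | ⟨rfl, h1⟩, h2⟩) | ⟨rfl, rfl⟩)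
                        · exact .inl h
                        · exact .inr ⟨h, p₀, .inl h1, h2⟩
                        · exact .inr ⟨h, p₀, .inr ⟨rfl, by omega⟩, h2⟩
                        · exact .inr ⟨rfl, i, .inr ⟨rfl, by omega⟩, hpos, hp⟩
                    · simp
                  · intro hp
                    simp only [Expr.eval, g2, hj2, hv2, ind_pos] at hp
                    apply Runs.le (Runs.skip _) (by simp)
                    simp only [Store.set_mem]
                    refine hM2.congr fun x _ p _ => ?_
                    constructor
                    · rintro (h | ⟨h, p₀, h1 | ⟨h1', h1⟩, h2⟩)
                      · exact .inl h
                      · exact .inr ⟨h, p₀, .inl h1, h2⟩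
                      · exact .inr ⟨h, p₀, .inr ⟨h1', by omega⟩, h2⟩
                    · rintro (h | ⟨h, p₀, h1 | ⟨h1', h1⟩, h2⟩)
                      · exact .inl h
                      · exact .inr ⟨h, p₀, .inl h1, h2⟩
                      · refine .inr ⟨h, p₀, .inr ⟨h1', ?_⟩, h2⟩
                        rcases Nat.lt_succ_iff_lt_or_eq.1 h1 with h3 | h3
                        · exact h3
                        · subst h1' h3
                          exact absurd h2.2 hp
                · simp
              · intro s2 hM2 _ _
                refine hM2.congr fun x _ p hp => ?_
                simp only [hp, and_true, Nat.lt_succ_iff_lt_or_eq]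
            · omega
          · intro hpos
            simp only [Expr.eval, hi1, f1, hv, ind_pos] at hpos
            apply Runs.le (Runs.skip _) (by omega)
            refine hM.congr fun x _ p _ => ?_
            constructor
            · rintro (h | ⟨h, p₀, h1, h2⟩)
              · exact .inl h
              · exact .inr ⟨h, p₀, by omega, h2⟩
            · rintro (h | ⟨h, p₀, h1, h2⟩)
              · exact .inl h
              · refine .inr ⟨h, p₀, ?_, h2⟩
                rcases Nat.lt_succ_iff_lt_or_eq.1 h1 with h3 | h3
                · exact h3
                · subst h3
                  exact absurd h2.1 hpos
        · intro s2 hf2 hM2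
          have g1 : s2.reg .row = r + i * g := by rw [hf2 _ (by decide), hrow1]
          have g2 : s2.reg .mN = g := by rw [hf2 _ (by decide), f3]
          apply Runs.assign (by simp [g1, g2]; omega)
          refine ⟨?_, hM2⟩
          simp [g1, g2]
          ring
      · simp
        omega
    · rintro s1 ⟨_, hM⟩ _ _
      exact hM
  · simp
    have : n * (n * 22 + 30 + 3) ≤ n * (n * 30 + 40) := Nat.mul_le_mul_left _ (by omega)
    omega
  · exact fun s' f h => hQ s' f h

theorem succ_mod_eq {x M : ℕ} (hM : 0 < M) :
    (x + 1) % M = if x % M + 1 = M then 0 else x % M + 1 := by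
  have h := Nat.mod_lt x hM
  have h1 := Nat.div_add_mod x M
  split_ifs with h2
  · rw [← h1, add_assoc, h2, Nat.mul_add_mod, Nat.mod_self]
  · rw [← h1, add_assoc, Nat.mul_add_mod, Nat.mul_add_mod, Nat.mod_mod, Nat.mod_eq_of_lt]
    omega

theorem updateSets_runs {mem₀ : ℕ → ℕ} {a k j n r g : ℕ} {R E : ℕ → ℕ → Prop}
    (hR : Mat mem₀ s.mem a (2 ^ k) n R) (hj : j < k) (hn : s.reg .n = n) (htb : s.reg .tb = a)
    (hfull : s.reg .full = 2 ^ k) (hpw : s.reg .pw = 2 ^ j)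
    (hdn : s.reg .dn = 2 ^ j * n) (hrow : s.reg .row0 = r) (hmN : s.reg .mN = g)
    (hE : ∀ p₀ < n, ∀ p < n, mem₀ (r + p₀ * g + p) = ind (E p₀ p))
    (hra : ∀ p₀ < n, ∀ p < n, r + p₀ * g + p < a) (hW : a + 2 ^ k * n < W) (hWr : r + n * g < W)
    (hWk : 2 ^ k < W)
    (hQ : ∀ s' : Store Var, (∀ e ∉ updateSets.writes, s'.reg e = s.reg e) →
      Mat mem₀ s'.mem a (2 ^ k) n (fun x p => R x p ∨
        ∃ y p₀, SMCP.Low j y ∧ x = y + 2 ^ j ∧ p₀ < n ∧ R y p₀ ∧ E p₀ p) → Q s') :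
    Runs W updateSets s (2 ^ k * (n * (n * 30 + 40) + 60) + 10) Q := by
  have hjk : 2 ^ (j + 1) ≤ 2 ^ k := Nat.pow_le_pow_right (by omega) hj
  have h2j : 2 ^ (j + 1) = 2 ^ j + 2 ^ j := by rw [pow_succ]; ring
  have hpos : 0 < 2 ^ j := by positivity
  apply Runs.mono (R := fun s' => Mat mem₀ s'.mem a (2 ^ k) n (fun x p => R x p ∨
        ∃ y p₀, SMCP.Low j y ∧ x = y + 2 ^ j ∧ p₀ < n ∧ R y p₀ ∧ E p₀ p))
  · unfold updateSets
    apply Runs.assign_seq (by simp)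
    apply Runs.assign_seq (by simp; omega)
    apply Runs.for_ (T := n * (n * 30 + 40) + 55) (fun i s' => s'.reg .src = a + i * n ∧
      s'.reg .ph = i % 2 ^ (j + 1) ∧ Mat mem₀ s'.mem a (2 ^ k) n fun x p => R x p ∨
        ∃ y p₀, y < i ∧ SMCP.Low j y ∧ x = y + 2 ^ j ∧ p₀ < n ∧ R y p₀ ∧ E p₀ p) (2 ^ k)
      (by simp [hfull]) (by decide) (by decide) (by decide)
    · exact ⟨by simp [htb], by simp, hR.congr fun x _ p _ => by simp⟩
    · rintro i hi s1 ⟨hsrc, hph, hM⟩ hi1 hf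
      have hf' (e : Var) (he : e ∉ updateSets.writes) : s1.reg e = s.reg e := by
        have h1 : e ≠ .src := by rintro rfl; revert he; decide
        have h2 : e ≠ .ph := by rintro rfl; revert he; decide
        rw [hf e, Store.set_reg_ne _ _ h2, Store.set_reg_ne _ _ h1]
        exact fun h => he (List.mem_cons_of_mem _ (List.mem_cons_of_mem _ h))
      have f1 : s1.reg .n = n := by rw [hf' _ (by decide), hn]
      have f2 : s1.reg .pw = 2 ^ j := by rw [hf' _ (by decide), hpw]
      have f3 : s1.reg .dn = 2 ^ j * n := by rw [hf' _ (by decide), hdn]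
      have f4 : s1.reg .row0 = r := by rw [hf' _ (by decide), hrow]
      have f5 : s1.reg .mN = g := by rw [hf' _ (by decide), hmN]
      have hle : (i + 1) * n ≤ 2 ^ k * n := Nat.mul_le_mul_right _ hi
      rw [Nat.succ_mul] at hle
      have hmod : i % 2 ^ (j + 1) < 2 ^ (j + 1) := Nat.mod_lt _ (by positivity)
      apply Runs.le
      · apply Runs.seq (R := fun s' => Mat mem₀ s'.mem a (2 ^ k) n fun x p => R x p ∨
          ∃ y p₀, y < i + 1 ∧ SMCP.Low j y ∧ x = y + 2 ^ j ∧ p₀ < n ∧ R y p₀ ∧ E p₀ p)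
        · apply Runs.ite (T := n * (n * 30 + 40) + 10) (by simp) (by simp)
          · intro hlow
            simp only [Expr.eval, hph, f2] at hlow
            have hlow' : SMCP.Low j i := hlow
            apply transfer_runs hM f1 hsrc f3 f4 f5 hpos (hlow'.add_lt hj hi) hE hra hW hWr
            intro s2 _ hM2
            -- Rows that have been changed belong to sets that contain `j`, so the row that is read
            -- has not been changed.
            have hold (p₀ : ℕ) : (R i p₀ ∨ ∃ y p₁, y < i ∧ SMCP.Low j y ∧ i = y + 2 ^ j ∧ p₁ < n ∧
                R y p₁ ∧ E p₁ p₀) ↔ R i p₀ := by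
              refine or_iff_left ?_
              rintro ⟨y, p₁, -, hy, rfl, -⟩
              have := hy.testBit_add j
              rw [SMCP.low_iff.1 hlow'] at this
              simp at this
            refine hM2.congr fun x _ p _ => ?_
            simp only [hold]
            constructor
            · rintro ((h | ⟨y, p₀, h1, h2⟩) | ⟨rfl, p₀, h1, h2, h3⟩)
              · exact .inl h
              · exact .inr ⟨y, p₀, by omega, h2⟩
              · exact .inr ⟨i, p₀, by omega, hlow', rfl, h1, h2, h3⟩
            · rintro (h | ⟨y, p₀, h1, h2, h3, h4, h5⟩)
              · exact .inl (.inl h)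
              · rcases Nat.lt_succ_iff_lt_or_eq.1 h1 with h1 | rfl
                · exact .inl (.inr ⟨y, p₀, h1, h2, h3, h4, h5⟩)
                · exact .inr ⟨h3, p₀, h4, h5⟩
          · intro hlow
            simp only [Expr.eval, hph, f2] at hlow
            apply Runs.le (Runs.skip _) (by omega)
            refine hM.congr fun x _ p _ => ?_
            refine or_congr_right ⟨?_, ?_⟩
            · rintro ⟨y, p₀, h1, h2⟩
              exact ⟨y, p₀, by omega, h2⟩
            · rintro ⟨y, p₀, h1, h2, h3⟩
              rcases Nat.lt_succ_iff_lt_or_eq.1 h1 with h1 | rfl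
              · exact ⟨y, p₀, h1, h2, h3⟩
              · exact absurd h2 hlow
        · intro s2 hf2 hM2
          have g1 : s2.reg .src = a + i * n := by rw [hf2 _ (by decide), hsrc]
          have g2 : s2.reg .n = n := by rw [hf2 _ (by decide), f1]
          have g3 : s2.reg .ph = i % 2 ^ (j + 1) := by rw [hf2 _ (by decide), hph]
          have g4 : s2.reg .pw = 2 ^ j := by rw [hf2 _ (by decide), f2]
          apply Runs.assign_seq (by simp [g1, g2]; omega)
          apply Runs.assign_seq (by simp [g3]; omega)
          have hs := succ_mod_eq (x := i) (M := 2 ^ (j + 1)) (by positivity)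
          apply Runs.ifEq (T := 3) (by omega) (by simp) (by simp [g4]; omega)
          · intro h1
            simp [g3, g4, ← h2j] at h1
            rw [if_pos h1] at hs
            apply Runs.assign (by simp; omega)
            refine ⟨?_, by simp [hs], hM2⟩
            simp [g1, g2]
            ring
          · intro h1
            simp [g3, g4, ← h2j] at h1
            rw [if_neg h1] at hs
            refine ⟨?_, by simp [hs, g3], hM2⟩
            simp [g1, g2]
            ring
      · simp
        omega
    · rintro s1 ⟨_, _, hM⟩ _ _
      refine hM.congr fun x hx p _ => or_congr_right ⟨?_, ?_⟩
      · rintro ⟨y, p₀, h1, h2⟩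
        exact ⟨y, p₀, h2⟩
      · rintro ⟨y, p₀, h1, rfl, h2⟩
        exact ⟨y, p₀, by omega, h1, rfl, h2⟩
  · simp
    have : 2 ^ k * (n * (n * 30 + 40) + 55 + 3) ≤ 2 ^ k * (n * (n * 30 + 40) + 60) :=
      Nat.mul_le_mul_left _ (by omega)
    omega
  · exact fun s' f h => hQ s' f h

/-- Fills `y` memory cells with zeros, from the address in `b` on; `i` is the loop variable. -/
def Cmd.clear {V : Type} (i y b : V) : Cmd V :=
  .for_ i y (.store (.add (.var b) (.var i)) (.lit 0))

theorem clear_runs {i y b : Var} {n a : ℕ} (hy : y ≠ i) (hb : b ≠ i) (hn : s.reg y = n)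
    (ha : s.reg b = a) (hW : a + n < W)
    (hQ : ∀ s' : Store Var, (∀ e, e ≠ i → s'.reg e = s.reg e) →
      (∀ z, s'.mem z = if a ≤ z ∧ z < a + n then 0 else s.mem z) → Q s') :
    Runs W (.clear i y b) s (n * 10 + 2) Q := by
  refine Runs.for_ (T := 7) (fun j s' => ∀ z, s'.mem z = if a ≤ z ∧ z < a + j then 0 else s.mem z) n
    hn (by simp) (by simp) hy ?_ ?_ ?_
  · intro z
    rw [if_neg (by omega)]
    rfl
  · rintro j hj s' hI hi hf
    have h1 : s'.reg b = a := by rw [hf b (by simpa using hb), ha]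
    refine Runs.store (by simp [h1, hi]; omega) (by simp; omega) fun z => ?_
    simp only [Store.set_mem, Store.put_mem, Expr.eval, h1, hi, hI z]
    split_ifs <;> first | rfl | omega
  · rintro s' hI - hf
    exact hQ s' (fun e he => hf e (by simpa using he)) hI

/-- The address of the table that says which sets of positions can be covered by the threads so
far. It follows the tables of the `B_i` and the `k + 1` memory states. -/
def coverAddr (S : SMCP) (k : ℕ) : ℕ := S.inAddr S.t + S.outPos S.t + k + 1

/-- A bound for the addresses and numbers used in the test of one interface sequence. -/
def arena (S : SMCP) (k : ℕ) : ℕ :=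
  coverAddr S k + 2 ^ k + 2 ^ k * S.b + 2 * (S.m * S.b * (S.m * S.b)) + 10

/-- Everything is in place for testing the interface sequence of length `k` that is given by the
memory states `d 0, …, d k`. -/
structure Ready (S : SMCP) (k : ℕ) (d : ℕ → Fin S.m) (τ : Store Var) : Prop extends
    Params S τ where
  base : τ.reg .base = S.inAddr S.t
  len : τ.reg .k = k
  full : τ.reg .full = 2 ^ k
  dig : τ.reg .dig = S.inAddr S.t + S.outPos S.t
  dp : τ.reg .dp = coverAddr S k
  tb : τ.reg .tb = coverAddr S k + 2 ^ k
  loaded : S.Loaded τ.mem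
  table : ∀ i, S.TableAt i τ.mem (S.inAddr S.t + S.outPos i)
  digits : ∀ j ≤ k, τ.mem (S.inAddr S.t + S.outPos S.t + j) = d j

theorem Ready.congr_digits {S : SMCP} {k : ℕ} {d d' : ℕ → Fin S.m} {s s' : Store Var}
    (h : Ready S k d s)
    (hr : ∀ e ∈ [Var.s, .m, .t, .thr, .base, .k, .full, .dig, .dp, .tb], s'.reg e = s.reg e)
    (hm : ∀ z < S.inAddr S.t + S.outPos S.t, s'.mem z = s.mem z)
    (hd : ∀ j ≤ k, s'.mem (S.inAddr S.t + S.outPos S.t + j) = d' j) : Ready S k d' s' := by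
  refine ⟨h.toParams.congr fun e he => hr e (by revert he; revert e; decide),
    by rw [hr _ (by decide), h.base], by rw [hr _ (by decide), h.len],
    by rw [hr _ (by decide), h.full], by rw [hr _ (by decide), h.dig],
    by rw [hr _ (by decide), h.dp], by rw [hr _ (by decide), h.tb],
    h.loaded.congr fun z hz => hm z (by omega), fun i => ?_, hd⟩
  have hout := SMCP.outPos_mono (S := S) (Nat.succ_le_of_lt i.2)
  rw [Nat.succ_eq_add_one, SMCP.outPos_succ, SMCP.nn_fin] at hout
  exact tableAt_congr (h.table i) fun z _ hz => hm z (by omega)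

theorem Ready.congr {S : SMCP} {k : ℕ} {d : ℕ → Fin S.m} {s s' : Store Var} (h : Ready S k d s)
    (hr : ∀ e ∈ [Var.s, .m, .t, .thr, .base, .k, .full, .dig, .dp, .tb], s'.reg e = s.reg e)
    (hm : ∀ z < coverAddr S k, s'.mem z = s.mem z) : Ready S k d s' := by
  have hc : coverAddr S k = S.inAddr S.t + S.outPos S.t + k + 1 := rfl
  exact h.congr_digits hr (fun z hz => hm z (by omega)) fun j hj => by
    rw [hm _ (by omega), h.digits j hj]

/-- Finds the transitions for the letter at position `j`, and makes use of them. -/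
def position : Cmd Var :=
  .assign .q (.get (.add (.var .dig) (.var .j))) ;;
  .assign .q2 (.get (.add (.add (.var .dig) (.var .j)) (.lit 1))) ;;
  .assign .row0 (.var .bp) ;; .addMul .z .row0 .q .N ;; .addMul .z .row0 .q2 .n ;; updateSets

/-- Scans the sequence once, for all sets at the same time. -/
def positions : Cmd Var :=
  .assign .pw (.lit 1) ;; .assign .dn (.var .n) ;;
  .for_ .j .k (position ;; .assign .pw (.add (.var .pw) (.var .pw)) ;;
    .assign .dn (.add (.var .dn) (.var .dn)))

/-- The set table of thread `i` after `j` positions; its columns are the states. -/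
def SMCP.reachTable (S : SMCP) (i : Fin S.t) (d : ℕ → Fin S.m) (D : ℕ → Prop) (j x p : ℕ) : Prop :=
  ∃ h : p < S.n i, reach (S.B i) d D j x ⟨p, h⟩

theorem position_runs {S : SMCP} {k j b : ℕ} {i : Fin S.t} {d : ℕ → Fin S.m} {D : ℕ → Prop}
    {mem₀ : ℕ → ℕ} (h : Ready S k d ⟨s.reg, mem₀⟩) (hat : AtThread S b i s) (hb : b = S.inAddr S.t)
    (hR : Mat mem₀ s.mem (coverAddr S k + 2 ^ k) (2 ^ k) (S.n i) (S.reachTable i d D j))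
    (hj : j < k) (hjr : s.reg .j = j) (hpw : s.reg .pw = 2 ^ j) (hdn : s.reg .dn = 2 ^ j * S.n i)
    (hmN : s.reg .mN = S.m * (S.n i * S.m)) (hW : arena S k < W)
    (hQ : ∀ s' : Store Var, (∀ e ∉ position.writes, s'.reg e = s.reg e) →
      Mat mem₀ s'.mem (coverAddr S k + 2 ^ k) (2 ^ k) (S.n i) (S.reachTable i d D (j + 1)) → Q s') :
    Runs W position s (2 ^ k * (S.n i * (S.n i * 30 + 40) + 60) + S.m * 20 + 50) Q := by
  subst hb
  have hc : coverAddr S k = S.inAddr S.t + S.outPos S.t + k + 1 := rfl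
  have hout := SMCP.outPos_mono (S := S) (Nat.succ_le_of_lt i.2)
  rw [Nat.succ_eq_add_one, SMCP.outPos_succ, SMCP.nn_fin] at hout
  have hnK : S.n i * S.m ≤ S.m * S.b := by rw [mul_comm]; exact Nat.mul_le_mul_left _ (n_le_b S i)
  have hNN : S.n i * S.m * (S.n i * S.m) ≤ S.m * S.b * (S.m * S.b) := Nat.mul_le_mul hnK hnK
  have h2k : 0 < 2 ^ k := by positivity
  have hb' : 2 ^ k * S.n i ≤ 2 ^ k * S.b := Nat.mul_le_mul_left _ (n_le_b S i)
  have hn0 := n_pos S i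
  have hm0 := m_pos S
  have hdig : s.reg .dig = S.inAddr S.t + S.outPos S.t := h.dig
  have hv (l : ℕ) (hl : l ≤ k) : s.mem (S.inAddr S.t + S.outPos S.t + l) = d l := by
    rw [hR.outside _ (.inl (by omega))]
    exact h.digits l hl
  have hq := (d j).2
  have hq2 := (d (j + 1)).2
  have e1 : ((d j : ℕ) + 1) * (S.n i * S.m) ≤ S.m * (S.n i * S.m) := Nat.mul_le_mul_right _ hq
  have e2 : ((d (j + 1) : ℕ) + 1) * S.n i ≤ S.m * S.n i := Nat.mul_le_mul_right _ hq2
  have e3 : S.m * (S.n i * S.m) ≤ S.n i * S.m * (S.n i * S.m) :=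
    Nat.mul_le_mul_right _ (Nat.le_mul_of_pos_left _ hn0)
  have e4 : S.m * S.n i = S.n i * S.m := mul_comm _ _
  have e5 : S.n i * (S.m * (S.n i * S.m)) = S.n i * S.m * (S.n i * S.m) := by ring
  rw [Nat.succ_mul] at e1 e2
  rw [arena] at hW
  have hT (p₀ p : ℕ) (h₀ : p₀ < S.n i) (hp : p < S.n i) :
      S.inAddr S.t + S.outPos i + (p₀ * S.m + d j) * (S.n i * S.m) + ((d (j + 1) : ℕ) * S.n i + p) =
      S.inAddr S.t + S.outPos i + d j * (S.n i * S.m) + d (j + 1) * S.n i +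
        p₀ * (S.m * (S.n i * S.m)) + p := by ring
  apply Runs.le
  · unfold position
    apply Runs.assign_seq (by simp [hdig, hjr]; omega)
    apply Runs.assign_seq (by simp [hdig, hjr]; omega)
    apply Runs.assign_seq (by simp)
    apply Runs.addMul_seq (by simp) (by simp) (by simp) (by simp) (by simp)
      (S.inAddr S.t + S.outPos i) (d j) (S.n i * S.m) (by simp [hat.bp])
      (by simp [hdig, hjr, hv j hj.le]) (by simp [hat.N]) (by omega)
    intro s1 f1 m1 r1
    apply Runs.addMul_seq (by simp) (by simp) (by simp) (by simp) (by simp)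
      (S.inAddr S.t + S.outPos i + d j * (S.n i * S.m)) (d (j + 1)) (S.n i) (by simp [r1])
      (by simp [f1, hdig, hjr, add_assoc, ← hv (j + 1) hj]) (by simp [f1, hat.n]) (by omega)
    intro s2 f2 m2 r2
    apply updateSets_runs (mem₀ := mem₀) (k := k) (j := j) (n := S.n i) (g := S.m * (S.n i * S.m))
      (E := fun p₀ p => ∃ (h₀ : p₀ < S.n i) (hp : p < S.n i),
        (S.B i).trans ⟨p₀, h₀⟩ (d j, d (j + 1)) ⟨p, hp⟩)
      (by rw [m2, m1]; exact hR) hj (by simp [f1, f2, hat.n])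
      (by simp [f1, f2]; exact h.tb) (by simp [f1, f2]; exact h.full) (by simp [f1, f2, hpw])
      (by simp [f1, f2, hdn]) r2 (by simp [f1, f2, hmN]) ?_ ?_ (by omega) (by omega)
      (by omega)
    · intro s3 f3 hM
      refine hQ s3 (fun e he => ?_) (hM.congr fun x _ p hp => ?_)
      · have h1 : e ≠ .q := by rintro rfl; revert he; decide
        have h2 : e ≠ .q2 := by rintro rfl; revert he; decide
        have h3 : e ≠ .row0 := by rintro rfl; revert he; decide
        have h4 : e ≠ .z := by rintro rfl; revert he; decide
        have h5 : e ∉ updateSets.writes := fun h => he (by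
          simp only [position, Cmd.writes, List.mem_append]; tauto)
        rw [f3 e h5, f2 e h4 h3, f1 e h4 h3]
        simp [h1, h2, h3]
      · constructor
        · rintro (⟨_, h⟩ | ⟨y, p₀, h1, h2, h3, ⟨_, h4⟩, _, _, h5⟩)
          · exact ⟨hp, .inl h⟩
          · exact ⟨hp, .inr ⟨y, _, h1, h2, h4, h5⟩⟩
        · rintro ⟨_, h | ⟨y, p₀, h1, h2, h4, h5⟩⟩
          · exact .inl ⟨hp, h⟩
          · exact .inr ⟨y, p₀, h1, h2, p₀.2, ⟨p₀.2, h4⟩, p₀.2, hp, h5⟩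
    · intro p₀ h₀ p hp
      rw [← hT p₀ p h₀ hp]
      refine (h.table i ⟨p₀, h₀⟩ (d j) (d (j + 1)) ⟨p, hp⟩).trans ?_
      simp [h₀, hp]
    · intro p₀ h₀ p hp
      rw [← hT p₀ p h₀ hp]
      have h1 := SMCP.pair_lt h₀ hq
      have h2 := SMCP.pair_lt hq2 hp
      rw [e4] at h2
      have h3 := SMCP.pair_lt h1 h2
      omega
  · simp
    omega

theorem positions_runs {S : SMCP} {k b : ℕ} {i : Fin S.t} {d : ℕ → Fin S.m} {D : ℕ → Prop}
    {mem₀ : ℕ → ℕ} (h : Ready S k d ⟨s.reg, mem₀⟩) (hat : AtThread S b i s) (hb : b = S.inAddr S.t)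
    (hR : Mat mem₀ s.mem (coverAddr S k + 2 ^ k) (2 ^ k) (S.n i) (S.reachTable i d D 0))
    (hmN : s.reg .mN = S.m * (S.n i * S.m)) (hW : arena S k < W)
    (hQ : ∀ s' : Store Var, (∀ e ∉ positions.writes, s'.reg e = s.reg e) →
      Mat mem₀ s'.mem (coverAddr S k + 2 ^ k) (2 ^ k) (S.n i) (S.reachTable i d D k) → Q s') :
    Runs W positions s (k * (2 ^ k * (S.n i * (S.n i * 30 + 40) + 60) + S.m * 20 + 70) + 10) Q := by
  have h2k : 0 < 2 ^ k := by positivity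
  have hb' : 2 ^ k * S.n i ≤ 2 ^ k * S.b := Nat.mul_le_mul_left _ (n_le_b S i)
  apply Runs.mono (R := fun s' =>
    Mat mem₀ s'.mem (coverAddr S k + 2 ^ k) (2 ^ k) (S.n i) (S.reachTable i d D k))
  · rw [arena] at hW
    unfold positions
    apply Runs.assign_seq (by simp; omega)
    apply Runs.assign_seq (by simp)
    apply Runs.for_ (T := 2 ^ k * (S.n i * (S.n i * 30 + 40) + 60) + S.m * 20 + 50 + 14)
      (fun j s' => s'.reg .pw = 2 ^ j ∧ s'.reg .dn = 2 ^ j * S.n i ∧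
      Mat mem₀ s'.mem (coverAddr S k + 2 ^ k) (2 ^ k) (S.n i) (S.reachTable i d D j)) k
      (by simp; exact h.len) (by decide) (by decide) (by decide)
    · exact ⟨by simp, by simp [hat.n], hR⟩
    · rintro j hj s1 ⟨hpw, hdn, hM⟩ hj1 hf
      have hf' (e : Var) (he : e ∉ positions.writes) : s1.reg e = s.reg e := by
        have h1 : e ≠ .pw := by rintro rfl; revert he; decide
        have h2 : e ≠ .dn := by rintro rfl; revert he; decide
        rw [hf e, Store.set_reg_ne _ _ h2, Store.set_reg_ne _ _ h1]
        exact fun h => he (List.mem_cons_of_mem _ (List.mem_cons_of_mem _ h))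
      have h2j : 2 ^ (j + 1) ≤ 2 ^ k := Nat.pow_le_pow_right (by omega) hj
      have h3j : 2 ^ (j + 1) * S.n i ≤ 2 ^ k * S.n i := Nat.mul_le_mul_right _ h2j
      rw [pow_succ] at h2j
      rw [pow_succ, mul_right_comm] at h3j
      apply Runs.le
      · apply Runs.seq (R := fun s' => Mat mem₀ s'.mem (coverAddr S k + 2 ^ k) (2 ^ k) (S.n i)
          (S.reachTable i d D (j + 1)))
        · refine position_runs (mem₀ := mem₀)
            (h.congr (fun e he => hf' e (by revert he; revert e; decide))
            fun z _ => rfl) (hat.congr fun e he => hf' e (by revert he; revert e; decide)) hb hM hj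
            hj1 hpw hdn (by rw [hf' _ (by decide), hmN]) ?_ fun s' _ h => h
          rwa [arena]
        · intro s2 f2 hM2
          have g1 : s2.reg .pw = 2 ^ j := by rw [f2 _ (by decide), hpw]
          have g2 : s2.reg .dn = 2 ^ j * S.n i := by rw [f2 _ (by decide), hdn]
          apply Runs.assign_seq (by simp [g1]; omega)
          apply Runs.assign (by simp [g2]; omega)
          refine ⟨by simp [g1]; ring, by simp [g2]; ring, hM2⟩
      · simp
    · rintro s1 ⟨_, _, hM⟩ _ _
      exact hM
  · simp
    have : k * (2 ^ k * (S.n i * (S.n i * 30 + 40) + 60) + S.m * 20 + 50 + 14 + 3) ≤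
      k * (2 ^ k * (S.n i * (S.n i * 30 + 40) + 60) + S.m * 20 + 70) :=
      Nat.mul_le_mul_left _ (by omega)
    omega
  · exact fun s' f h => hQ s' f h

/-- The set table before the first position: every set that is covered so far, in the initial
state. -/
def initTable : Cmd Var :=
  .assign .w (.var .tb) ;;
  .for_ .x .full (.clear .p .n .w ;;
    .store (.add (.var .w) (.var .ini)) (.get (.add (.var .dp) (.var .x))) ;;
    .assign .w (.add (.var .w) (.var .n)))

theorem initTable_runs {a c M n ini : ℕ} {D : ℕ → Prop} (htb : s.reg .tb = a)
    (hfull : s.reg .full = M) (hn : s.reg .n = n) (hini : s.reg .ini = ini) (hdp : s.reg .dp = c)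
    (hi : ini < n) (hc : c + M ≤ a) (hD : ∀ x < M, s.mem (c + x) = ind (D x))
    (hW : a + M * n < W)
    (hQ : ∀ s' : Store Var, (∀ e ∉ initTable.writes, s'.reg e = s.reg e) →
      Mat s.mem s'.mem a M n (fun x p => D x ∧ p = ini) → Q s') :
    Runs W initTable s (M * (n * 10 + 30) + 10) Q := by
  apply Runs.mono (R := fun s' => Mat s.mem s'.mem a M n (fun x p => D x ∧ p = ini))
  · unfold initTable
    apply Runs.assign_seq (by simp)
    apply Runs.for_ (T := n * 10 + 25) (fun j s' => s'.reg .w = a + j * n ∧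
      Mat s.mem s'.mem a j n (fun x p => D x ∧ p = ini)) M
      (by simp [hfull]) (by decide) (by decide) (by decide)
    · exact ⟨by simp [htb], fun x hx => absurd hx (Nat.not_lt_zero _), fun _ _ => rfl⟩
    · rintro j hj s1 ⟨hw, hM⟩ hj1 hf
      have f1 : s1.reg .n = n := by rw [hf _ (by decide)]; simp [hn]
      have f2 : s1.reg .ini = ini := by rw [hf _ (by decide)]; simp [hini]
      have f3 : s1.reg .dp = c := by rw [hf _ (by decide)]; simp [hdp]
      have hle : (j + 1) * n ≤ M * n := Nat.mul_le_mul_right _ hj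
      rw [Nat.succ_mul] at hle
      apply Runs.le
      · apply Runs.seq (R := fun s' => ∀ z, s'.mem z =
          if a + j * n ≤ z ∧ z < a + j * n + n then 0 else s1.mem z)
        · exact clear_runs (by simp) (by simp) f1 hw (by omega) fun s' _ h => h
        · intro s2 f hm
          have g1 : s2.reg .w = a + j * n := by rw [f _ (by decide), hw]
          have g2 : s2.reg .ini = ini := by rw [f _ (by decide), f2]
          have g3 : s2.reg .dp = c := by rw [f _ (by decide), f3]
          have g4 : s2.reg .x = j := by rw [f _ (by decide), hj1]
          have g5 : s2.reg .n = n := by rw [f _ (by decide), f1]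
          have hv : s2.mem (c + j) = ind (D j) := by
            rw [hm, if_neg (by omega), hM.outside _ (.inl (by omega)), hD j hj]
          apply Runs.store_seq (by simp [g1, g2]; omega) (by simp [g3, g4]; omega)
          apply Runs.assign (by simp [g1, g5]; omega)
          refine ⟨by simp [g1, g5]; ring, fun x hx p hp => ?_, fun z hz => ?_⟩
          · simp only [Store.set_mem, Store.put_mem, Expr.eval, g1, g2, g3, g4, hv, hm]
            rcases Nat.lt_succ_iff_lt_or_eq.1 hx with hx | rfl
            · have h1 : (x + 1) * n ≤ j * n := Nat.mul_le_mul_right _ hx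
              rw [Nat.succ_mul] at h1
              rw [if_neg (by omega), if_neg (by omega), hM.cell x hx p hp]
            · split_ifs with h1 h2
              · have : p = ini := by omega
                simp [this]
              · have : p ≠ ini := by omega
                simp [this, ind]
              · omega
          · rw [Nat.succ_mul] at hz
            simp only [Store.set_mem, Store.put_mem, Expr.eval, g1, g2, g3, g4, hm]
            rw [if_neg (by omega), if_neg (by omega), hM.outside z (by omega)]
      · simp
    · rintro s1 ⟨_, hM⟩ _ _
      exact hM
  · simp
    have : M * (n * 10 + 25 + 3) ≤ M * (n * 10 + 30) := Nat.mul_le_mul_left _ (by omega)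
    omega
  · exact fun s' f h => hQ s' f h

/-- A set that the thread has brought to its final state is covered from now on. -/
def collect : Cmd Var :=
  .assign .w (.add (.var .tb) (.var .fin)) ;;
  .for_ .x .full (
    .ite (.lit 0) (.get (.var .w)) (.store (.add (.var .dp) (.var .x)) (.lit 1)) .skip ;;
    .assign .w (.add (.var .w) (.var .n)))

theorem collect_runs {mem₀ : ℕ → ℕ} {a c M n fin : ℕ} {D : ℕ → Prop} {R : ℕ → ℕ → Prop}
    (htb : s.reg .tb = a) (hfull : s.reg .full = M) (hn : s.reg .n = n) (hfin : s.reg .fin = fin)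
    (hdp : s.reg .dp = c) (hi : fin < n) (hc : c + M ≤ a) (hD : ∀ x < M, mem₀ (c + x) = ind (D x))
    (hR : Mat mem₀ s.mem a M n R) (hM : 0 < M) (hW : a + M * n + n < W)
    (hQ : ∀ s' : Store Var, (∀ e ∉ collect.writes, s'.reg e = s.reg e) →
      (∀ z < c, s'.mem z = mem₀ z) → (∀ x < M, s'.mem (c + x) = ind (D x ∨ R x fin)) → Q s') :
    Runs W collect s (M * 30 + 20) Q := by
  have hMn := Nat.le_mul_of_pos_left n hM
  have hMn' := Nat.le_mul_of_pos_right M (Nat.zero_lt_of_lt hi)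
  apply Runs.mono (R := fun s' => (∀ z < c, s'.mem z = mem₀ z) ∧
    (∀ x < M, s'.mem (c + x) = ind (D x ∨ R x fin)))
  · unfold collect
    apply Runs.assign_seq (by simp [htb, hfin]; omega)
    apply Runs.for_ (T := 25) (fun j s' => s'.reg .w = a + j * n + fin ∧
      (∀ z, z < c ∨ c + M ≤ z → s'.mem z = s.mem z) ∧
      ∀ x < M, s'.mem (c + x) = ind (D x ∨ x < j ∧ R x fin)) M
      (by simp [hfull]) (by decide) (by decide) (by decide)
    · refine ⟨by simp [htb, hfin], fun z _ => rfl, fun x hx => ?_⟩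
      simp only [Store.set_mem]
      rw [hR.outside _ (.inl (by omega)), hD x hx]
      simp
    · rintro j hj s1 ⟨hw, ho, hcov⟩ hj1 hf
      have f1 : s1.reg .n = n := by rw [hf _ (by decide)]; simp [hn]
      have f3 : s1.reg .dp = c := by rw [hf _ (by decide)]; simp [hdp]
      have hle : (j + 1) * n ≤ M * n := Nat.mul_le_mul_right _ hj
      rw [Nat.succ_mul] at hle
      have hv : s1.mem (a + j * n + fin) = ind (R j fin) := by
        rw [ho _ (.inr (by omega)), hR.cell j hj fin hi]
      have hsame (h : ¬ R j fin) (x : ℕ) : (x < j ∧ R x fin) ↔ (x < j + 1 ∧ R x fin) := by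
        constructor
        · rintro ⟨h1, h2⟩
          exact ⟨by omega, h2⟩
        · rintro ⟨h1, h2⟩
          rcases Nat.lt_succ_iff_lt_or_eq.1 h1 with h1 | rfl
          · exact ⟨h1, h2⟩
          · exact absurd h2 h
      apply Runs.le
      · apply Runs.seq (R := fun s' => (∀ z, z < c ∨ c + M ≤ z → s'.mem z = s.mem z) ∧
          ∀ x < M, s'.mem (c + x) = ind (D x ∨ x < j + 1 ∧ R x fin))
        · apply Runs.ite (T := 8) (by simp; omega) (by simp)
          · intro h
            simp only [Expr.eval, hw, hv, ind_pos] at h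
            apply Runs.le
            · apply Runs.store (by simp [f3, hj1]; omega) (by simp; omega)
              refine ⟨fun z hz => ?_, fun x hx => ?_⟩
              · simp only [Store.put_mem, Expr.eval, f3, hj1]
                rw [if_neg (by omega), ho z hz]
              · simp only [Store.put_mem, Expr.eval, f3, hj1]
                split_ifs with h1
                · obtain rfl : x = j := by omega
                  simp [ind, h]
                · rw [hcov x hx]
                  congr 3
                  rw [Nat.lt_succ_iff_lt_or_eq]
                  simp [show x ≠ j by omega]
            · simp
          · intro h
            simp only [Expr.eval, hw, hv, ind_pos] at h
            apply Runs.le (Runs.skip _) (by omega)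
            refine ⟨ho, fun x hx => ?_⟩
            rw [hcov x hx, propext (hsame h x)]
        · rintro s2 f2 ⟨ho2, hcov2⟩
          have g1 : s2.reg .w = a + j * n + fin := by rw [f2 _ (by decide), hw]
          have g5 : s2.reg .n = n := by rw [f2 _ (by decide), f1]
          apply Runs.assign (by simp [g1, g5]; omega)
          exact ⟨by simp [g1, g5]; ring, ho2, hcov2⟩
      · simp
    · rintro s1 ⟨_, ho, hcov⟩ _ _
      refine ⟨fun z hz => ?_, fun x hx => ?_⟩
      · rw [ho z (.inl hz), hR.outside z (.inl (by omega))]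
      · rw [hcov x hx]
        simp [hx]
  · simp
    omega
  · exact fun s' f h => hQ s' f h.1 h.2

/-- Lets the current thread take part: from the sets covered by the threads before it to those
covered with its help. -/
def threadStep : Cmd Var :=
  .assign .ini (.get (.add (.var .ptr) (.lit 1))) ;;
  .assign .fin (.get (.add (.var .ptr) (.lit 2))) ;;
  .assign .mN (.lit 0) ;; .addMul .z .mN .m .N ;; initTable ;; positions ;; collect

/-- Tests whether the current interface sequence can be distributed among the threads. -/
def check : Cmd Var :=
  .clear .x .full .dp ;; .store (.var .dp) (.lit 1) ;; threads threadStep ;;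
  .ite (.lit 0) (.get (.sub (.add (.var .dp) (.var .full)) (.lit 1))) (.assign .ans (.lit 1)) .skip

theorem threadStep_runs {S : SMCP} {k : ℕ} {i : Fin S.t} {d : ℕ → Fin S.m}
    (h : Ready S k d s) (hat : AtThread S (S.inAddr S.t) i s)
    (hD : ∀ x < 2 ^ k, s.mem (coverAddr S k + x) = ind (S.cover d k i x)) (hk : 0 < k)
    (hW : arena S k < W)
    (hQ : ∀ s' : Store Var, (∀ e ∉ threadStep.writes, s'.reg e = s.reg e) →
      (∀ z < coverAddr S k, s'.mem z = s.mem z) →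
      (∀ x < 2 ^ k, s'.mem (coverAddr S k + x) = ind (S.cover d k (i + 1) x)) → Q s') :
    Runs W threadStep s (k * (2 ^ k * (S.b * (S.b * 30 + 60) + 150) + S.m * 40 + 200)) Q := by
  have hc : coverAddr S k = S.inAddr S.t + S.outPos S.t + k + 1 := rfl
  have hin := SMCP.inAddr_mono (S := S) (Nat.succ_le_of_lt i.2)
  rw [Nat.succ_eq_add_one, SMCP.inAddr_succ, SMCP.nn_fin] at hin
  have hnK : S.n i * S.m ≤ S.m * S.b := by rw [mul_comm]; exact Nat.mul_le_mul_left _ (n_le_b S i)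
  have hNN : S.n i * S.m * (S.n i * S.m) ≤ S.m * S.b * (S.m * S.b) := Nat.mul_le_mul hnK hnK
  have h2k : 0 < 2 ^ k := by positivity
  have hnb := n_le_b S i
  have hb' : 2 ^ k * S.n i ≤ 2 ^ k * S.b := Nat.mul_le_mul_left _ hnb
  have hn0 := n_pos S i
  have hm0 := m_pos S
  have e3 : S.m * (S.n i * S.m) ≤ S.n i * S.m * (S.n i * S.m) :=
    Nat.mul_le_mul_right _ (Nat.le_mul_of_pos_left _ hn0)
  have e4 : S.n i ≤ S.n i * S.m := Nat.le_mul_of_pos_right _ hm0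
  have e5 : S.n i * S.m ≤ S.n i * S.m * (S.n i * S.m) := Nat.le_mul_self _
  have hW' := hW
  rw [arena] at hW
  apply Runs.mono (R := fun s' => (∀ z < coverAddr S k, s'.mem z = s.mem z) ∧
    (∀ x < 2 ^ k, s'.mem (coverAddr S k + x) = ind (S.cover d k (i + 1) x)))
  · unfold threadStep
    apply Runs.assign_seq (by simp [hat.ptr]; omega)
    apply Runs.assign_seq (by simp [hat.ptr]; omega)
    apply Runs.assign_seq (by simp; omega)
    apply Runs.addMul_seq (by simp) (by simp) (by simp) (by simp) (by simp)
      0 S.m (S.n i * S.m) (by simp) (by simp [hat.m]) (by simp [hat.N]) (by omega)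
    intro s1 f1 m1 r1
    apply Runs.seq (R := fun s' => Mat s1.mem s'.mem (coverAddr S k + 2 ^ k) (2 ^ k) (S.n i)
      (S.reachTable i d (S.cover d k i) 0))
    · refine initTable_runs (a := coverAddr S k + 2 ^ k) (c := coverAddr S k) (M := 2 ^ k)
        (n := S.n i) (ini := (S.A i).init) (D := S.cover d k i) (by simp [f1, h.tb])
        (by simp [f1, h.full]) (by simp [f1, hat.n])
        (by simp [f1, hat.ptr, h.loaded.init_thread]) (by simp [f1, h.dp]) (Fin.is_lt _) le_rfl
        (by simpa [m1] using hD) (by omega) fun s' _ hM => hM.congr fun x _ p hp => ?_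
      constructor
      · rintro ⟨h1, rfl⟩
        exact ⟨hp, h1, rfl⟩
      · rintro ⟨_, h1, h2⟩
        exact ⟨h1, congrArg Fin.val h2⟩
    · intro s2 f2 hM
      have hf (e : Var) (he : e ∉ threadStep.writes) : s2.reg e = s.reg e := by
        rw [f2 e fun hm => he (by simp only [threadStep, Cmd.writes, List.mem_append]; tauto),
          f1 e (by rintro rfl; revert he; decide) (by rintro rfl; revert he; decide),
          Store.set_reg_ne _ _ (by rintro rfl; revert he; decide),
          Store.set_reg_ne _ _ (by rintro rfl; revert he; decide),
          Store.set_reg_ne _ _ (by rintro rfl; revert he; decide)]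
      have hfin : s2.reg .fin = (S.A i).final := by
        rw [f2 _ (by decide)]
        simp [f1, hat.ptr, h.loaded.final_thread]
      apply Runs.seq (R := fun s' => Mat s1.mem s'.mem (coverAddr S k + 2 ^ k) (2 ^ k) (S.n i)
        (S.reachTable i d (S.cover d k i) k))
      · refine positions_runs (mem₀ := s1.mem)
          (h.congr (fun e he => hf e ?_) fun z _ => by simp [m1])
          (hat.congr fun e he => hf e ?_) rfl hM ?_ hW' fun s' _ h => h
        · revert he; revert e; decide
        · revert he; revert e; decide
        · rw [f2 _ (by decide), r1, Nat.zero_add]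
      · intro s3 f3 hM3
        have hf3 (e : Var) (he : e ∉ threadStep.writes) : s3.reg e = s.reg e := by
          rw [f3 e fun hm => he (by simp only [threadStep, Cmd.writes, List.mem_append]; tauto),
            hf e he]
        refine collect_runs (a := coverAddr S k + 2 ^ k) (c := coverAddr S k) (M := 2 ^ k)
          (n := S.n i) (fin := (S.A i).final) (D := S.cover d k i) (by rw [hf3 _ (by decide), h.tb])
          (by rw [hf3 _ (by decide), h.full]) (by rw [hf3 _ (by decide), hat.n])
          (by rw [f3 _ (by decide), hfin]) (by rw [hf3 _ (by decide), h.dp]) (Fin.is_lt _) le_rfl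
          (by simpa [m1] using hD) hM3 h2k (by omega) fun s4 f4 h1 h2 => ⟨fun z hz => ?_,
            fun x hx => ?_⟩
        · rw [h1 z hz, m1]; rfl
        · rw [h2 x hx, SMCP.cover]
          congr 2
          refine propext ⟨?_, ?_⟩
          · rintro ⟨_, h⟩
            exact ⟨i.2, h⟩
          · rintro ⟨_, h⟩
            exact ⟨Fin.is_lt _, h⟩
  · have a1 : 2 ^ k * (S.n i * 10 + 30) ≤ 2 ^ k * (S.b * 10 + 30) := by gcongr
    have a2 : k * (2 ^ k * (S.n i * (S.n i * 30 + 40) + 60) + S.m * 20 + 70) ≤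
        k * (2 ^ k * (S.b * (S.b * 30 + 40) + 60) + S.m * 20 + 70) := by gcongr
    have a3 : 1 * (2 ^ k * (S.b * 10 + 30) + 2 ^ k * 30 + S.m * 10 + 100) ≤
        k * (2 ^ k * (S.b * 10 + 30) + 2 ^ k * 30 + S.m * 10 + 100) := Nat.mul_le_mul_right _ hk
    have a4 : k * (2 ^ k * (S.b * (S.b * 30 + 40) + 60) + S.m * 20 + 70) +
        k * (2 ^ k * (S.b * 10 + 30) + 2 ^ k * 30 + S.m * 10 + 100) ≤
        k * (2 ^ k * (S.b * (S.b * 30 + 60) + 150) + S.m * 40 + 200) := by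
      rw [← Nat.mul_add]
      apply Nat.mul_le_mul_left
      have : 2 ^ k * (S.b * (S.b * 30 + 40) + 60) + S.m * 20 + 70 +
        (2 ^ k * (S.b * 10 + 30) + 2 ^ k * 30 + S.m * 10 + 100) + 2 ^ k * (S.b * 10 + 30) +
          S.m * 10 + 30 = 2 ^ k * (S.b * (S.b * 30 + 60) + 150) + S.m * 40 + 200 := by ring
      omega
    simp
    omega
  · rintro s' f ⟨h1, h2⟩
    exact hQ s' f h1 h2

theorem check_runs {S : SMCP} {k : ℕ} {d : ℕ → Fin S.m} (h : Ready S k d s) (hk : 0 < k)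
    (hW : arena S k < W) {P : Prop} (hP : s.reg .ans = ind P)
    (hQ : ∀ s' : Store Var, (∀ e ∉ check.writes, s'.reg e = s.reg e) → Ready S k d s' →
      s'.reg .ans = ind (P ∨ S.Covers k d) → Q s') :
    Runs W check s (S.t * (k * (2 ^ k * (S.b * (S.b * 30 + 60) + 150) + S.m * 40 + 200) +
      80 * (S.m * S.b)) + 2 ^ k * 10 + 40) Q := by
  have hc : coverAddr S k = S.inAddr S.t + S.outPos S.t + k + 1 := rfl
  have h2k : 0 < 2 ^ k := by positivity
  have hW' := hW
  rw [arena] at hW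
  apply Runs.mono (R := fun s' => (∀ z < coverAddr S k, s'.mem z = s.mem z) ∧
    s'.reg .ans = ind (P ∨ S.Covers k d))
  · unfold check
    apply Runs.seq (R := fun s' => ∀ z, s'.mem z =
        if coverAddr S k ≤ z ∧ z < coverAddr S k + 2 ^ k then 0 else s.mem z)
    · exact clear_runs (by simp) (by simp) h.full h.dp (by omega) fun s' _ h => h
    · intro s1 f1 m1
      have hdp : s1.reg .dp = coverAddr S k := by rw [f1 _ (by decide), h.dp]
      apply Runs.store_seq (by simp) (by simp; omega)
      set s2 := s1.put ((Expr.var Var.dp).eval s1) ((Expr.lit 1).eval s1) with hs2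
      have m2 (z : ℕ) (hz : z < coverAddr S k) : s2.mem z = s.mem z := by
        rw [hs2, Store.put_mem, if_neg (by simp [hdp]; omega), m1, if_neg (by omega)]
      have hR : Ready S k d s2 := h.congr (fun e he => f1 e (by revert he; revert e; decide)) m2
      apply Runs.seq (T := S.t * (k * (2 ^ k * (S.b * (S.b * 30 + 60) + 150) + S.m * 40 + 200) +
          80 * (S.m * S.b)) + 10)
          (R := fun s' => (∀ z < coverAddr S k, s'.mem z = s.mem z) ∧
          ∀ x < 2 ^ k, s'.mem (coverAddr S k + x) = ind (S.cover d k S.t x))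
      · refine threads_runs (b := S.inAddr S.t) (fun i s' => Ready S k d s' ∧
          (∀ z < coverAddr S k, s'.mem z = s.mem z) ∧
          ∀ x < 2 ^ k, s'.mem (coverAddr S k + x) = ind (S.cover d k i x)) ?_ ?_ hR.toParams hR.base
          (by decide) (by omega) (by omega) ⟨hR, m2, ?_⟩ ?_ ?_
        · rintro j s s' ⟨h1, h2, h3⟩ h4 h5
          exact ⟨h1.congr (fun e he => h5 e (by revert he; revert e; decide)) fun z _ => by rw [h4],
            fun z hz => by rw [h4, h2 z hz], fun x hx => by rw [h4, h3 x hx]⟩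
        · rintro j s' ⟨h1, -, -⟩
          exact h1.loaded
        · intro x hx
          rw [hs2, Store.put_mem]
          simp only [Expr.eval, hdp, SMCP.cover]
          rcases Nat.eq_zero_or_pos x with rfl | hx0
          · simp [ind]
          · rw [if_neg (by omega), m1, if_pos (by omega)]
            simp [ind, hx0.ne']
        · rintro i s3 ⟨h1, h2, h3⟩ hat -
          apply threadStep_runs (d := d) h1 hat h3 hk hW'
          intro s4 f4 h4 h5
          exact ⟨h1.congr (fun e he => f4 e (by revert he; revert e; decide)) h4,
            fun z hz => by rw [h4 z hz, h2 z hz], h5⟩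
        · rintro s3 ⟨_, h1, h2⟩ _ _
          exact ⟨h1, h2⟩
      · rintro s3 f3 ⟨h1, h2⟩
        have g1 : s3.reg .dp = coverAddr S k := by rw [f3 _ (by decide)]; exact hdp
        have g2 : s3.reg .full = 2 ^ k := by
          rw [f3 _ (by decide)]
          exact hR.full
        have g3 : s3.reg .ans = ind P := by
          rw [f3 _ (by decide)]
          exact (f1 _ (by decide)).trans hP
        have e : coverAddr S k + 2 ^ k - 1 = coverAddr S k + (2 ^ k - 1) := by omega
        have hv : s3.mem (coverAddr S k + 2 ^ k - 1) = ind (S.Covers k d) := by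
          rw [e, h2 _ (by omega), propext (SMCP.cover_full_iff S d k)]
        apply Runs.ite (T := 3) (by simp; omega) (by simp [g1, g2]; omega)
        · intro hlt
          simp only [Expr.eval, g1, g2, hv, ind_pos] at hlt
          apply Runs.assign (by simp; omega)
          exact ⟨h1, by simp [ind, hlt]⟩
        · intro hlt
          simp only [Expr.eval, g1, g2, hv, ind_pos] at hlt
          apply Runs.le (Runs.skip _) (by omega)
          exact ⟨h1, by simp [hlt, g3]⟩
  · simp
    omega
  · rintro s' f ⟨h1, h2⟩
    exact hQ s' f (h.congr (fun e he => f e (by revert he; revert e; decide)) h1) h2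

/-! ### Running through all interface sequences -/

theorem SMCP.share_congr_letters {Q : Type} {d d' : ℕ → Q} {f : ℕ → ℕ} {i k : ℕ}
    (h : ∀ j ≤ k, d j = d' j) : share d f i k = share d' f i k := by
  induction k with
  | zero => rfl
  | succ k ih =>
    rw [share_succ, share_succ, ih fun j hj => h j (by omega), h k (by omega), h (k + 1) le_rfl]

theorem SMCP.Covers.congr {S : SMCP} {k : ℕ} {d d' : ℕ → Fin S.m} (h : S.Covers k d)
    (hd : ∀ j ≤ k, d j = d' j) : S.Covers k d' := by
  obtain ⟨f, hf, ha⟩ := h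
  exact ⟨f, hf, fun i => by rw [← SMCP.share_congr_letters hd]; exact ha i⟩

/-- The sequence of memory states with number `u`: the states between the first and the last one are
the digits of `u` in base `m`. -/
def SMCP.stateSeq (S : SMCP) (cs u j : ℕ) : Fin S.m :=
  if j = 0 then S.M.init else if j ≤ cs then ⟨u / S.m ^ (j - 1) % S.m, Nat.mod_lt _ (m_pos S)⟩
  else S.M.final

theorem SMCP.stateSeq_zero {S : SMCP} {cs u : ℕ} : S.stateSeq cs u 0 = S.M.init := rfl

theorem SMCP.stateSeq_last {S : SMCP} {cs u : ℕ} : S.stateSeq cs u (cs + 1) = S.M.final := by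
  simp [SMCP.stateSeq]

theorem SMCP.stateSeq_digit {S : SMCP} {cs u j : ℕ} (hj : j < cs) :
    (S.stateSeq cs u (j + 1) : ℕ) = u / S.m ^ j % S.m := by
  simp [SMCP.stateSeq, Nat.succ_le_of_lt hj]

theorem SMCP.exists_stateSeq {S : SMCP} {cs : ℕ} {d : ℕ → Fin S.m} (h0 : d 0 = S.M.init)
    (h1 : d (cs + 1) = S.M.final) : ∃ u < S.m ^ cs, ∀ j ≤ cs + 1, d j = S.stateSeq cs u j := by
  refine ⟨finFunctionFinEquiv fun j : Fin cs => d (j + 1), Fin.is_lt _, fun j hj => ?_⟩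
  rcases Nat.eq_zero_or_pos j with rfl | hj0
  · rw [h0, SMCP.stateSeq_zero]
  rcases Nat.lt_or_eq_of_le hj with hj | rfl
  · obtain ⟨j, rfl⟩ : ∃ l, j = l + 1 := ⟨j - 1, by omega⟩
    have hj' : j < cs := by omega
    apply Fin.ext
    rw [SMCP.stateSeq_digit hj']
    have := finFunctionFinEquiv_symm_apply_val (m := S.m) (n := cs)
      (finFunctionFinEquiv fun j : Fin cs => d (j + 1)) ⟨j, hj'⟩
    rw [← this, Equiv.symm_apply_apply]
  · rw [h1, SMCP.stateSeq_last]

theorem digit_add {m a c : ℕ} (hm : 0 < m) (hc : c ≤ 1) :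
    (a % m + c = m → (a + c) % m = 0 ∧ (a + c) / m = a / m + 1) ∧
    (a % m + c ≠ m → (a + c) % m = a % m + c ∧ (a + c) / m = a / m) := by
  have h := Nat.div_add_mod a m
  have h1 := Nat.mod_lt a hm
  have e : a + c = a % m + c + m * (a / m) := by omega
  constructor
  · intro h2
    rw [e, h2, Nat.add_mul_div_left _ _ hm, Nat.add_mul_mod_self_left, Nat.mod_self,
      Nat.div_self hm]
    omega
  · intro h2
    have h3 : a % m + c < m := by omega
    rw [e, Nat.add_mul_div_left _ _ hm, Nat.add_mul_mod_self_left, Nat.mod_eq_of_lt h3,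
      Nat.div_eq_of_lt h3, Nat.zero_add]
    exact ⟨rfl, rfl⟩

/-- Moves on to the next sequence of memory states, by adding one to its number. -/
def next : Cmd Var :=
  .assign .carry (.lit 1) ;;
  .for_ .j .cs (
    .assign .d (.add (.get (.add (.add (.var .dig) (.lit 1)) (.var .j))) (.var .carry)) ;;
    .assign .carry (.lit 0) ;;
    .ifEq (.var .d) (.var .m) (.assign .d (.lit 0) ;; .assign .carry (.lit 1)) ;;
    .store (.add (.add (.var .dig) (.lit 1)) (.var .j)) (.var .d))

theorem next_runs {S : SMCP} {cs u : ℕ} (h : Ready S (cs + 1) (S.stateSeq cs u) s)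
    (hcs : s.reg .cs = cs) (hW : arena S (cs + 1) < W) (hmW : S.m < W)
    (hQ : ∀ s' : Store Var, (∀ e ∉ next.writes, s'.reg e = s.reg e) →
      Ready S (cs + 1) (S.stateSeq cs (u + 1)) s' → Q s') :
    Runs W next s (cs * 60 + 10) Q := by
  have hc : coverAddr S (cs + 1) = S.inAddr S.t + S.outPos S.t + (cs + 1) + 1 := rfl
  have h2k : 0 < 2 ^ (cs + 1) := by positivity
  rw [arena] at hW
  have hdig := h.dig
  have hm := m_pos S
  obtain ⟨D, hD⟩ : ∃ D, D = S.inAddr S.t + S.outPos S.t := ⟨_, rfl⟩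
  rw [← hD] at hdig hc
  apply Runs.mono (R := fun s' => (∀ z, z < D + 1 ∨ D + 1 + cs ≤ z → s'.mem z = s.mem z) ∧
    ∀ j < cs, s'.mem (D + 1 + j) = (u + 1) / S.m ^ j % S.m)
  · unfold next
    apply Runs.assign_seq (by simp; omega)
    apply Runs.for_ (T := 55) (fun j s' => s'.reg .carry ≤ 1 ∧
      (u + 1) / S.m ^ j = u / S.m ^ j + s'.reg .carry ∧
      (∀ z, z < D + 1 ∨ D + 1 + j ≤ z → s'.mem z = s.mem z) ∧
      ∀ l < j, s'.mem (D + 1 + l) = (u + 1) / S.m ^ l % S.m) cs (by simp [hcs])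
      (by decide) (by decide) (by decide)
    · exact ⟨by simp, by simp, fun _ _ => rfl, fun _ h => absurd h (Nat.not_lt_zero _)⟩
    · rintro j hj s1 ⟨hc1, hcar, ho, hd⟩ hj1 hf
      have f1 : s1.reg .dig = D := by rw [hf _ (by decide)]; simp [hdig]
      have f2 : s1.reg .m = S.m := by rw [hf _ (by decide)]; simp [h.m]
      have hv : s1.mem (D + 1 + j) = u / S.m ^ j % S.m := by
        rw [ho _ (by omega), hD, add_right_comm, add_assoc, h.digits _ (by omega),
          SMCP.stateSeq_digit hj]
      obtain ⟨c1, c2⟩ := digit_add (a := u / S.m ^ j) hm hc1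
      have hlt := Nat.mod_lt (u / S.m ^ j) hm
      rw [← hcar, Nat.div_div_eq_div_mul, Nat.div_div_eq_div_mul, ← pow_succ] at c1 c2
      apply Runs.le
      · apply Runs.assign_seq (by simp [f1, hj1, hv]; omega)
        apply Runs.assign_seq (by simp; omega)
        apply Runs.seq (T := 2 * (2 + 2 + 1) + 6) (R := fun s' => s'.mem = s1.mem ∧
          s'.reg .carry ≤ 1 ∧ (u + 1) / S.m ^ (j + 1) = u / S.m ^ (j + 1) + s'.reg .carry ∧
          s'.reg .d = (u + 1) / S.m ^ j % S.m)
        · apply Runs.ifEq (T := 6) (by omega) (by simp) (by simp)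
          · intro he
            simp [f1, hj1, hv, f2] at he
            apply Runs.le
            · apply Runs.assign_seq (by simp; omega)
              apply Runs.assign (by simp; omega)
              simpa using ⟨(c1 he).2, (c1 he).1.symm⟩
            · simp
          · intro he
            simp [f1, hj1, hv, f2] at he
            simpa [f1, hj1, hv] using ⟨(c2 he).2, (c2 he).1.symm⟩
        · rintro s2 f ⟨m2, r1, r2, r3⟩
          have g1 : s2.reg .dig = D := by rw [f _ (by decide)]; simp [f1]
          have g2 : s2.reg .j = j := by rw [f _ (by decide)]; simp [hj1]
          apply Runs.store (by simp [g1, g2]; omega) (by simp)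
          refine ⟨by simpa using r1, by simpa using r2, fun z hz => ?_, fun l hl => ?_⟩
          · simp only [Store.set_mem, Store.put_mem, Expr.eval, g1, g2]
            rw [if_neg (by omega), m2, ho z (by omega)]
          · simp only [Store.set_mem, Store.put_mem, Expr.eval, g1, g2]
            split_ifs with he
            · obtain rfl : l = j := by omega
              exact r3
            · rw [m2, hd l (by omega)]
      · simp
    · rintro s1 ⟨_, _, ho, hd⟩ _ _
      exact ⟨ho, hd⟩
  · simp
    omega
  · rintro s' f ⟨ho, hd⟩
    refine hQ s' f (h.congr_digits (fun e he => f e (by revert he; revert e; decide))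
      (fun z hz => ho z (by omega)) fun j hj => ?_)
    rw [← hD]
    rcases Nat.eq_zero_or_pos j with rfl | hj0
    · rw [ho _ (by omega), hD, h.digits 0 hj]
      rfl
    rcases Nat.lt_or_eq_of_le hj with hj | rfl
    · obtain ⟨j, rfl⟩ : ∃ l, j = l + 1 := ⟨j - 1, by omega⟩
      rw [SMCP.stateSeq_digit (by omega), ← hd j (by omega), add_assoc, add_comm 1 j]
    · rw [ho _ (by omega), hD, h.digits _ le_rfl, SMCP.stateSeq_last, SMCP.stateSeq_last]

/-- Lays out the memory for sequences of length `k = cs + 1`, computes `2 ^ k` and the number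
`m ^ cs` of sequences, and writes down the sequence with number `0`. -/
def setup : Cmd Var :=
  .assign .ans (.lit 0) ;; .assign .k (.add (.var .cs) (.lit 1)) ;;
  .assign .full (.lit 1) ;; .for_ .x .k (.assign .full (.add (.var .full) (.var .full))) ;;
  .assign .cnt (.lit 1) ;; .for_ .x .cs (
    .assign .tmp (.lit 0) ;; .addMul .z .tmp .m .cnt ;; .assign .cnt (.var .tmp)) ;;
  .assign .dig (.var .bp) ;; .assign .dp (.add (.add (.var .dig) (.var .k)) (.lit 1)) ;;
  .assign .tb (.add (.var .dp) (.var .full)) ;;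
  .store (.var .dig) (.var .q0) ;; .assign .w (.add (.var .dig) (.lit 1)) ;; .clear .x .cs .w ;;
  .store (.add (.var .dig) (.var .k)) (.var .qf)

theorem setup_runs {S : SMCP} {cs : ℕ} (h : Prepared S s) (hcs : s.reg .cs = cs)
    (hW : arena S (cs + 1) < W) (hmW : S.m ^ cs < W)
    (hQ : ∀ s' : Store Var, (∀ e ∉ setup.writes, s'.reg e = s.reg e) →
      Ready S (cs + 1) (S.stateSeq cs 0) s' → s'.reg .ans = 0 → s'.reg .cnt = S.m ^ cs → Q s') :
    Runs W setup s ((cs + 1) * (S.m * 10 + 100)) Q := by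
  have hc : coverAddr S (cs + 1) = S.inAddr S.t + S.outPos S.t + (cs + 1) + 1 := rfl
  have h2k : 0 < 2 ^ (cs + 1) := by positivity
  rw [arena] at hW
  have hm := m_pos S
  obtain ⟨D, hD⟩ : ∃ D, D = S.inAddr S.t + S.outPos S.t := ⟨_, rfl⟩
  rw [← hD] at hc
  have hbp : s.reg .bp = D := by rw [h.bp, hD]
  apply Runs.mono (R := fun s' => (∀ z < D, s'.mem z = s.mem z) ∧ s'.mem D = S.M.init ∧
    (∀ j < cs, s'.mem (D + 1 + j) = 0) ∧ s'.mem (D + (cs + 1)) = S.M.final ∧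
    s'.reg .ans = 0 ∧ s'.reg .cnt = S.m ^ cs ∧ s'.reg .k = cs + 1 ∧ s'.reg .full = 2 ^ (cs + 1) ∧
    s'.reg .dig = D ∧ s'.reg .dp = coverAddr S (cs + 1) ∧
    s'.reg .tb = coverAddr S (cs + 1) + 2 ^ (cs + 1))
  · unfold setup
    apply Runs.assign_seq (by simp; omega)
    apply Runs.assign_seq (by simp [hcs]; omega)
    apply Runs.assign_seq (by simp; omega)
    apply Runs.seq (R := fun s' => s'.mem = s.mem ∧ s'.reg .full = 2 ^ (cs + 1))
    · apply Runs.for_ (T := 7) (fun j s' => s'.mem = s.mem ∧ s'.reg .full = 2 ^ j) (cs + 1)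
        (by simp [hcs]) (by decide) (by decide) (by decide)
      · simp
      · rintro j hj s1 ⟨m1, r1⟩ - -
        have h2j : 2 ^ (j + 1) ≤ 2 ^ (cs + 1) := Nat.pow_le_pow_right (by omega) hj
        rw [pow_succ] at h2j
        apply Runs.assign (by simp [r1]; omega)
        exact ⟨by simp [m1], by simp [r1]; ring⟩
      · exact fun s1 h _ _ => h
    rintro s1 f1 ⟨m1, r1⟩
    have g1 (e : Var) (he : e ≠ .ans) (he' : e ≠ .k) (he'' : e ∉ [Var.full, .x]) :
        s1.reg e = s.reg e := by
      simp only [List.mem_cons, List.not_mem_nil, or_false, not_or] at he''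
      rw [f1 e (by simp [he''])]
      simp [he, he', he'']
    have k1 : s1.reg .k = cs + 1 := by rw [f1 _ (by decide)]; simp [hcs]
    have a1 : s1.reg .ans = 0 := by rw [f1 _ (by decide)]; simp
    apply Runs.assign_seq (by simp; omega)
    apply Runs.seq (R := fun s' => s'.mem = s.mem ∧ s'.reg .cnt = S.m ^ cs)
    · apply Runs.for_ (T := S.m * 10 + 10) (fun j s' => s'.mem = s.mem ∧ s'.reg .cnt = S.m ^ j) cs
        (by simp [g1, hcs]) (by decide) (by decide) (by decide)
      · simp [m1]
      · rintro j hj s2 ⟨m2, r2⟩ - hf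
        have f2 : s2.reg .m = S.m := by rw [hf _ (by decide)]; simp [g1, h.m]
        have hmj : S.m ^ (j + 1) ≤ S.m ^ cs := Nat.pow_le_pow_right hm hj
        rw [pow_succ, mul_comm] at hmj
        apply Runs.le
        · apply Runs.assign_seq (by simp; omega)
          apply Runs.addMul_seq (by simp) (by simp) (by simp) (by simp) (by simp)
            0 S.m (S.m ^ j) (by simp) (by simp [f2]) (by simp [r2]) (by omega)
          intro s3 f3 m3 r3
          apply Runs.assign (by simp)
          exact ⟨by simp [m3, m2], by simp [r3]; ring⟩
        · simp
          omega
      · exact fun s1 h _ _ => h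
    rintro s2 f2 ⟨m2, r2⟩
    have g2 (e : Var) (he : e ∉ [Var.cnt, .x, .tmp, .z]) : s2.reg e = s1.reg e := by
      simp only [List.mem_cons, List.not_mem_nil, or_false, not_or] at he
      rw [f2 e (by simp [Cmd.addMul, he])]
      simp [he]
    apply Runs.assign_seq (by simp)
    apply Runs.assign_seq (by simp [g2, g1, hbp, k1]; omega)
    apply Runs.assign_seq (by simp [g2, g1, hbp, k1, r1]; omega)
    apply Runs.store_seq (by simp) (by simp)
    apply Runs.assign_seq (by simp [g2, g1, hbp]; omega)
    apply Runs.seq (R := fun s' => (∀ z < D, s'.mem z = s.mem z) ∧ s'.mem D = S.M.init ∧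
      (∀ j < cs, s'.mem (D + 1 + j) = 0))
    · refine clear_runs (n := cs) (a := D + 1) (by simp) (by simp) (by simp [g2, g1, hcs])
        (by simp [g2, g1, hbp]) (by omega) ?_
      intro s3 _ m3
      refine ⟨fun z hz => ?_, ?_, fun j hj => ?_⟩
      · rw [m3, if_neg (by omega)]
        simp [Store.put_mem, g2, g1, hbp, m2, hz.ne]
      · rw [m3, if_neg (by omega)]
        simp [Store.put_mem, g2, g1, hbp, h.q0]
      · rw [m3, if_pos (by omega)]
    · rintro s3 f3 ⟨n1, n2, n3⟩
      have g3 (e : Var) (he : e ≠ .x) := f3 e (by simpa [Cmd.clear] using he)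
      apply Runs.store (by simp [g3, g2, g1, hbp, k1]; omega) (by simp)
      refine ⟨fun z hz => ?_, ?_, fun j hj => ?_, ?_, ?_⟩
      · simp [Store.put_mem, g3, g2, g1, hbp, k1, n1 z hz]
        omega
      · simp [Store.put_mem, g3, g2, g1, hbp, k1, n2]
      · simp [Store.put_mem, g3, g2, g1, hbp, k1, n3 j hj]
        omega
      · simp [Store.put_mem, g3, g2, g1, hbp, k1, h.qf]
      · simp [g3, g2, g1, hbp, k1, a1, r1, r2, hc, add_assoc]
  · simp
    ring_nf
    omega
  · rintro s' f ⟨h1, h2, h3, h4, h5, h6, h7, h8, h9, h10, h11⟩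
    refine hQ s' f ⟨h.toParams.congr fun e he => f e (by revert he; revert e; decide),
      by rw [f _ (by decide), h.base], h7, h8, by rw [h9, hD], h10, h11,
      h.loaded.congr fun z hz => h1 z (by omega), fun i => ?_, fun j hj => ?_⟩ h5 h6
    · have hout := SMCP.outPos_mono (S := S) (Nat.succ_le_of_lt i.2)
      rw [Nat.succ_eq_add_one, SMCP.outPos_succ, SMCP.nn_fin] at hout
      exact tableAt_congr (h.table i) fun z _ hz => h1 z (by omega)
    · rw [← hD]
      rcases Nat.eq_zero_or_pos j with rfl | hj0
      · exact h2
      rcases Nat.lt_or_eq_of_le hj with hj | rfl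
      · obtain ⟨j, rfl⟩ : ∃ l, j = l + 1 := ⟨j - 1, by omega⟩
        rw [SMCP.stateSeq_digit (by omega), add_comm j 1, ← add_assoc, h3 j (by omega)]
        simp
      · rw [h4, SMCP.stateSeq_last]

/-- The program for bounded context switching. The answer is also positive if the memory accepts the
empty interface sequence. -/
def solve : Cmd Var :=
  prep ;; setup ;; .for_ .u .cnt (check ;; next) ;;
  .ifEq (.var .q0) (.var .qf) (.assign .ans (.lit 1)) ;; .assign .cs (.var .ans)

theorem solve_runs {S : SMCP} {cs : ℕ} (ht : 0 < S.t) (hL : S.Loaded s.mem) (hcs : s.reg .cs = cs)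
    (hW : space S < W) (hW' : arena S (cs + 1) < W) (hmW : S.m ^ cs < W)
    (hQ : ∀ s' : Store Var, s'.reg .cs = ind (S.HasBCS cs) → Q s') :
    Runs W solve s (1000 * S.prepTime + (cs + 1) * (S.m * 10 + 100) +
      S.m ^ cs * (S.t * ((cs + 1) * (2 ^ (cs + 1) * (S.b * (S.b * 30 + 60) + 150) + S.m * 40 + 200) +
        80 * (S.m * S.b)) + 2 ^ (cs + 1) * 10 + (cs * 60) + 60) + 40) Q := by
  have hm := m_pos S
  have hK : S.m ≤ S.m * S.b := Nat.le_mul_of_pos_right _ (b_pos ht)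
  have hmW1 : S.m < W := by rw [space] at hW; omega
  apply Runs.le
  · unfold solve
    apply Runs.seq (R := Prepared S)
    · exact prep_runs ht hL hW fun s' _ h => h
    rintro s1 f1 h1
    have hcs1 : s1.reg .cs = cs := by rw [f1 _ (by decide), hcs]
    apply Runs.seq (R := fun s' => Ready S (cs + 1) (S.stateSeq cs 0) s' ∧ s'.reg .ans = 0 ∧
      s'.reg .cnt = S.m ^ cs)
    · exact setup_runs h1 hcs1 hW' hmW fun s' _ h2 h3 h4 => ⟨h2, h3, h4⟩
    rintro s2 f2 ⟨h2, hans, hcnt⟩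
    have hcs2 : s2.reg .cs = cs := by rw [f2 _ (by decide), hcs1]
    apply Runs.seq (R := fun s' => s'.reg .ans =
      ind (∃ u < S.m ^ cs, S.Covers (cs + 1) (S.stateSeq cs u)))
    · apply Runs.for_ (fun u s' => Ready S (cs + 1) (S.stateSeq cs u) s' ∧ s'.reg .ans =
        ind (∃ u' < u, S.Covers (cs + 1) (S.stateSeq cs u'))) (S.m ^ cs) hcnt
        (by decide) (by decide) (by decide)
      · refine ⟨h2.congr (fun e he => Store.set_reg_ne _ _ (by rintro rfl; revert he; decide))
          fun _ _ => rfl, ?_⟩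
        simp [hans, ind]
      · rintro u hu s3 ⟨h3, ha⟩ hu3 hf
        apply Runs.seq (R := fun s' => Ready S (cs + 1) (S.stateSeq cs u) s' ∧ s'.reg .ans =
          ind ((∃ u' < u, S.Covers (cs + 1) (S.stateSeq cs u')) ∨
            S.Covers (cs + 1) (S.stateSeq cs u)))
        · exact check_runs h3 (Nat.succ_pos _) hW' ha fun s' _ h4 h5 => ⟨h4, h5⟩
        · rintro s4 f4 ⟨h4, h5⟩
          apply next_runs h4 (by rw [f4 _ (by decide), hf _ (by decide), hcs2]) hW' hmW1
          intro s5 f5 h6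
          refine ⟨h6.congr (fun e he => Store.set_reg_ne _ _ (by rintro rfl; revert he; decide))
            fun _ _ => rfl, ?_⟩
          rw [Store.set_reg_ne _ _ (by decide), f5 _ (by decide), h5]
          congr 1
          refine propext ⟨?_, ?_⟩
          · rintro (⟨u', h7, h8⟩ | h7)
            · exact ⟨u', by omega, h8⟩
            · exact ⟨u, by omega, h7⟩
          · rintro ⟨u', h7, h8⟩
            rcases Nat.lt_succ_iff_lt_or_eq.1 h7 with h7 | rfl
            · exact .inl ⟨u', h7, h8⟩
            · exact .inr h8
      · rintro s3 ⟨_, h⟩ _ _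
        exact h
    rintro s3 f3 h3
    have hq0 : s3.reg .q0 = S.M.init := by rw [f3 _ (by decide), f2 _ (by decide), h1.q0]
    have hqf : s3.reg .qf = S.M.final := by rw [f3 _ (by decide), f2 _ (by decide), h1.qf]
    have hiff : S.HasBCS cs ↔ S.M.init = S.M.final ∨
        ∃ u < S.m ^ cs, S.Covers (cs + 1) (S.stateSeq cs u) := by
      rw [SMCP.hasBCS_iff_covers S cs ht]
      refine or_congr_right ⟨?_, ?_⟩
      · rintro ⟨d, hd0, hd1, hd⟩
        obtain ⟨u, hu, he⟩ := SMCP.exists_stateSeq hd0 hd1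
        exact ⟨u, hu, hd.congr he⟩
      · rintro ⟨u, _, hd⟩
        exact ⟨_, SMCP.stateSeq_zero, SMCP.stateSeq_last, hd⟩
    apply Runs.seq (R := fun s' => s'.reg .ans = ind (S.HasBCS cs))
    · apply Runs.ifEq (T := 3) (by omega) (by simp) (by simp)
      · intro h
        simp only [Expr.eval, hq0, hqf] at h
        apply Runs.assign (by simp; omega)
        have : S.HasBCS cs := hiff.2 (.inl (Fin.ext h))
        simp [ind, this]
      · intro h
        simp only [Expr.eval, hq0, hqf] at h
        rw [h3, propext hiff, propext (or_iff_right fun e => h (congrArg Fin.val e))]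
    · intro s4 _ h4
      apply Runs.assign (by simp)
      apply hQ
      simp [h4]
  · have e : S.m ^ cs * (S.t * ((cs + 1) * (2 ^ (cs + 1) * (S.b * (S.b * 30 + 60) + 150) +
        S.m * 40 + 200) + 80 * (S.m * S.b)) + 2 ^ (cs + 1) * 10 + 40 + (cs * 60 + 10) + 3) ≤
        S.m ^ cs * (S.t * ((cs + 1) * (2 ^ (cs + 1) * (S.b * (S.b * 30 + 60) + 150) + S.m * 40 +
        200) + 80 * (S.m * S.b)) + 2 ^ (cs + 1) * 10 + (cs * 60) + 60) :=
      Nat.mul_le_mul_left _ (by omega)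
    simp
    omega

/-! ### Running times -/

theorem prepTime_eq (S : SMCP) :
    S.prepTime = S.t * ((S.m * S.b) ^ 3 + S.s * (S.m * S.b) ^ 2) := by
  rw [SMCP.prepTime]; ring

theorem le_prepTime {S : SMCP} (ht : 0 < S.t) : 1 ≤ S.prepTime ∧ S.t ≤ S.prepTime ∧
    S.s ≤ S.prepTime ∧ (S.m * S.b) ^ 2 ≤ S.prepTime ∧ S.m * S.b ≤ S.prepTime ∧
    S.t * (S.m * S.b) ^ 2 + S.t * (S.s * (S.m * S.b) ^ 2) ≤ S.prepTime := by
  obtain ⟨K, hK⟩ : ∃ K, K = S.m * S.b := ⟨_, rfl⟩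
  have hK1 : 1 ≤ K := by rw [hK]; exact Nat.mul_pos (m_pos S) (b_pos ht)
  have h1 : K ^ 2 ≤ K ^ 3 := Nat.pow_le_pow_right hK1 (by omega)
  have h2 : K ≤ K ^ 2 := Nat.le_self_pow (by omega) K
  have h3 : S.s ≤ S.s * K ^ 2 := Nat.le_mul_of_pos_right _ (by positivity)
  have h4 : K ^ 3 + S.s * K ^ 2 ≤ S.t * (K ^ 3 + S.s * K ^ 2) := Nat.le_mul_of_pos_left _ ht
  have h5 : S.t * 1 ≤ S.t * (K ^ 3 + S.s * K ^ 2) := Nat.mul_le_mul_left _ (by omega)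
  have h6 : S.t * (K ^ 2 + S.s * K ^ 2) ≤ S.t * (K ^ 3 + S.s * K ^ 2) :=
    Nat.mul_le_mul_left _ (by omega)
  rw [Nat.mul_add S.t (K ^ 2)] at h6
  rw [prepTime_eq, ← hK]
  refine ⟨?_, ?_, ?_, ?_, ?_, h6⟩ <;> omega

theorem outPos_le (S : SMCP) : S.outPos S.t ≤ S.t * (S.m * S.b) ^ 2 := by
  have : ∀ j ∈ Finset.range S.t, S.nn j * S.m * (S.nn j * S.m) ≤ (S.m * S.b) ^ 2 := by
    intro j hj
    rw [SMCP.nn_of_lt (Finset.mem_range.1 hj), sq, mul_comm (S.n _)]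
    have := n_le_b S ⟨j, Finset.mem_range.1 hj⟩
    gcongr
  simpa [SMCP.outPos] using Finset.sum_le_card_nsmul _ _ _ this

theorem inAddr_le {S : SMCP} (ht : 0 < S.t) : S.inAddr S.t ≤ 10 * S.prepTime := by
  have hm := m_pos S
  have hb := b_pos ht
  obtain ⟨h1, h2, -, -, -, h6⟩ := le_prepTime ht
  have h : ∀ j ∈ Finset.range S.t, 3 + S.nn j * (S.s * S.nn j) ≤ 3 + S.s * (S.m * S.b) ^ 2 := by
    intro j hj
    rw [SMCP.nn_of_lt (Finset.mem_range.1 hj)]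
    have h1 := n_le_b S ⟨j, Finset.mem_range.1 hj⟩
    have h2 : S.b ≤ S.m * S.b := Nat.le_mul_of_pos_left _ hm
    have h3 := Nat.mul_le_mul (h1.trans h2) (h1.trans h2)
    have h4 := Nat.mul_le_mul_left S.s h3
    rw [← sq (S.m * S.b)] at h4
    have e : S.n ⟨j, Finset.mem_range.1 hj⟩ * (S.s * S.n ⟨j, Finset.mem_range.1 hj⟩) =
      S.s * (S.n ⟨j, Finset.mem_range.1 hj⟩ * S.n ⟨j, Finset.mem_range.1 hj⟩) := by ring
    omega
  have h3 := Finset.sum_le_card_nsmul _ _ _ h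
  rw [Finset.card_range, smul_eq_mul, Nat.mul_add] at h3
  have h4 : S.m * (S.s * S.m) ≤ S.t * (S.s * (S.m * S.b) ^ 2) := by
    calc S.m * (S.s * S.m) = 1 * (S.s * (S.m * 1) ^ 2) := by ring
      _ ≤ S.t * (S.s * (S.m * S.b) ^ 2) := by gcongr <;> omega
  rw [SMCP.inAddr]
  omega

theorem space_le {S : SMCP} (ht : 0 < S.t) : space S ≤ 33 * S.prepTime := by
  have h := inAddr_le ht
  have h' := outPos_le S
  obtain ⟨h1, -, -, -, h5, h6⟩ := le_prepTime ht
  rw [space]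
  omega

theorem encode_le {S : SMCP} (ht : 0 < S.t) {v : ℕ} (hv : v ∈ S.encode) : v ≤ S.prepTime := by
  obtain ⟨h1, h2, h3, -, h5, -⟩ := le_prepTime ht
  have hm : S.m ≤ S.m * S.b := Nat.le_mul_of_pos_right _ (b_pos ht)
  have hb : S.b ≤ S.m * S.b := Nat.le_mul_of_pos_left _ (m_pos S)
  have htab {α σ : Type} (L : List α) (l : List σ) (A : Automaton α σ) (h : v ∈ table L l A) :
      v ≤ 1 := by
    simp only [table, List.mem_flatMap, List.mem_map] at h
    obtain ⟨_, _, _, _, _, _, rfl⟩ := h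
    split_ifs <;> omega
  simp only [SMCP.encode, List.mem_append, List.mem_cons, List.not_mem_nil, or_false,
    List.mem_flatMap] at hv
  rcases hv with ((rfl | rfl | rfl | rfl | rfl) | h) | ⟨i, -, (rfl | rfl | rfl) | h⟩
  · exact h3
  · omega
  · exact h2
  · have := S.M.init.2; omega
  · have := S.M.final.2; omega
  · have := htab _ _ _ h; omega
  · have := n_le_b S i; omega
  · have := n_le_b S i; have := (S.A i).init.2; omega
  · have := n_le_b S i; have := (S.A i).final.2; omega
  · have := htab _ _ _ h; omega

/-- The time for testing one interface sequence of length `k`. -/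
def checkTime (S : SMCP) (k : ℕ) : ℕ := 2 ^ k * S.t * k * S.m * S.b ^ 2

theorem arena_le {S : SMCP} (ht : 0 < S.t) (k : ℕ) (hk : 0 < k) :
    arena S k ≤ 13 * S.prepTime + 14 * checkTime S k := by
  have h := inAddr_le ht
  have h' := outPos_le S
  obtain ⟨h1, -, -, h4, -, h6⟩ := le_prepTime ht
  have hm := m_pos S
  have hb := b_pos ht
  have e1 : 2 ^ k * S.b ≤ checkTime S k := by
    calc 2 ^ k * S.b = 2 ^ k * 1 * 1 * 1 * S.b ^ 1 := by ring
      _ ≤ checkTime S k := by unfold checkTime; gcongr <;> omega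
  have e2 : 2 ^ k ≤ 2 ^ k * S.b := Nat.le_mul_of_pos_right _ hb
  have e3 : k < 2 ^ k := Nat.lt_two_pow_self
  rw [sq] at h4
  rw [arena, coverAddr]
  omega

theorem solve_time_le {S : SMCP} {cs : ℕ} (ht : 0 < S.t) :
    1000 * S.prepTime + (cs + 1) * (S.m * 10 + 100) +
      S.m ^ cs * (S.t * ((cs + 1) * (2 ^ (cs + 1) * (S.b * (S.b * 30 + 60) + 150) + S.m * 40 + 200) +
        80 * (S.m * S.b)) + 2 ^ (cs + 1) * 10 + (cs * 60) + 60) + 40 ≤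
    1000 * S.prepTime + 1000 * (S.m ^ cs * checkTime S (cs + 1)) := by
  have hm := m_pos S
  have hb := b_pos ht
  obtain ⟨k, hk⟩ : ∃ k, k = cs + 1 := ⟨_, rfl⟩
  have hk0 : 0 < k := by omega
  obtain ⟨X, hX⟩ : ∃ X, X = checkTime S k := ⟨_, rfl⟩
  have h2k : 1 ≤ 2 ^ k := Nat.one_le_two_pow
  have a1 : S.t * k * 2 ^ k * S.b ^ 2 ≤ X := by
    calc S.t * k * 2 ^ k * S.b ^ 2 = 2 ^ k * S.t * k * 1 * S.b ^ 2 := by ring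
      _ ≤ X := by rw [hX]; unfold checkTime; gcongr; omega
  have a2 : S.t * k * 2 ^ k * S.b ≤ X := by
    calc S.t * k * 2 ^ k * S.b = 2 ^ k * S.t * k * 1 * S.b ^ 1 := by ring
      _ ≤ X := by rw [hX]; unfold checkTime; gcongr <;> omega
  have a3 : S.t * k * 2 ^ k ≤ X := by
    calc S.t * k * 2 ^ k = 2 ^ k * S.t * k * 1 * 1 ^ 2 := by ring
      _ ≤ X := by rw [hX]; unfold checkTime; gcongr <;> omega
  have a4 : S.t * k * S.m ≤ X := by
    calc S.t * k * S.m = 1 * S.t * k * S.m * 1 ^ 2 := by ring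
      _ ≤ X := by rw [hX]; unfold checkTime; gcongr; omega
  have a5 : S.t * k ≤ S.t * k * S.m := Nat.le_mul_of_pos_right _ hm
  have a6 : S.t * (S.m * S.b) ≤ X := by
    calc S.t * (S.m * S.b) = 1 * S.t * 1 * S.m * S.b ^ 1 := by ring
      _ ≤ X := by rw [hX]; unfold checkTime; gcongr <;> omega
  have a7 : 2 ^ k ≤ X := by
    calc 2 ^ k = 2 ^ k * 1 * 1 * 1 * 1 ^ 2 := by ring
      _ ≤ X := by rw [hX]; unfold checkTime; gcongr <;> omega
  have a8 : k * S.m ≤ X := by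
    calc k * S.m = 1 * 1 * k * S.m * 1 ^ 2 := by ring
      _ ≤ X := by rw [hX]; unfold checkTime; gcongr <;> omega
  have a9 : k ≤ k * S.m := Nat.le_mul_of_pos_right _ hm
  have e1 : S.t * (k * (2 ^ k * (S.b * (S.b * 30 + 60) + 150) + S.m * 40 + 200) +
      80 * (S.m * S.b)) = 30 * (S.t * k * 2 ^ k * S.b ^ 2) + 60 * (S.t * k * 2 ^ k * S.b) +
      150 * (S.t * k * 2 ^ k) + 40 * (S.t * k * S.m) + 200 * (S.t * k) +
      80 * (S.t * (S.m * S.b)) := by ring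
  have e2 : k * (S.m * 10 + 100) = 10 * (k * S.m) + 100 * k := by ring
  have e3 : S.m ^ cs * (S.t * (k * (2 ^ k * (S.b * (S.b * 30 + 60) + 150) + S.m * 40 + 200) +
      80 * (S.m * S.b)) + 2 ^ k * 10 + (cs * 60) + 60) ≤ S.m ^ cs * (800 * X) := by
    apply Nat.mul_le_mul_left
    omega
  have e4 : S.m ^ cs * (800 * X) = 800 * (S.m ^ cs * X) := by ring
  have e5 : X ≤ S.m ^ cs * X := Nat.le_mul_of_pos_left _ (by positivity)
  rw [← hk, ← hX]
  omega

theorem solve_decides {S : SMCP} (cs : ℕ) (ht : 0 < S.t) : S.DecidedWithin cs solve.code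
    (1000 * S.prepTime + 1000 * (S.m ^ cs * checkTime S (cs + 1))) := by
  obtain ⟨h1, -⟩ := le_prepTime ht
  have hm := m_pos S
  have hb := b_pos ht
  have hs := space_le ht
  have ha := arena_le ht (cs + 1) (Nat.succ_pos _)
  have hX : 2 ^ (cs + 1) ≤ checkTime S (cs + 1) := by
    calc 2 ^ (cs + 1) = 2 ^ (cs + 1) * 1 * 1 * 1 * 1 ^ 2 := by ring
      _ ≤ checkTime S (cs + 1) := by unfold checkTime; gcongr <;> omega
  have hlt : cs + 1 < 2 ^ (cs + 1) := Nat.lt_two_pow_self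
  have e1 : checkTime S (cs + 1) ≤ S.m ^ cs * checkTime S (cs + 1) :=
    Nat.le_mul_of_pos_left _ (by positivity)
  have e2 : S.m ^ cs ≤ S.m ^ cs * checkTime S (cs + 1) := Nat.le_mul_of_pos_right _ (by omega)
  refine Runs.runsWithin (T := _) (solve_time_le ht) (by omega) (by omega)
    (fun v hv => by have := encode_le ht hv; omega) ?_
  refine solve_runs (cs := cs) ht (SMCP.loaded_start cs) rfl (by omega) (by omega)
    (by omega) fun s' h σ hσ => ?_
  have h0 : σ.reg 0 = ind (S.HasBCS cs) := by rw [← h, ← hσ]; rfl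
  constructor
  · intro h
    simp [h0, ind, h]
  · intro h
    simp [h0, ind, h]

theorem prep_computes {S : SMCP} (ht : 0 < S.t) :
    S.BComputedWithin (prep ;; .assign .cs (.var .base)).code (2000 * S.prepTime) := by
  obtain ⟨h1, -⟩ := le_prepTime ht
  have hs := space_le ht
  refine Runs.runsWithin (T := 1000 * S.prepTime + 4) (by omega) (by omega) (by omega)
    (fun v hv => by have := encode_le ht hv; omega) ?_
  refine Runs.seq (R := Prepared S) (prep_runs ht (SMCP.loaded_start 0) (by omega)
    fun s' _ h => h) ?_
  intro s1 _ h
  apply Runs.assign (by simp)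
  intro σ hσ
  have h0 : σ.reg 0 = S.inAddr S.t := by
    have : (view σ : Store Var).reg .cs = S.inAddr S.t := by simp [hσ, h.base]
    exact this
  have hm : σ.mem = s1.mem := congrArg Store.mem hσ
  rw [h0, hm]
  exact SMCP.seg_encodeB h.table

theorem b_le_instanceSize (S : SMCP) (cs : ℕ) : S.b ≤ S.instanceSize cs := by
  have h : S.b ≤ ∑ i, (S.A i).size := Finset.sup_le fun i hi =>
    Finset.single_le_sum (f := fun i => (S.A i).size) (fun _ _ => Nat.zero_le _) hi
  rw [SMCP.instanceSize]
  omega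

theorem time_le_bcsTime (S : SMCP) (cs : ℕ) :
    1000 * S.prepTime + 1000 * (S.m ^ cs * checkTime S (cs + 1)) ≤ 1000 * S.bcsTime 0 cs := by
  have e : S.m ^ cs * checkTime S (cs + 1) =
      S.m ^ (cs + 1) * (2 ^ (cs + 1) * S.t * (cs + 1) * S.b ^ 2) := by
    rw [checkTime]; ring
  have h : S.m ^ (cs + 1) * (2 ^ (cs + 1) * S.t * (cs + 1) * S.b ^ 2) ≤
      S.m ^ (cs + 1) * SM 0 S.b (cs + 1) S.t := by
    unfold SM
    gcongr
    omega
  rw [SMCP.bcsTime, e]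
  omega

theorem time_le_poly (S : SMCP) (cs : ℕ) :
    1000 * S.prepTime + 1000 * (S.m ^ cs * checkTime S (cs + 1)) ≤
      S.m ^ cs * 2 ^ cs * (1000 * (.X ^ 7 + .X ^ 6 + 2 * .X ^ 4 * (.X + 1)) :
        Polynomial ℕ).eval (S.instanceSize cs) := by
  have hb := b_le_instanceSize S cs
  obtain ⟨N, hN⟩ : ∃ N, N = S.instanceSize cs := ⟨_, rfl⟩
  rw [← hN] at hb
  rw [SMCP.instanceSize] at hN
  have hs : S.s ≤ N := by omega
  have hm : S.m ≤ N := by omega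
  have ht : S.t ≤ N := by omega
  have hc : cs ≤ N := by omega
  have h1 : S.prepTime ≤ N ^ 7 + N ^ 6 := by
    calc S.prepTime ≤ N * N ^ 3 * N ^ 3 + N * N * N ^ 2 * N ^ 2 := by
          unfold SMCP.prepTime; gcongr
      _ = N ^ 7 + N ^ 6 := by ring
  have h2 : S.m ^ cs * checkTime S (cs + 1) ≤ S.m ^ cs * 2 ^ cs * (2 * N ^ 4 * (N + 1)) := by
    calc S.m ^ cs * checkTime S (cs + 1) =
          S.m ^ cs * 2 ^ cs * (2 * (S.t * S.m * S.b ^ 2) * (cs + 1)) := by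
            rw [checkTime]; ring
      _ ≤ S.m ^ cs * 2 ^ cs * (2 * (N * N * N ^ 2) * (N + 1)) := by gcongr
      _ = S.m ^ cs * 2 ^ cs * (2 * N ^ 4 * (N + 1)) := by ring
  have h3 : S.prepTime ≤ S.m ^ cs * 2 ^ cs * (N ^ 7 + N ^ 6) :=
    h1.trans (Nat.le_mul_of_pos_left _ (by have := m_pos S; positivity))
  have e : S.instanceSize cs = N := by rw [hN]; rfl
  simp only [e, Polynomial.eval_mul, Polynomial.eval_add, Polynomial.eval_pow, Polynomial.eval_X,
    Polynomial.eval_ofNat, Polynomial.eval_one]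
  calc _ ≤ 1000 * (S.m ^ cs * 2 ^ cs * (N ^ 7 + N ^ 6)) +
        1000 * (S.m ^ cs * 2 ^ cs * (2 * N ^ 4 * (N + 1))) := by omega
    _ = _ := by ring

end BCS

theorem mainTheorem2 :
    -- `B_i` is an automaton for the interface language of thread `i`
    (∀ (S : BCS.SMCP) (i : Fin S.t), (S.B i).lang = S.interfaceLang i) ∧
    -- it suffices to test the valid interface sequences for membership in the shuffle
    (∀ (S : BCS.SMCP) (cs : ℕ), S.HasBCS cs ↔
      ∃ σ : List (Fin S.m × Fin S.m), σ.length ≤ cs + 1 ∧ S.Valid σ ∧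
        σ ∈ BCS.shuffle fun i => (S.B i).lang) ∧
    -- the automata `B_i` are computed in polynomial time
    (∃ (P : BCS.Prog) (C : ℕ), ∀ S : BCS.SMCP, 0 < S.t →
      S.BComputedWithin P (C * S.prepTime)) ∧
    -- the running time for bounded context switching, in both forms
    (∃ P : BCS.Prog,
      (∃ c C : ℕ, ∀ (S : BCS.SMCP) (cs : ℕ), 0 < S.t →
        S.DecidedWithin cs P (C * S.bcsTime c cs)) ∧
      (∃ p : Polynomial ℕ, ∀ (S : BCS.SMCP) (cs : ℕ), 0 < S.t →
        S.DecidedWithin cs P (S.m ^ cs * 2 ^ cs * p.eval (S.instanceSize cs)))) :=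
  ⟨BCS.SMCP.lang_B, BCS.SMCP.hasBCS_iff, ⟨_, 2000, fun _ => BCS.prep_computes⟩, BCS.solve.code,
    ⟨0, 1000, fun S cs ht => (BCS.solve_decides cs ht).mono (BCS.time_le_bcsTime S cs)⟩,
    ⟨_, fun S cs ht => (BCS.solve_decides cs ht).mono (BCS.time_le_poly S cs)⟩⟩
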